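/- Let $C$ be a smooth projective geometrically irreducible curve over the finite field $\mathbb F_q$ with function field $Q$, let $\infty\in C(\mathbb F_q)$, $A=\Gamma(C\setminus\{\infty\},\mathcal O_C)$, let $L=\mathbb F_s$ be a finite extension of $\mathbb F_q$ with $s=q^e$, and fix an $\mathbb F_q$-morphism $c:\operatorname{Spec}L\to C$ with image the closed point $\varepsilon$. Put $C_L=C\times_{\mathbb F_q}\operatorname{Spec}L$, let $\sigma=\mathrm{id}_C\times\operatorname{Spec}(\mathrm{Frob}_q)$, and let $\mathcal I$ be the ideal sheaf of the graph of $c$ on $C_L$. An *abelian $\tau$-sheaf* $\underline{\mathcal F}=(\mathcal F_i,\Pi_i,\tau_i)_{i\in\mathbb Z}$ of rank $r$, dimension $d$ and characteristic $c$ over $L$ consists of locally free sheaves $\mathcal F_i$ of rank $r$ on $C_L$ and injective $\mathcal O_{C_L}$-homomorphisms $\Pi_i:\mathcal F_i\to\mathcal F_{i+1}$, $\tau_i:\sigma^*\mathcal F_i\to\mathcal F_{i+1}$ with $\Pi_{i+1}\tau_i=\tau_{i+1}\,\sigma^*\Pi_i$ such that: there are integers $k,l>0$ with $ld=kr$ such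 that $\Pi_{i+l-1}\circ\dots\circ\Pi_i$ identifies $\mathcal F_i$ with $\mathcal F_{i+l}(-k\cdot\infty)\subset\mathcal F_{i+l}$ for all $i$; $\dim_L\operatorname{coker}\Pi_i=d$ for all $i$; and $\dim_L\operatorname{coker}\tau_i=d$ and $\mathcal I^d\operatorname{coker}\tau_i=0$ for all $i$. Its *weight* is $d/r$ (and $0$ if $r=0$). A *morphism* $\underline{\mathcal F}\to\underline{\mathcal F}'$ is a family of $\mathcal O_{C_L}$-homomorphisms $f_i:\mathcal F_i\to\mathcal F_i'$ commuting with the $\Pi$'s and the $\tau$'s. The $Q$-vector space $\operatorname{QHom}(\underline{\mathcal F},\underline{\mathcal F}')$ of quasi-morphisms is the union (direct limit along the natural inclusions) of the $\operatorname{Hom}(\underline{\mathcal F},\underline{\mathcal F}'(D))$ over all effective divisors $D$ on $C$. Let $v\neq\infty,\varepsilon$ be a closed point of $C$, $A_v$ the completion of $A$ at $v$ and $Q_v=\operatorname{Frac}A_v$. Put $M=\Gamma(C_L\setminus\{\infty\},\mathcal F_0)$ and $\tau=\Pi_0^{-1}\circ\tau_0:\sigma^*M\to M$. The rational $v$-adic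 Tate module of $\underline{\mathcal F}$ is $$V_v\underline{\mathcal F}=\Bigl(\varprojlim_n\bigl((M/v^nM)\otimes_LL^{\rm sep}\bigr)^{\tau}\Bigr)\otimes_{A_v}Q_v ,$$ where $\tau$ acts on $L^{\rm sep}$ as the $q$-Frobenius and the superscript denotes invariants. The $s$-Frobenius $\pi=\tau^e:M\to M$ is $A\otimes_{\mathbb F_q}L$-linear and induces a $Q_v$-linear endomorphism $\pi_v$ of $V_v\underline{\mathcal F}$; let $\chi_v\in Q_v[x]$ be its characteristic polynomial. For nonzero polynomials $f,g$ over a field $K$ put $$r_K(f,g)=\sum_{\mu}m(\mu)\,n(\mu)\,\deg\mu ,$$ the sum over all monic irreducible $\mu\in K[x]$, where $m(\mu)$ and $n(\mu)$ are the multiplicities of $\mu$ in $f$ and in $g$. **Theorem.** Let $\underline{\mathcal F}$ and $\underline{\mathcal F}'$ be abelian $\tau$-sheaves of the same characteristic $c$ and of the same weight over $\mathbb F_s$, and let $v\neq\varepsilon,\infty$ be a place of $Q$ such that the endomorphisms $\pi_v$ of $V_v\underline{\mathcal F}$ and $\pi_v'$ of $V_v\underline{\mathcal F}'$ are semisimple.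 Let $\chi_v$ and $\chi'_v$ be their characteristic polynomials. Then $$\dim_Q\operatorname{QHom}(\underline{\mathcal F},\underline{\mathcal F}')=r_{Q_v}(\chi_v,\chi_v') .$$ -/

import Mathlib

open scoped TensorProduct

namespace TauSheaf

universe w

/-! ## The curve -/

/-- A pair `(C, ∞)` consisting of a smooth projective geometrically irreducible curve `C` over
`Fq` with function field `Q` and an `Fq`-rational point `∞` of `C`, given by the two rings
`A = Γ(C ∖ {∞}, 𝒪_C)` and `O = 𝒪_{C,∞}` inside `Q`.  Thus `Spec A` is a smooth affine curve, and
the closed points of `C` (the places of `Q`, i.e. the nontrivial valuation rings of `Q` over `Fq`)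
are the closed points of `Spec A` together with the single further point `∞`. -/
structure PointedCurve (Fq Q : Type*) [Field Fq] [Field Q] [Algebra Fq Q] where
  /-- the ring of functions regular outside `∞` -/
  A : Subalgebra Fq Q
  /-- the local ring at `∞` -/
  O : Subalgebra Fq Q
  isDedekindDomain : IsDedekindDomain A
  finiteType : Algebra.FiniteType Fq A
  isFractionRing : IsFractionRing A Q
  /-- `Fq` is algebraically closed in `Q` (geometric irreducibility) -/
  isAlgClosedIn : ∀ x : Q, IsAlgebraic Fq x → x ∈ Set.range (algebraMap Fq Q)
  isDVR : IsDiscreteValuationRing O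
  isFractionRing_O : IsFractionRing O Q
  /-- the residue field at `∞` is `Fq` -/
  rational : ∀ x : O, ∃ a : Fq, ¬ IsUnit (x - algebraMap Fq O a)
  /-- `∞` is the one and only place of `Q` that is not centred on `Spec A` -/
  places : ∀ R : ValuationSubring Q, (∀ a : Fq, algebraMap Fq Q a ∈ R) → R ≠ ⊤ →
    ((A : Set Q) ⊆ R ↔ (R : Set Q) ≠ O)

attribute [instance] PointedCurve.isDedekindDomain PointedCurve.finiteType
  PointedCurve.isFractionRing PointedCurve.isDVR PointedCurve.isFractionRing_O

section Base

variable {Fq Q : Type*} [Field Fq] [Field Q] [Algebra Fq Q] (C : PointedCurve Fq Q)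
variable (L : Type*) [Field L] [Algebra Fq L]

/-- For a subring `R` of `Q` the ring `R_L = R ⊗ L`, as a subring of `Q_L = Q ⊗ L`
(we write the factor `L` on the left). -/
noncomputable def ext (R : Subalgebra Fq Q) : Subalgebra L (L ⊗[Fq] Q) :=
  (Algebra.TensorProduct.map (AlgHom.id L L) R.val).range

theorem one_tmul_mem_ext (R : Subalgebra Fq Q) (a : R) :
    (1 : L) ⊗ₜ[Fq] (a : Q) ∈ ext L R :=
  ⟨(1 : L) ⊗ₜ[Fq] a, by simp⟩

noncomputable instance (R : Subalgebra Fq Q) : CommRing (ext L R) :=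
  Subalgebra.toCommRing (ext L R)

/-- The inclusion `R → R_L`, `a ↦ a ⊗ 1`. -/
noncomputable def toExt (R : Subalgebra Fq Q) : R →+* ext L R where
  toFun a := ⟨(1 : L) ⊗ₜ[Fq] (a : Q), one_tmul_mem_ext L R a⟩
  map_one' := rfl
  map_zero' := by ext; simp
  map_mul' a b := by ext; simp
  map_add' a b := by ext; simp [TensorProduct.tmul_add]

noncomputable instance (R : Subalgebra Fq Q) : Algebra R (ext L R) := (toExt L R).toAlgebra

/-- `A_L = A ⊗ L` -/
noncomputable abbrev PointedCurve.AL : Subalgebra L (L ⊗[Fq] Q) := ext L C.A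

/-- `O_L = 𝒪_{C,∞} ⊗ L` -/
noncomputable abbrev PointedCurve.OL : Subalgebra L (L ⊗[Fq] Q) := ext L C.O

/-- The ideal of the closed subscheme `∞ × Spec L` in `O_L`. -/
noncomputable def PointedCurve.idealInf : Ideal (C.OL L) :=
  (IsLocalRing.maximalIdeal C.O).map (toExt L C.O)

/-! ## Locally free sheaves on `C_L` -/

/-- A sheaf on `C_L = C × Spec L` embedded in its generic fibre, given by gluing: the generic
fibre `V` (a `Q_L`-module), the `A_L`-module `aff ⊆ V` of sections over
`C_L ∖ {∞} = Spec A_L`, and the `O_L`-module `inf ⊆ V` of germs along `∞ × Spec L`. -/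
structure LatticeSheaf where
  V : Type w
  [addCommGroup : AddCommGroup V]
  [module : Module (L ⊗[Fq] Q) V]
  aff : Submodule (C.AL L) V
  inf : Submodule (C.OL L) V

attribute [instance] LatticeSheaf.addCommGroup LatticeSheaf.module

end Base

theorem exists_pole {Fq Q : Type*} [Field Fq] [Field Q] [Algebra Fq Q]
    (C : PointedCurve Fq Q) (a : Q) :
    (∃ b : C.A, b ≠ 0 ∧ (b : Q) * a ∈ C.A) ∧
    ∃ n : ℕ, ∀ b ∈ IsLocalRing.maximalIdeal C.O ^ n, (b : Q) * a ∈ C.O := by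
  constructor
  · obtain ⟨x, y, hy, rfl⟩ := IsFractionRing.div_surjective (A := C.A) a
    refine ⟨y, nonZeroDivisors.ne_zero hy, ?_⟩
    have : (y : Q) ≠ 0 := by
      simpa using nonZeroDivisors.ne_zero hy
    change (y : Q) * ((x : Q) / (y : Q)) ∈ _
    rw [mul_div_cancel₀ _ this]
    exact x.2
  · obtain ⟨x, y, hy, rfl⟩ := IsFractionRing.div_surjective (A := C.O) a
    have hy0 : y ≠ 0 := nonZeroDivisors.ne_zero hy
    obtain ⟨ϖ, hϖ⟩ := IsDiscreteValuationRing.exists_irreducible C.O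
    obtain ⟨n, u, hu⟩ := IsDiscreteValuationRing.eq_unit_mul_pow_irreducible hy0 hϖ
    refine ⟨n, fun b hb => ?_⟩
    rw [hϖ.maximalIdeal_eq, Ideal.span_singleton_pow, Ideal.mem_span_singleton] at hb
    have hyb : y ∣ b := by
      rw [hu]
      exact (Units.mul_left_dvd).2 hb
    obtain ⟨z, rfl⟩ := hyb
    have : (y : Q) ≠ 0 := by simpa using hy0
    change ((y * z : C.O) : Q) * ((x : Q) / (y : Q)) ∈ _
    have e : ((y * z : C.O) : Q) * ((x : Q) / (y : Q)) = ((z * x : C.O) : Q) := by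
      push_cast
      field_simp
    rw [e]
    exact (z * x).2

section Sheaves

variable {Fq Q : Type*} [Field Fq] [Field Q] [Algebra Fq Q] {C : PointedCurve Fq Q}
variable {L : Type*} [Field L] [Algebra Fq L]

/-- The `L`-vector space structure induced by `L → Q_L`. -/
noncomputable instance (F : LatticeSheaf.{w} C L) : Module L F.V :=
  Module.compHom F.V (algebraMap L (L ⊗[Fq] Q))

/-- The `Q`-vector space structure induced by `Q → Q_L`. -/
noncomputable instance (F : LatticeSheaf.{w} C L) : Module Q F.V :=
  Module.compHom F.V
    ((Algebra.TensorProduct.includeRight : Q →ₐ[Fq] L ⊗[Fq] Q) : Q →+* L ⊗[Fq] Q)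

theorem smul_Q_def (F : LatticeSheaf.{w} C L) (a : Q) (x : F.V) :
    a • x = ((1 : L) ⊗ₜ[Fq] a) • x := rfl

instance (F : LatticeSheaf.{w} C L) : IsScalarTower L (L ⊗[Fq] Q) F.V :=
  ⟨fun a b x => by
    rw [Algebra.smul_def, mul_smul]; rfl⟩

instance (F : LatticeSheaf.{w} C L) : SMulCommClass (L ⊗[Fq] Q) Q F.V :=
  ⟨fun a b x => by rw [smul_Q_def, smul_Q_def, smul_smul, smul_smul, mul_comm]⟩

instance (F : LatticeSheaf.{w} C L) : SMulCommClass L Q F.V :=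
  ⟨fun a b x => by
    rw [← algebraMap_smul (L ⊗[Fq] Q) a (b • x), ← algebraMap_smul (L ⊗[Fq] Q) a x, smul_comm]⟩

instance (F : LatticeSheaf.{w} C L) : IsScalarTower C.A (C.AL L) F.V :=
  ⟨fun a b x => by
    rw [Algebra.smul_def, mul_smul]; rfl⟩

noncomputable instance (F : LatticeSheaf.{w} C L) : AddCommGroup F.aff :=
  Submodule.addCommGroup F.aff

noncomputable instance (F : LatticeSheaf.{w} C L) : Module L F.aff := Submodule.module' F.aff

noncomputable instance (F : LatticeSheaf.{w} C L) : Module C.A F.aff := Submodule.module' F.aff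

instance (F : LatticeSheaf.{w} C L) : SMulCommClass L C.A F.aff :=
  ⟨fun a b x => Subtype.ext (smul_comm a (b : Q) (x : F.V))⟩

theorem toExt_smul_smul (F : LatticeSheaf.{w} C L) (R : Subalgebra Fq Q) (a : Q) (u t : R)
    (h : (u : Q) * a ∈ R) (x : F.V) :
    toExt L R (u * t) • (a • x) = toExt L R ⟨u * a, h⟩ • (toExt L R t • x) := by
  change ((1 : L) ⊗ₜ[Fq] ((u : Q) * (t : Q))) • (((1 : L) ⊗ₜ[Fq] a) • x) =
    ((1 : L) ⊗ₜ[Fq] ((u : Q) * a)) • (((1 : L) ⊗ₜ[Fq] (t : Q)) • x)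
  rw [smul_smul, smul_smul, Algebra.TensorProduct.tmul_mul_tmul,
    Algebra.TensorProduct.tmul_mul_tmul, mul_right_comm]

/-- `F` is a locally free sheaf of rank `r` on `C_L`. -/
structure LatticeSheaf.IsLocallyFree (F : LatticeSheaf.{w} C L) (r : ℕ) : Prop where
  free : Module.Free (L ⊗[Fq] Q) F.V
  finite : Module.Finite (L ⊗[Fq] Q) F.V
  rank : Module.finrank (L ⊗[Fq] Q) F.V = r
  finite_aff : Module.Finite (C.AL L) F.aff
  projective_aff : Module.Projective (C.AL L) F.aff
  span_aff : Submodule.span (L ⊗[Fq] Q) (F.aff : Set F.V) = ⊤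
  finite_inf : Module.Finite (C.OL L) F.inf
  projective_inf : Module.Projective (C.OL L) F.inf
  span_inf : Submodule.span (L ⊗[Fq] Q) (F.inf : Set F.V) = ⊤

/-- A map on generic fibres that maps sections to sections. -/
def MapsSections (F F' : LatticeSheaf.{w} C L) (f : F.V → F'.V) : Prop :=
  Set.MapsTo f F.aff F'.aff ∧ Set.MapsTo f F.inf F'.inf

variable (C) in
/-- An effective divisor `D` on `C`: its part on `Spec A` is given by the corresponding nonzero
ideal of `A` and its multiplicity at `∞` by a natural number. -/
structure EffectiveDivisor where
  ideal : Ideal C.A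
  ideal_ne_bot : ideal ≠ ⊥
  mult : ℕ

/-- The sheaf `F(D) = F ⊗ 𝒪(D)` for an effective divisor `D` on `C`; it has the same generic
fibre as `F`. -/
noncomputable def LatticeSheaf.twist (F : LatticeSheaf.{w} C L) (D : EffectiveDivisor C) :
    LatticeSheaf.{w} C L where
  V := F.V
  aff :=
    { carrier := {x | ∀ a ∈ D.ideal, toExt L C.A a • x ∈ F.aff}
      add_mem' := fun hx hy a ha => by
        rw [smul_add]; exact F.aff.add_mem (hx a ha) (hy a ha)
      zero_mem' := fun a _ => by rw [smul_zero]; exact F.aff.zero_mem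
      smul_mem' := fun b x hx a ha => by
        rw [smul_comm]; exact F.aff.smul_mem b (hx a ha) }
  inf :=
    { carrier := {x | ∀ a ∈ IsLocalRing.maximalIdeal C.O ^ D.mult, toExt L C.O a • x ∈ F.inf}
      add_mem' := fun hx hy a ha => by
        rw [smul_add]; exact F.inf.add_mem (hx a ha) (hy a ha)
      zero_mem' := fun a _ => by rw [smul_zero]; exact F.inf.zero_mem
      smul_mem' := fun b x hx a ha => by
        rw [smul_comm]; exact F.inf.smul_mem b (hx a ha) }

/-- `dim_L` of (the global sections of) the quotient of the sheaf with sections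
`Γ(C_L ∖ ∞, F)` and germs `F_∞` by the subsheaf with sections `P` and germs `N`. -/
noncomputable def cokerRank (F : LatticeSheaf.{w} C L) (P : Submodule (C.AL L) F.V)
    (N : Submodule (C.OL L) F.V) : Cardinal.{w} :=
  Module.rank L (F.aff ⧸ P.submoduleOf F.aff) + Module.rank L (F.inf ⧸ N.submoduleOf F.inf)

/-! ## Abelian `τ`-sheaves -/

/-- The characteristic: a morphism `c : Spec L → C` over `Fq`, where `L` is finite over `Fq`.
It either factors through `Spec A`, and is then given by an `Fq`-homomorphism `c^* : A → L`, or its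
image is `∞`, and then it is the unique such morphism as `∞` has residue field `Fq`. -/
inductive Characteristic (C : PointedCurve Fq Q) (L : Type*) [Field L] [Algebra Fq L]
  | affine (cstar : C.A →ₐ[Fq] L)
  | infinity

/-- The sections over `Spec A_L` of the ideal sheaf of the graph of `c`. -/
noncomputable def Characteristic.graphAff : Characteristic C L → Ideal (C.AL L)
  | .affine cstar =>
      Ideal.span (Set.range fun a : C.A => toExt L C.A a - algebraMap L (C.AL L) (cstar a))
  | .infinity => ⊤

/-- The germs along `∞ × Spec L` of the ideal sheaf of the graph of `c` (`L` finite). If the image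
of `c` is `∞` then the graph is `∞ × Spec L`. -/
noncomputable def Characteristic.graphInf : Characteristic C L → Ideal (C.OL L)
  | .affine _ => ⊤
  | .infinity => C.idealInf L

/-- The closed point `v ≠ ∞` of `C` is the image `ε` of `c`. -/
def Characteristic.IsPoint (c : Characteristic C L)
    (v : IsDedekindDomain.HeightOneSpectrum C.A) : Prop :=
  match c with
  | .affine cstar => v.asIdeal = RingHom.ker cstar
  | .infinity => False

/-- The linear identification `V_i = V_j` for equal indices `i = j`. -/
def castLin (F : ℤ → LatticeSheaf.{w} C L) {i j : ℤ} (h : i = j) :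
    (F i).V →ₗ[L ⊗[Fq] Q] (F j).V :=
  h ▸ LinearMap.id

/-- The composite `Π_{i+n-1} ∘ ⋯ ∘ Π_i : F_i → F_{i+n}`. -/
def iterPi (F : ℤ → LatticeSheaf.{w} C L) (P : ∀ i, (F i).V →ₗ[L ⊗[Fq] Q] (F (i + 1)).V)
    (i : ℤ) : (n : ℕ) → (F i).V →ₗ[L ⊗[Fq] Q] (F (i + n)).V
  | 0 => castLin F (by simp)
  | n + 1 => castLin F (by push_cast; ring) ∘ₗ P (i + n) ∘ₗ iterPi F P i n

theorem castLin_injective (F : ℤ → LatticeSheaf.{w} C L) {i j : ℤ} (h : i = j) :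
    Function.Injective (castLin F h) := by
  subst h; exact fun _ _ h => h

theorem castLin_mapsSections (F : ℤ → LatticeSheaf.{w} C L) {i j : ℤ} (h : i = j) :
    MapsSections (F i) (F j) (castLin F h) := by
  subst h; exact ⟨fun _ h => h, fun _ h => h⟩

theorem iterPi_mapsSections (F : ℤ → LatticeSheaf.{w} C L)
    (P : ∀ i, (F i).V →ₗ[L ⊗[Fq] Q] (F (i + 1)).V)
    (hP : ∀ i, MapsSections (F i) (F (i + 1)) (P i)) (i : ℤ) :
    ∀ n : ℕ, MapsSections (F i) (F (i + n)) (iterPi F P i n)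
  | 0 => castLin_mapsSections F _
  | n + 1 =>
    have ih := iterPi_mapsSections F P hP i n
    have hc := castLin_mapsSections F
      (show i + (n : ℤ) + 1 = i + ((n + 1 : ℕ) : ℤ) by push_cast; ring)
    ⟨hc.1.comp ((hP _).1.comp ih.1), hc.2.comp ((hP _).2.comp ih.2)⟩

end Sheaves

section Frobenius

variable {Fq Q : Type*} [Field Fq] [Fintype Fq] [Field Q] [Algebra Fq Q] {C : PointedCurve Fq Q}
variable {L : Type*} [Field L] [Algebra Fq L]

variable (Fq L) in
/-- The `q`-Frobenius `x ↦ x ^ q` on `L`. -/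
noncomputable abbrev frobL : L →+* L := (FiniteField.frobeniusAlgHom Fq L : L →+* L)

variable (Fq Q L) in
/-- The endomorphism `σ^*` of `Q_L`: the identity on `Q` and the `q`-Frobenius on `L`. -/
noncomputable def sigma : L ⊗[Fq] Q →+* L ⊗[Fq] Q :=
  (Algebra.TensorProduct.map (FiniteField.frobeniusAlgHom Fq L) (AlgHom.id Fq Q) :
    L ⊗[Fq] Q →ₐ[Fq] L ⊗[Fq] Q)

@[simp] theorem sigma_tmul (b : L) (a : Q) :
    sigma Fq Q L (b ⊗ₜ a) = frobL Fq L b ⊗ₜ a := by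
  simp [sigma]

/-- An abelian `τ`-sheaf of characteristic `c` over the finite field `L`.  An `𝒪`-linear map
`τ_i : σ^*F_i → F_{i+1}` is the same as a `σ^*`-semilinear map on generic fibres which maps the
sections of `F_i` to sections of `F_{i+1}`; as `σ^*` is bijective on `Q_L` (`L` being perfect), the
former is injective if and only if the latter is.  The image of `σ^*F_i` is spanned by the images
of the sections of `F_i`. -/
structure AbelianTauSheaf (C : PointedCurve Fq Q) [Finite L] (c : Characteristic C L) where
  /-- the rank -/
  r : ℕ
  /-- the dimension -/
  d : ℕ
  F : ℤ → LatticeSheaf.{w} C L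
  Pi : ∀ i, (F i).V →ₗ[L ⊗[Fq] Q] (F (i + 1)).V
  tau : ∀ i, (F i).V →ₛₗ[sigma Fq Q L] (F (i + 1)).V
  isLocallyFree : ∀ i, (F i).IsLocallyFree r
  mapsSections_Pi : ∀ i, MapsSections (F i) (F (i + 1)) (Pi i)
  mapsSections_tau : ∀ i, MapsSections (F i) (F (i + 1)) (tau i)
  injective_Pi : ∀ i, Function.Injective (Pi i)
  injective_tau : ∀ i, Function.Injective (tau i)
  comm : ∀ i x, Pi (i + 1) (tau i x) = tau (i + 1) (Pi i x)
  /-- the composite `Π_{i+l-1} ∘ ⋯ ∘ Π_i` identifies `F_i` with `F_{i+l}(-k·∞)` -/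
  periodic : ∃ k l : ℕ, 0 < k ∧ 0 < l ∧ l * d = k * r ∧ ∀ i : ℤ,
    (F i).aff.map ((iterPi F Pi i l).restrictScalars (C.AL L)) = (F (i + l)).aff ∧
    (F i).inf.map ((iterPi F Pi i l).restrictScalars (C.OL L)) =
      (C.idealInf L) ^ k • (F (i + l)).inf
  coker_Pi : ∀ i, cokerRank (F (i + 1))
    ((F i).aff.map ((Pi i).restrictScalars (C.AL L)))
    ((F i).inf.map ((Pi i).restrictScalars (C.OL L))) = d
  coker_tau : ∀ i, cokerRank (F (i + 1))
    (Submodule.span (C.AL L) (tau i '' (F i).aff))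
    (Submodule.span (C.OL L) (tau i '' (F i).inf)) = d
  /-- the cokernel of `τ_i` is annihilated by the `d`-th power of the ideal of the graph -/
  annihilates_aff : ∀ i, c.graphAff ^ d • (F (i + 1)).aff ≤
    Submodule.span (C.AL L) (tau i '' (F i).aff)
  annihilates_inf : ∀ i, c.graphInf ^ d • (F (i + 1)).inf ≤
    Submodule.span (C.OL L) (tau i '' (F i).inf)

namespace AbelianTauSheaf

variable [Finite L] {c : Characteristic C L}

/-- The weight `d / r` (and `0` for the zero sheaf, where `r = 0`). -/
def weight (F : AbelianTauSheaf.{w} C c) : ℚ := if F.r = 0 then 0 else (F.d : ℚ) / F.r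

/-! ## Quasi-morphisms -/

/-- A family of maps on generic fibres is a morphism of abelian `τ`-sheaves `F → F'(D)`. -/
def IsHomTwist (F F' : AbelianTauSheaf.{w} C c) (D : EffectiveDivisor C)
    (f : ∀ i, (F.F i).V →ₗ[L ⊗[Fq] Q] (F'.F i).V) : Prop :=
  (∀ i, MapsSections (F.F i) ((F'.F i).twist D) (f i)) ∧
  (∀ i x, f (i + 1) (F.Pi i x) = F'.Pi i (f i x)) ∧
  (∀ i x, f (i + 1) (F.tau i x) = F'.tau i (f i x))

theorem IsHomTwist.zero (F F' : AbelianTauSheaf.{w} C c) (D : EffectiveDivisor C) :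
    IsHomTwist F F' D 0 :=
  ⟨fun i => ⟨fun _ _ => ((F'.F i).twist D).aff.zero_mem,
    fun _ _ => ((F'.F i).twist D).inf.zero_mem⟩,
    fun i _ => (map_zero (F'.Pi i)).symm, fun i _ => (map_zero (F'.tau i)).symm⟩

theorem IsHomTwist.add {F F' : AbelianTauSheaf.{w} C c} {D E : EffectiveDivisor C}
    {f g : ∀ i, (F.F i).V →ₗ[L ⊗[Fq] Q] (F'.F i).V}
    (hf : IsHomTwist F F' D f) (hg : IsHomTwist F F' E g) :
    IsHomTwist F F' ⟨D.ideal * E.ideal, mul_ne_zero D.ideal_ne_bot E.ideal_ne_bot,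
      D.mult + E.mult⟩ (f + g) := by
  obtain ⟨hf, hf1, hf2⟩ := hf
  obtain ⟨hg, hg1, hg2⟩ := hg
  refine ⟨fun i => ⟨fun x hx a ha => ?_, fun x hx a ha => ?_⟩, fun i x => ?_, fun i x => ?_⟩
  · change _ • (f i x + g i x) ∈ _
    rw [smul_add]
    have ha' : a ∈ D.ideal * E.ideal := ha
    have h1 : a ∈ D.ideal := Ideal.mul_le_left ha'
    have h2 : a ∈ E.ideal := Ideal.mul_le_right ha'
    exact (F'.F i).aff.add_mem ((hf i).1 hx a h1) ((hg i).1 hx a h2)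
  · change _ • (f i x + g i x) ∈ _
    rw [smul_add]
    have ha' : a ∈ IsLocalRing.maximalIdeal C.O ^ (D.mult + E.mult) := ha
    have h1 := Ideal.pow_le_pow_right (Nat.le_add_right D.mult E.mult) ha'
    have h2 := Ideal.pow_le_pow_right (Nat.le_add_left E.mult D.mult) ha'
    exact (F'.F i).inf.add_mem ((hf i).2 hx a h1) ((hg i).2 hx a h2)
  · change f (i + 1) (F.Pi i x) + g (i + 1) (F.Pi i x) = F'.Pi i (f i x + g i x)
    rw [hf1, hg1, map_add]
  · change f (i + 1) (F.tau i x) + g (i + 1) (F.tau i x) = F'.tau i (f i x + g i x)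
    rw [hf2, hg2, map_add]

theorem IsHomTwist.smul {F F' : AbelianTauSheaf.{w} C c} {D : EffectiveDivisor C}
    {f : ∀ i, (F.F i).V →ₗ[L ⊗[Fq] Q] (F'.F i).V} (hf : IsHomTwist F F' D f) (a : Q) :
    ∃ E, IsHomTwist F F' E (a • f) := by
  obtain ⟨hf, hf1, hf2⟩ := hf
  obtain ⟨⟨b, hb0, hb⟩, n, hn⟩ := exists_pole C a
  have hb1 : Ideal.span {b} ≠ ⊥ := fun h => hb0 (Ideal.span_singleton_eq_bot.1 h)
  refine ⟨⟨D.ideal * Ideal.span {b}, mul_ne_zero D.ideal_ne_bot hb1, n + D.mult⟩,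
    fun i => ⟨fun x hx y hy => ?_, fun x hx y hy => ?_⟩, fun i x => ?_, fun i x => ?_⟩
  · obtain ⟨z, hz, rfl⟩ := Ideal.mem_mul_span_singleton.1 hy
    change toExt L C.A (z * b) • (a • f i x) ∈ (F'.F i).aff
    rw [mul_comm z b, toExt_smul_smul _ _ _ _ _ hb]
    exact (F'.F i).aff.smul_mem _ ((hf i).1 hx z hz)
  · change toExt L C.O y • (a • f i x) ∈ (F'.F i).inf
    have hy' : y ∈ IsLocalRing.maximalIdeal C.O ^ n * IsLocalRing.maximalIdeal C.O ^ D.mult := by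
      rw [← pow_add]; exact hy
    refine Submodule.mul_induction_on hy' (fun u hu t ht => ?_) (fun u t hu ht => ?_)
    · rw [toExt_smul_smul _ _ _ _ _ (hn u hu)]
      exact (F'.F i).inf.smul_mem _ ((hf i).2 hx t ht)
    · rw [map_add, add_smul]
      exact (F'.F i).inf.add_mem hu ht
  · change a • f (i + 1) (F.Pi i x) = F'.Pi i (a • f i x)
    rw [hf1, smul_Q_def, smul_Q_def, map_smul]
  · change a • f (i + 1) (F.tau i x) = F'.tau i (a • f i x)
    rw [hf2, smul_Q_def, smul_Q_def, LinearMap.map_smulₛₗ, sigma_tmul, map_one]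

/-- The `Q`-vector space `QHom(F, F')` of quasi-morphisms, i.e. the union of the
`Hom(F, F'(D))` over all effective divisors `D` on `C`.  Two morphisms into `F'(D₁)` and `F'(D₂)`
agree in `F'(D₁ + D₂)` if and only if they agree on the generic fibres, so equivalence classes of
quasi-morphisms are such families of maps on the generic fibres. -/
def QHom (F F' : AbelianTauSheaf.{w} C c) :
    Submodule Q (∀ i, (F.F i).V →ₗ[L ⊗[Fq] Q] (F'.F i).V) where
  carrier := {f | ∃ D, IsHomTwist F F' D f}
  zero_mem' := ⟨⟨⊤, top_ne_bot, 0⟩, IsHomTwist.zero F F' _⟩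
  add_mem' := fun ⟨_, hf⟩ ⟨_, hg⟩ => ⟨_, hf.add hg⟩
  smul_mem' := fun a _ ⟨_, hf⟩ => hf.smul a

/-! ## The associated `τ`-module `M = Γ(C_L ∖ {∞}, F_0)`, `τ = Π_0⁻¹ ∘ τ_0` -/

/-- Each `Π_j` is an isomorphism outside `∞`. -/
theorem surjOn_Pi (F : AbelianTauSheaf.{w} C c) (j : ℤ) :
    Set.SurjOn (F.Pi j) (F.F j).aff (F.F (j + 1)).aff := by
  obtain ⟨k, l, -, hl, -, h⟩ := F.periodic
  obtain ⟨n, rfl⟩ : ∃ n, l = n + 1 := ⟨l - 1, by omega⟩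
  obtain ⟨i, rfl⟩ : ∃ i : ℤ, j = i + n := ⟨j - n, by ring⟩
  intro y hy
  have e : i + (n : ℤ) + 1 = i + ((n + 1 : ℕ) : ℤ) := by push_cast; ring
  have hy' := (castLin_mapsSections F.F e).1 hy
  rw [SetLike.mem_coe, ← (h i).1] at hy'
  obtain ⟨x, hx, hxy⟩ := hy'
  exact ⟨iterPi F.F F.Pi i n x, (iterPi_mapsSections F.F F.Pi F.mapsSections_Pi i n).1 hx,
    castLin_injective F.F e hxy⟩

/-- The `A_L`-module `M = Γ(C_L ∖ {∞}, F_0)`. -/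
abbrev M (F : AbelianTauSheaf.{w} C c) : Type w := (F.F 0).aff

/-- `Π_0` on sections over `C_L ∖ {∞}`. -/
noncomputable def affPi (F : AbelianTauSheaf.{w} C c) :
    (F.F 0).aff →ₗ[C.AL L] (F.F (0 + 1)).aff :=
  ((F.Pi 0).restrictScalars (C.AL L)).restrict (F.mapsSections_Pi 0).1

theorem affPi_bijective (F : AbelianTauSheaf.{w} C c) : Function.Bijective F.affPi := by
  constructor
  · intro x y h
    exact Subtype.ext (F.injective_Pi 0 (congrArg Subtype.val h))
  · intro y
    obtain ⟨x, hx, hxy⟩ := F.surjOn_Pi 0 y.2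
    exact ⟨⟨x, hx⟩, Subtype.ext hxy⟩

/-- `τ_0` on sections over `C_L ∖ {∞}`. -/
noncomputable def affTau (F : AbelianTauSheaf.{w} C c) :
    (F.F 0).aff →ₗ[C.A] (F.F (0 + 1)).aff where
  toFun x := ⟨F.tau 0 x, (F.mapsSections_tau 0).1 x.2⟩
  map_add' x y := Subtype.ext (map_add (F.tau 0) (x : (F.F 0).V) y)
  map_smul' a x := Subtype.ext <| by
    change F.tau 0 (((1 : L) ⊗ₜ[Fq] (a : Q)) • (x : (F.F 0).V)) =
      ((1 : L) ⊗ₜ[Fq] (a : Q)) • F.tau 0 x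
    rw [LinearMap.map_smulₛₗ, sigma_tmul, map_one]

theorem affTau_smul (F : AbelianTauSheaf.{w} C c) (b : L) (x : (F.F 0).aff) :
    F.affTau (b • x) = frobL Fq L b • F.affTau x := Subtype.ext <| by
  change F.tau 0 ((b ⊗ₜ[Fq] (1 : Q)) • (x : (F.F 0).V)) =
    (frobL Fq L b ⊗ₜ[Fq] (1 : Q)) • F.tau 0 x
  rw [LinearMap.map_smulₛₗ, sigma_tmul]

/-- The map `τ = Π_0⁻¹ ∘ τ_0 : M → M`; it is `A`-linear and `q`-Frobenius-semilinear over `L`. -/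
noncomputable def tauM (F : AbelianTauSheaf.{w} C c) : F.M →ₗ[C.A] F.M :=
  ((LinearEquiv.ofBijective F.affPi F.affPi_bijective).restrictScalars C.A).symm.toLinearMap ∘ₗ
    F.affTau

theorem tauM_smul (F : AbelianTauSheaf.{w} C c) (b : L) (x : F.M) :
    F.tauM (b • x) = frobL Fq L b • F.tauM x := by
  apply F.affPi_bijective.1
  have h1 : ∀ y, F.affPi (F.tauM y) = F.affTau y := fun y =>
    (LinearEquiv.ofBijective F.affPi F.affPi_bijective).apply_symm_apply _
  have h2 : F.affPi (frobL Fq L b • F.tauM x) = frobL Fq L b • F.affPi (F.tauM x) :=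
    Subtype.ext ((F.Pi 0).map_smul ((frobL Fq L b) ⊗ₜ[Fq] (1 : Q)) (F.tauM x : (F.F 0).V))
  rw [h2, h1, h1, affTau_smul]

/-- The `s`-Frobenius `π = τ^e : M → M` for `#L = s = q^e`. -/
noncomputable def frobM (F : AbelianTauSheaf.{w} C c) : F.M →ₗ[C.A] F.M :=
  F.tauM ^ Module.finrank Fq L

theorem frobL_pow_finrank (b : L) : (frobL Fq L)^[Module.finrank Fq L] b = b := by
  have := Fintype.ofFinite L
  have h := congrArg (fun f : L →ₐ[Fq] L => f b)
    (pow_orderOf_eq_one (FiniteField.frobeniusAlgHom Fq L))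
  rw [FiniteField.orderOf_frobeniusAlgHom] at h
  simpa [AlgHom.coe_pow] using h

theorem tauM_pow_smul (F : AbelianTauSheaf.{w} C c) (n : ℕ) (b : L) (x : F.M) :
    (F.tauM ^ n) (b • x) = (frobL Fq L)^[n] b • (F.tauM ^ n) x := by
  induction n generalizing b x with
  | zero => rfl
  | succ n ih => rw [pow_succ, Module.End.mul_apply, Module.End.mul_apply, tauM_smul, ih,
      Function.iterate_succ_apply]

/-- `π : M → M` is `L`-linear (hence `A_L`-linear). -/
theorem frobM_smul (F : AbelianTauSheaf.{w} C c) (b : L) (x : F.M) :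
    F.frobM (b • x) = b • F.frobM x := by
  rw [frobM, tauM_pow_smul, frobL_pow_finrank]

/-! ## The Tate module -/

/-- The `A`-module `M ⊗_L L^sep`. -/
def Msep (F : AbelianTauSheaf.{w} C c) := F.M ⊗[L] SeparableClosure L

noncomputable instance (F : AbelianTauSheaf.{w} C c) : AddCommGroup F.Msep :=
  inferInstanceAs (AddCommGroup (F.M ⊗[L] SeparableClosure L))

noncomputable instance (F : AbelianTauSheaf.{w} C c) : Module C.A F.Msep :=
  inferInstanceAs (Module C.A (F.M ⊗[L] SeparableClosure L))

/-- The element `m ⊗ b` of `M ⊗_L L^sep`. -/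
noncomputable def tmulSep (F : AbelianTauSheaf.{w} C c) (m : F.M) (b : SeparableClosure L) : F.Msep :=
  m ⊗ₜ[L] b

theorem Msep.induction (F : AbelianTauSheaf.{w} C c) {p : F.Msep → Prop} (x : F.Msep)
    (zero : p 0) (tmul : ∀ m b, p (F.tmulSep m b)) (add : ∀ x y, p x → p y → p (x + y)) : p x :=
  TensorProduct.induction_on (motive := p) x zero tmul add

theorem smul_tmulSep (F : AbelianTauSheaf.{w} C c) (a : C.A) (m : F.M)
    (b : SeparableClosure L) : a • F.tmulSep m b = F.tmulSep (a • m) b :=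
  TensorProduct.smul_tmul' a m b

/-- The additive endomorphism `f ⊗ g` of `M ⊗_L L^sep`, for maps `f` and `g` that are both linear
or both `q`-Frobenius-semilinear over `L`; it is `A`-linear if `f` is so. -/
noncomputable def mapSep (F : AbelianTauSheaf.{w} C c) {φ : L →+* L} (f : F.M →ₗ[C.A] F.M)
    (hf : ∀ (b : L) x, f (b • x) = φ b • f x) (g : SeparableClosure L →ₛₗ[φ] SeparableClosure L) :
    F.Msep →ₗ[C.A] F.Msep :=
  let f' : F.M →ₛₗ[φ] F.M := { toFun := f, map_add' := map_add f, map_smul' := hf }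
  let h : F.Msep →+ F.Msep := (TensorProduct.map f' g).toAddMonoidHom
  { h with
    map_smul' := fun a x => by
      change h (a • x) = a • h x
      induction x using Msep.induction with
      | zero => rw [smul_zero, map_zero, smul_zero]
      | add x y hx hy => rw [smul_add, map_add, hx, hy, map_add, smul_add]
      | tmul m b =>
        rw [smul_tmulSep]
        change F.tmulSep (f (a • m)) (g b) = a • F.tmulSep (f m) (g b)
        rw [smul_tmulSep, f.map_smul] }

theorem mapSep_tmulSep (F : AbelianTauSheaf.{w} C c) {φ : L →+* L} (f : F.M →ₗ[C.A] F.M)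
    (hf : ∀ (b : L) x, f (b • x) = φ b • f x) (g : SeparableClosure L →ₛₗ[φ] SeparableClosure L)
    (m : F.M) (b : SeparableClosure L) :
    F.mapSep f hf g (F.tmulSep m b) = F.tmulSep (f m) (g b) := rfl

variable (Fq L) in
/-- The `q`-Frobenius `b ↦ b ^ q` on `L^sep`. -/
noncomputable def frobLsep : SeparableClosure L →ₛₗ[frobL Fq L] SeparableClosure L where
  toFun b := FiniteField.frobeniusAlgHom Fq (SeparableClosure L) b
  map_add' := map_add _
  map_smul' a b := by simp [Algebra.smul_def, mul_pow]

/-- The action of `τ` on `M ⊗_L L^sep`, `x ⊗ b ↦ τ(x) ⊗ b^q`. -/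
noncomputable def tauSep (F : AbelianTauSheaf.{w} C c) : F.Msep →ₗ[C.A] F.Msep :=
  F.mapSep F.tauM F.tauM_smul (frobLsep Fq L)

/-- The action of `π` on `M ⊗_L L^sep`, `x ⊗ b ↦ π(x) ⊗ b`. -/
noncomputable def frobSep (F : AbelianTauSheaf.{w} C c) : F.Msep →ₗ[C.A] F.Msep :=
  F.mapSep (φ := RingHom.id L) F.frobM F.frobM_smul LinearMap.id

theorem tauSep_comp_frobSep (F : AbelianTauSheaf.{w} C c) :
    F.tauSep ∘ₗ F.frobSep = F.frobSep ∘ₗ F.tauSep := by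
  refine LinearMap.ext fun x => ?_
  rw [LinearMap.comp_apply, LinearMap.comp_apply]
  induction x using Msep.induction with
  | zero => rw [map_zero, map_zero, map_zero]
  | add x y hx hy => rw [map_add, map_add, hx, hy, map_add, map_add]
  | tmul m b =>
    have h : F.tauM (F.frobM m) = F.frobM (F.tauM m) := by
      rw [frobM, ← Module.End.mul_apply, ← Module.End.mul_apply, ← pow_succ', ← pow_succ]
    rw [tauSep, frobSep, mapSep_tmulSep, mapSep_tmulSep, mapSep_tmulSep, mapSep_tmulSep, h]
    rfl

end AbelianTauSheaf

end Frobenius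

section Tate

open IsDedekindDomain

variable {Fq Q : Type*} [Field Fq] [Field Q] [Algebra Fq Q] {C : PointedCurve Fq Q}

/-- `A_v`, the completion of `A` at a closed point `v` of `Spec A`. -/
abbrev Av (v : HeightOneSpectrum C.A) : Type _ := AdicCompletion v.asIdeal C.A

theorem mul_not_mem_pow {R : Type*} [CommRing R] [IsDedekindDomain R] (v : HeightOneSpectrum R)
    {a b : R} {n m : ℕ} (ha : a ∉ v.asIdeal ^ n) (hb : b ∉ v.asIdeal ^ m) :
    a * b ∉ v.asIdeal ^ (n + m) := by
  rw [← Ideal.span_singleton_le_iff_mem, ← Ideal.dvd_iff_le] at ha hb ⊢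
  rw [← Ideal.span_singleton_mul_span_singleton, pow_dvd_iff_le_emultiplicity,
    emultiplicity_mul v.prime]
  rw [pow_dvd_iff_le_emultiplicity] at ha hb
  push Not at ha hb ⊢
  rw [Nat.cast_add]
  exact ENat.add_lt_add ha hb

theorem isDomain_adicCompletion {R : Type*} [CommRing R] [IsDedekindDomain R]
    (v : HeightOneSpectrum R) : IsDomain (AdicCompletion v.asIdeal R) := by
  have key : ∀ x : AdicCompletion v.asIdeal R, x ≠ 0 →
      ∃ (a : AdicCompletion.AdicCauchySequence v.asIdeal R) (n : ℕ),
        AdicCompletion.mk v.asIdeal R a = x ∧ ∀ N, n ≤ N → a.val N ∉ v.asIdeal ^ n := by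
    intro x hx
    obtain ⟨a, rfl⟩ := AdicCompletion.mk_surjective v.asIdeal R x
    by_contra! hcon
    refine hx (AdicCompletion.ext_evalₐ fun n => ?_)
    obtain ⟨N, hN, h⟩ := hcon a n rfl
    rw [AdicCompletion.evalₐ_mk, map_zero, ← AdicCompletion.Ideal.mk_eq_mk v.asIdeal hN a]
    exact Ideal.Quotient.eq_zero_iff_mem.2 h
  have : Nontrivial (AdicCompletion v.asIdeal R) := by
    refine ⟨1, 0, fun h => ?_⟩
    have h1 := congrArg (AdicCompletion.evalₐ v.asIdeal 1) h
    rw [map_one, map_zero, ← map_one (Ideal.Quotient.mk _), Ideal.Quotient.eq_zero_iff_mem,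
      pow_one] at h1
    exact v.isPrime.ne_top ((Ideal.eq_top_iff_one _).2 h1)
  have : NoZeroDivisors (AdicCompletion v.asIdeal R) := by
    refine ⟨fun {x y} hxy => ?_⟩
    by_contra! hcon
    obtain ⟨a, n, rfl, ha⟩ := key x hcon.1
    obtain ⟨b, m, rfl, hb⟩ := key y hcon.2
    have h1 := congrArg (AdicCompletion.evalₐ v.asIdeal (n + m)) hxy
    rw [map_mul, AdicCompletion.evalₐ_mk, AdicCompletion.evalₐ_mk, map_zero, ← map_mul,
      Ideal.Quotient.eq_zero_iff_mem] at h1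
    exact mul_not_mem_pow v (ha _ (Nat.le_add_right n m)) (hb _ (Nat.le_add_left m n)) h1
  exact NoZeroDivisors.to_isDomain _

instance (v : HeightOneSpectrum C.A) : IsDomain (Av v) := isDomain_adicCompletion v

/-- `Q_v`, the field of fractions of `A_v`, i.e. the completion of `Q` at `v`. -/
abbrev Qv (v : HeightOneSpectrum C.A) : Type _ := FractionRing (Av v)

variable [Fintype Fq] {L : Type*} [Field L] [Algebra Fq L] [Finite L] {c : Characteristic C L}

namespace AbelianTauSheaf

/-- The `v`-adic Tate module `T_v F = lim_n ((M / v^n M) ⊗_L L^sep)^τ`, the `τ`-invariants in the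
`v`-adic completion `lim_n (M ⊗_L L^sep) / v^n` of `M ⊗_L L^sep`. -/
noncomputable def tateModule (F : AbelianTauSheaf.{w} C c) (v : HeightOneSpectrum C.A) :
    Submodule (Av v) (AdicCompletion v.asIdeal F.Msep) :=
  LinearMap.eqLocus (AdicCompletion.map v.asIdeal F.tauSep) LinearMap.id

/-- `T_v π : T_v F → T_v F`. -/
noncomputable def tateFrob (F : AbelianTauSheaf.{w} C c) (v : HeightOneSpectrum C.A) :
    F.tateModule v →ₗ[Av v] F.tateModule v :=
  (AdicCompletion.map v.asIdeal F.frobSep).restrict fun x hx => by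
    have hx' : AdicCompletion.map v.asIdeal F.tauSep x = x := hx
    change AdicCompletion.map v.asIdeal F.tauSep (AdicCompletion.map v.asIdeal F.frobSep x) =
      AdicCompletion.map v.asIdeal F.frobSep x
    rw [AdicCompletion.map_comp_apply, tauSep_comp_frobSep, ← AdicCompletion.map_comp_apply, hx']

/-- The rational Tate module `V_v F = Q_v ⊗ T_v F`. -/
def rationalTateModule (F : AbelianTauSheaf.{w} C c) (v : HeightOneSpectrum C.A) :=
  Qv v ⊗[Av v] F.tateModule v

noncomputable instance (F : AbelianTauSheaf.{w} C c) (v : HeightOneSpectrum C.A) :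
    AddCommGroup (F.rationalTateModule v) :=
  inferInstanceAs (AddCommGroup (Qv v ⊗[Av v] F.tateModule v))

noncomputable instance (F : AbelianTauSheaf.{w} C c) (v : HeightOneSpectrum C.A) :
    Module (Qv v) (F.rationalTateModule v) :=
  inferInstanceAs (Module (Qv v) (Qv v ⊗[Av v] F.tateModule v))

/-- The endomorphism `π_v = V_v π` of the `Q_v`-vector space `V_v F`. -/
noncomputable def piv (F : AbelianTauSheaf.{w} C c) (v : HeightOneSpectrum C.A) :
    Module.End (Qv v) (F.rationalTateModule v) :=
  (F.tateFrob v).baseChange (Qv v)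

end AbelianTauSheaf

end Tate

/-! ## Polynomials -/

open Classical in
/-- The characteristic polynomial of an endomorphism of a finite-dimensional vector space. -/
noncomputable def charPoly {K V : Type*} [Field K] [AddCommGroup V] [Module K V]
    (f : Module.End K V) : Polynomial K :=
  if _h : Module.Finite K V then LinearMap.charpoly f else 0

open Classical in
/-- `r_K(f, g) = ∑_μ m(μ) n(μ) deg μ`, where `μ` runs through the monic irreducible polynomials and
`m(μ)`, `n(μ)` are the multiplicities of `μ` in `f` and in `g`. -/
noncomputable def rPairing {K : Type*} [Field K] (f g : Polynomial K) : ℕ :=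
  ∑ μ ∈ (UniqueFactorizationMonoid.normalizedFactors f).toFinset,
    (UniqueFactorizationMonoid.normalizedFactors f).count μ *
      (UniqueFactorizationMonoid.normalizedFactors g).count μ * μ.natDegree

end TauSheaf

/-! Let `V` be the generic fibre of `F_0`, let `φ = Π_0⁻¹ τ_0` act on it, and put `e = [L : F_q]`,
`π = φ ^ e`; primes refer to `F'`. The space `H` of `Q`-linear maps `V → V'` commuting with `π` is
computed in two ways.

Over `Q`. The `Π_i` are invertible on generic fibres, so a quasi-morphism is determined by its
component at `0`, an `L`-linear map commuting with `φ`. Conversely every such map is a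
quasi-morphism: one element of `A` clears its denominators away from `∞`, and at `∞` equal weights
make the two chains of lattices scale in step, so that a bound over one common period holds for all
`i` (`rank_QHom`). Now `H` is the direct sum of its `q^j`-semilinear parts, `0 ≤ j < e`, each of
which becomes the `L`-linear part after composition with `φ^{-j}` (`finrank_intertwiners_eq_mul`).
On the `L`-linear part, conjugation by `φ` is Frobenius-semilinear and its `e`-th power is the
identity, so Galois descent applies (`finrank_linearIntertwiners_pow`). Hence `dim H = e² · dim
QHom`.

Over `Q_v`. There is a non-canonical isomorphism `Q_v ⊗ V ≅ (V_v F)^e` taking `π` to `π_v`. To see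
this, put `P = (M / v^n) ⊗ L^sep`. The map `τ ⊗ Frob_q` has as fixed points the `τ`-invariants that
make up the Tate module, while `id ⊗ Frob_s` has fixed points `M / v^n`. For a finite module `W` and
a submodule `K`, the homomorphisms from `W` vanishing on `K` into the two sets of fixed points
number `q^h` and `s^h` with the same `h`, the dimension of the corresponding space of maps into `P`.
So `M / v^n` and the `e`-th power of the invariants receive equally many homomorphisms, and Lovász's
counting argument makes them isomorphic (`nonempty_equiv_fixed`); working over `A[X]` with `X`
acting as `π` makes the isomorphism equivariant. The hypothesis `v ≠ ε` makes `τ` bijective modulo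
`v^n`, which gives the periodicity behind descent. There are finitely many choices at each level, so
a compatible system exists by compactness (`exists_completion_equiv`).

Intertwining spaces are compatible with the extension `Q_v / Q`, so `dim H = e² · dim Hom(π_v,
π_v')`. Semisimplicity enters only now, to identify the last dimension with the pairing of
characteristic polynomials (`finrank_intertwiners_of_isSemisimple`). Cancelling `e²` gives the
theorem. -/

namespace TauSheaf

/-! ## Power sums over finite fields -/

/-- The summand is a character of the cyclic group `Kˣ`, trivial exactly when `i = j`, so
orthogonality gives `0` or the group order `q ^ N - 1 = -1`. All later projections onto a single
Frobenius power rest on this. -/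
theorem sum_units_pow_mul_inv_pow (K : Type*) [Field K] [Fintype K] [DecidableEq K] {q N : ℕ} (hq : 1 < q)
    (hcard : Fintype.card K = q ^ N) {i j : ℕ} (hi : i < N) (hj : j < N) :
    ∑ c : Kˣ, ((c : K) ^ q ^ i * ((c : K) ^ q ^ j)⁻¹) = if i = j then -1 else 0 := by
  classical
  let f : Kˣ →* K := (Units.coeHom K).comp (powMonoidHom (q ^ i) / powMonoidHom (q ^ j))
  have hf : ∀ c : Kˣ, f c = (c : K) ^ q ^ i * ((c : K) ^ q ^ j)⁻¹ := fun c => by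
    simp [f, div_eq_mul_inv]
  simp_rw [← hf]
  rw [sum_hom_units f]
  have hiff : f = 1 ↔ i = j := by
    constructor
    · intro h
      by_contra hne
      obtain ⟨g, hg⟩ := IsCyclic.exists_generator (α := Kˣ)
      have hord : orderOf g = q ^ N - 1 := by
        rw [orderOf_eq_card_of_forall_mem_zpowers hg, Nat.card_eq_fintype_card,
          Fintype.card_units, hcard]
      have hlt : ∀ m < N, q ^ m < orderOf g := by
        intro m hm
        -- Distinct `i, j < N` force `N ≥ 2`, and then `q ^ N ≥ 2 q ^ (N - 1) ≥ q ^ (N - 1) + 2`,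
        -- which leaves room below the group order `q ^ N - 1`.
        have hN : 2 ≤ N := by omega
        rw [hord]
        have h1 : q ^ m ≤ q ^ (N - 1) := Nat.pow_le_pow_right (by omega) (by omega)
        have h2 : q ^ N = q * q ^ (N - 1) := by rw [← pow_succ', Nat.sub_add_cancel (by omega)]
        have h3 : 2 ≤ q ^ (N - 1) :=
          hq.trans_le (by simpa using Nat.pow_le_pow_right (n := q) (by omega) (show 1 ≤ N - 1 by omega))
        have h4 : 2 * q ^ (N - 1) ≤ q * q ^ (N - 1) := Nat.mul_le_mul_right _ hq
        omega
      have hgg : g ^ q ^ i = g ^ q ^ j := by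
        have h1 := DFunLike.congr_fun h g
        rw [hf, MonoidHom.one_apply, mul_inv_eq_one₀ (by simp)] at h1
        ext
        simpa using h1
      exact hne (Nat.pow_right_injective hq
        (pow_injOn_Iio_orderOf (hlt i hi) (hlt j hj) hgg))
    · rintro rfl
      ext c
      rw [hf, MonoidHom.one_apply, mul_inv_cancel₀ (by simp)]
  have hc : ((Fintype.card Kˣ : ℕ) : K) = -1 := by
    rw [Fintype.card_units, Nat.cast_sub Fintype.card_pos, FiniteField.cast_card_eq_zero]
    simp
  rw [Nat.cast_ite, hc, Nat.cast_zero]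
  simp only [hiff]

/-- The field `k` contains, for all `N > 0`, a field with `q ^ N` elements. -/
def HasSubfields (q : ℕ) (k : Type*) [Field k] : Prop :=
  ∀ N : ℕ, 0 < N → ∃ (K : Type) (_ : Field K) (_ : Fintype K) (_ : K →+* k),
    Fintype.card K = q ^ N

theorem HasSubfields.pow {q : ℕ} {k : Type*} [Field k] (h : HasSubfields q k) {e : ℕ}
    (he : 0 < e) : HasSubfields (q ^ e) k := fun N hN => by
  obtain ⟨K, _, _, ι, hK⟩ := h (e * N) (Nat.mul_pos he hN)
  exact ⟨K, ‹_›, ‹_›, ι, by rw [hK, pow_mul]⟩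

/-- The field with `q ^ N` elements is separable over the prime field, hence embeds into any
separably closed field of that characteristic. -/
theorem hasSubfields_of_isSepClosed (F : Type*) [Field F] [Fintype F] (k : Type*) [Field k]
    [Algebra F k] [IsSepClosed k] : HasSubfields (Fintype.card F) k := by
  intro N hN
  obtain ⟨p, hp⟩ := CharP.exists F
  obtain ⟨n, hp', hn⟩ := FiniteField.card F p
  have : Fact p.Prime := ⟨hp'⟩
  have : CharP k p := charP_of_injective_algebraMap (algebraMap F k).injective p
  let : Algebra (ZMod p) k := ZMod.algebra k p
  let _ : Fintype (GaloisField p (n * N)) := Fintype.ofFinite _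
  refine ⟨GaloisField p (n * N), inferInstance, inferInstance,
    (IsSepClosed.lift : GaloisField p (n * N) →ₐ[ZMod p] k).toRingHom, ?_⟩
  rw [hn, ← pow_mul, ← Nat.card_eq_fintype_card]
  exact GaloisField.card p _ (Nat.mul_pos n.pos hN).ne'

/-! ## Galois descent for finite fields -/

section Descent

variable {k P : Type*} [Field k] [AddCommGroup P] [Module k P] {q : ℕ}

/-- Every element is a `k`-linear combination of elements fixed by `φ`. -/
theorem mem_span_fixed (hq : 1 < q) (hk : HasSubfields q k) (φ : P →+ P)
    (hφ : ∀ (c : k) y, φ (c • y) = c ^ q • φ y) {N : ℕ} (hN : 0 < N) {y : P}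
    (hy : φ^[N] y = y) : y ∈ Submodule.span k {y | φ y = y} := by
  classical
  obtain ⟨K, _, _, ι, hK⟩ := hk N hN
  have hiter : ∀ (i : ℕ) (c : k), φ^[i] (c • y) = c ^ q ^ i • φ^[i] y := by
    intro i c
    induction i with
    | zero => simp
    | succ i ih => rw [Function.iterate_succ_apply', ih, hφ, ← pow_mul, ← pow_succ,
        Function.iterate_succ_apply']
  -- The trace of `c • y`. It is fixed by `φ` because both `φ^N` on `y` and the `q ^ N`-power map on
  -- `K` are trivial.
  let t : K → P := fun c => ∑ i ∈ Finset.range N, φ^[i] (ι c • y)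
  have ht : ∀ c, φ (t c) = t c := by
    intro c
    simp only [t]
    rw [map_sum]
    simp_rw [← Function.iterate_succ_apply' φ]
    rw [← sub_eq_zero, ← Finset.sum_sub_distrib,
      Finset.sum_range_sub (fun i => φ^[i] (ι c • y)), hiter, hiter, hy, ← map_pow, ← hK,
      FiniteField.pow_card]
    simp
  -- Weighting the traces by `c⁻¹` and summing over `Kˣ` leaves only the term `i = 0`, by
  -- orthogonality.
  have key : y = -∑ c : Kˣ, (ι (c : K))⁻¹ • t c := by
    have h1 : ∀ c : Kˣ, (ι (c : K))⁻¹ • t c =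
        ∑ i ∈ Finset.range N, ι ((c : K) ^ q ^ i * ((c : K) ^ q ^ 0)⁻¹) • φ^[i] y := by
      intro c
      simp only [t]
      rw [Finset.smul_sum]
      refine Finset.sum_congr rfl fun i _ => ?_
      rw [hiter, smul_smul]
      congr 1
      rw [map_mul, map_pow, map_inv₀, pow_zero, pow_one, mul_comm]
    simp_rw [h1]
    rw [Finset.sum_comm]
    simp_rw [← Finset.sum_smul, ← map_sum]
    rw [Finset.sum_eq_single_of_mem 0 (Finset.mem_range.2 hN)]
    · rw [sum_units_pow_mul_inv_pow K hq hK hN hN]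
      simp
    · intro i hi hi0
      rw [sum_units_pow_mul_inv_pow K hq hK (Finset.mem_range.1 hi) hN, if_neg hi0]
      simp
  rw [key]
  exact neg_mem (Submodule.sum_mem _ fun c _ =>
    Submodule.smul_mem _ _ (Submodule.subset_span (ht c)))

/-- There are elements of nonzero trace. -/
theorem exists_trace_eq_one (F : Type*) [Field F] [Fintype F] [Algebra F k]
    (hk : HasSubfields (Fintype.card F) k) {N : ℕ} (hN : 0 < N) :
    ∃ c : k, ∑ i ∈ Finset.range N, c ^ Fintype.card F ^ i = 1 := by
  classical
  set q := Fintype.card F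
  have hq : 1 < q := Fintype.one_lt_card
  let φ : k →+ k := (FiniteField.frobeniusAlgHom F k : k →+* k).toAddMonoidHom
  obtain ⟨K, _, _, ι, hK⟩ := hk N hN
  have hφ1 : ∀ c, φ c = c ^ q := fun c => rfl
  -- The same orthogonality shows that the traces of units cannot all vanish.
  have key : ∑ c : Kˣ, (ι (c : K))⁻¹ * ∑ i ∈ Finset.range N, (ι (c : K)) ^ q ^ i = -1 := by
    have h1 : ∀ c : Kˣ, (ι (c : K))⁻¹ * ∑ i ∈ Finset.range N, (ι (c : K)) ^ q ^ i =
        ∑ i ∈ Finset.range N, ι ((c : K) ^ q ^ i * ((c : K) ^ q ^ 0)⁻¹) := by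
      intro c
      rw [Finset.mul_sum]
      refine Finset.sum_congr rfl fun i _ => ?_
      rw [map_mul, map_pow, map_inv₀, pow_zero, pow_one, mul_comm]
    simp_rw [h1]
    rw [Finset.sum_comm]
    simp_rw [← map_sum]
    rw [Finset.sum_eq_single_of_mem 0 (Finset.mem_range.2 hN)]
    · rw [sum_units_pow_mul_inv_pow K hq hK hN hN]
      simp
    · intro i hi hi0
      rw [sum_units_pow_mul_inv_pow K hq hK (Finset.mem_range.1 hi) hN, if_neg hi0]
  obtain ⟨c, hc⟩ : ∃ c : Kˣ, ∑ i ∈ Finset.range N, (ι (c : K)) ^ q ^ i ≠ 0 := by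
    by_contra! hcon
    simp only [hcon, mul_zero, Finset.sum_const_zero] at key
    exact one_ne_zero (neg_eq_zero.1 key.symm)
  set T := ∑ i ∈ Finset.range N, (ι (c : K)) ^ q ^ i with hT
  have hTq : T ^ q = T := by
    have h2 : T ^ q = ∑ i ∈ Finset.range N, (ι (c : K)) ^ q ^ (i + 1) := by
      rw [← hφ1, hT, map_sum]
      refine Finset.sum_congr rfl fun i _ => ?_
      rw [hφ1, ← pow_mul, ← pow_succ]
    rw [h2, hT, ← sub_eq_zero, ← Finset.sum_sub_distrib,
      Finset.sum_range_sub (fun i => (ι (c : K)) ^ q ^ i), ← map_pow, ← hK, FiniteField.pow_card]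
    simp
  have hTi : ∀ i, T ^ q ^ i = T := by
    intro i
    induction i with
    | zero => simp
    | succ i ih => rw [pow_succ, pow_mul, ih, hTq]
  -- `T` is fixed by all powers of Frobenius, so dividing `c` by `T` divides the trace by `T`.
  refine ⟨ι c / T, ?_⟩
  simp_rw [div_pow, hTi]
  rw [← Finset.sum_div, ← hT, div_self hc]

/-- `X ^ q - X` already splits over `F`, so its roots in `k` all come from `F`. -/
theorem exists_algebraMap_eq_of_pow_card (F : Type*) [Field F] [Fintype F] [Algebra F k] {x : k}
    (hx : x ^ Fintype.card F = x) : ∃ a : F, algebraMap F k a = x := by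
  have h : (Polynomial.X ^ Fintype.card F - Polynomial.X : Polynomial k) =
      ∏ a : F, (Polynomial.X - Polynomial.C (algebraMap F k a)) := by
    have h1 : ∏ a : F, (Polynomial.X - Polynomial.C a) =
        (Polynomial.X ^ Fintype.card F - Polynomial.X : Polynomial F) := by
      have hdeg := FiniteField.X_pow_card_sub_X_natDegree_eq F (Fintype.one_lt_card (α := F))
      have h0 := Polynomial.prod_multiset_X_sub_C_of_monic_of_roots_card_eq
        (p := (Polynomial.X ^ Fintype.card F - Polynomial.X : Polynomial F))
        (Polynomial.monic_X_pow_sub (by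
          rw [Polynomial.degree_X]; exact_mod_cast Fintype.one_lt_card (α := F)))
        (by rw [FiniteField.roots_X_pow_card_sub_X, hdeg]; rfl)
      rwa [FiniteField.roots_X_pow_card_sub_X] at h0
    have h2 := congrArg (Polynomial.map (algebraMap F k)) h1.symm
    simpa [Polynomial.map_prod] using h2
  have h3 := congrArg (Polynomial.eval x) h
  rw [Polynomial.eval_prod] at h3
  simp only [Polynomial.eval_sub, Polynomial.eval_pow, Polynomial.eval_X, Polynomial.eval_C, hx,
    sub_self] at h3
  obtain ⟨a, -, ha⟩ := Finset.prod_eq_zero_iff.1 h3.symm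
  exact ⟨a, (sub_eq_zero.1 ha).symm⟩

/-- `F`-linearly independent fixed vectors are `k`-linearly independent. -/
theorem linearIndependent_of_fixed (F : Type*) [Field F] [Fintype F] [Algebra F k] [Module F P]
    [IsScalarTower F k P] (φ : P →+ P)
    (hφ : ∀ (c : k) y, φ (c • y) = c ^ Fintype.card F • φ y) {ι : Type*} (b : ι → P)
    (hb : LinearIndependent F b) (hfix : ∀ i, φ (b i) = b i) : LinearIndependent k b := by
  classical
  rw [linearIndependent_iff']
  intro s
  induction s using Finset.induction_on with
  | empty => simp
  | insert i0 s hi0 ih =>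
    intro g hg
    by_cases h0 : g i0 = 0
    · rw [Finset.sum_insert hi0, h0, zero_smul, zero_add] at hg
      intro i hi
      rcases Finset.mem_insert.1 hi with rfl | hi
      · exact h0
      · exact ih g hg i hi
    · exfalso
      -- Artin's argument: normalise one coefficient to `1`, apply `φ` and subtract. The shorter
      -- relation is trivial by induction, so the coefficients are Frobenius-fixed.
      have hsum : b i0 + ∑ i ∈ s, ((g i0)⁻¹ * g i) • b i = 0 := by
        have := congrArg (fun z => (g i0)⁻¹ • z) hg
        simp only [Finset.sum_insert hi0, smul_add, smul_smul, inv_mul_cancel₀ h0, one_smul,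
          Finset.smul_sum, smul_zero] at this
        exact this
      have hsum2 : b i0 + ∑ i ∈ s, ((g i0)⁻¹ * g i) ^ Fintype.card F • b i = 0 := by
        have := congrArg φ hsum
        simpa only [map_add, map_sum, hφ, hfix, map_zero] using this
      have hdiff : ∑ i ∈ s, (((g i0)⁻¹ * g i) ^ Fintype.card F - (g i0)⁻¹ * g i) • b i = 0 := by
        simp_rw [sub_smul]
        rw [Finset.sum_sub_distrib, sub_eq_zero]
        exact add_left_cancel (hsum2.trans hsum.symm)
      -- Frobenius-fixed coefficients lie in `F`, which contradicts independence over `F`.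
      have hF : ∀ i, ∃ a : F, i ∈ s → algebraMap F k a = (g i0)⁻¹ * g i := by
        intro i
        by_cases hi : i ∈ s
        · obtain ⟨a, ha⟩ := exists_algebraMap_eq_of_pow_card F (sub_eq_zero.1 (ih _ hdiff i hi))
          exact ⟨a, fun _ => ha⟩
        · exact ⟨0, fun h => (hi h).elim⟩
      choose a ha using hF
      have hrel : ∑ i ∈ insert i0 s, (if i = i0 then (1 : F) else a i) • b i = 0 := by
        rw [Finset.sum_insert hi0, if_pos rfl, one_smul, ← hsum]
        congr 1
        refine Finset.sum_congr rfl fun i hi => ?_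
        rw [if_neg (ne_of_mem_of_not_mem hi hi0), ← ha i hi, algebraMap_smul]
      have := linearIndependent_iff'.1 hb _ _ hrel i0 (Finset.mem_insert_self _ _)
      simp at this

/-- A finite-dimensional `k`-vector space `P` with a Frobenius-semilinear map `φ` under which
all elements are periodic has `q ^ dim P` fixed vectors. -/
theorem card_fixed (F : Type*) [Field F] [Fintype F] [Algebra F k] [Module.Finite k P]
    (hk : HasSubfields (Fintype.card F) k) (φ : P →+ P)
    (hφ : ∀ (c : k) y, φ (c • y) = c ^ Fintype.card F • φ y)
    (hper : ∀ y, ∃ N, 0 < N ∧ φ^[N] y = y) :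
    Nat.card {y | φ y = y} = Fintype.card F ^ Module.finrank k P := by
  let : Module F P := Module.compHom P (algebraMap F k)
  have : IsScalarTower F k P := ⟨fun a b x => by rw [Algebra.smul_def, mul_smul]; rfl⟩
  let W : Submodule F P :=
    { carrier := {y | φ y = y}
      add_mem' := fun {a b} ha hb => by
        change φ (a + b) = a + b
        rw [map_add, show φ a = a from ha, show φ b = b from hb]
      zero_mem' := map_zero φ
      smul_mem' := fun a x hx => by
        change φ (a • x) = a • x
        rw [← algebraMap_smul k a x, hφ, ← map_pow, FiniteField.pow_card, show φ x = x from hx] }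
  -- An `F`-basis of the fixed space is a `k`-basis of `P`: independence by Artin's argument,
  -- generation by traces.
  let b := Module.Basis.ofVectorSpace F W
  have hli : LinearIndependent k (fun i => (b i : P)) :=
    linearIndependent_of_fixed F φ hφ _
      (b.linearIndependent.map' W.subtype (Submodule.ker_subtype _)) fun i => (b i).2
  have hspan : ⊤ ≤ Submodule.span k (Set.range fun i => (b i : P)) := by
    intro y _
    obtain ⟨N, hN, hy⟩ := hper y
    refine Submodule.span_le.2 ?_ (mem_span_fixed Fintype.one_lt_card hk φ hφ hN hy)
    intro x hx
    have h1 : (⟨x, hx⟩ : W) ∈ Submodule.span F (Set.range b) := by rw [b.span_eq]; trivial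
    have h2 := Submodule.mem_map_of_mem (f := W.subtype) h1
    rw [Submodule.map_span, ← Set.range_comp] at h2
    exact Submodule.span_le_restrictScalars F k _ h2
  let B := Module.Basis.mk hli hspan
  have : Finite (Module.Basis.ofVectorSpaceIndex F W) := Module.Finite.finite_basis B
  let _ : Fintype (Module.Basis.ofVectorSpaceIndex F W) := Fintype.ofFinite _
  have : Module.Finite F W := Module.Finite.of_basis b
  have : Finite W := Module.finite_of_finite F
  let _ : Fintype W := Fintype.ofFinite _
  change Nat.card W = _
  rw [Nat.card_eq_fintype_card, Module.card_eq_pow_finrank (K := F),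
    Module.finrank_eq_card_basis b, Module.finrank_eq_card_basis B]

end Descent

/-! ## Finite modules are determined by counting homomorphisms -/

section Counting

variable {R W : Type*} [Ring R] [AddCommGroup W] [Module R W]

/-- Homomorphisms are sorted by their exact kernel. This is a triangular system, to be inverted from
large submodules downwards. -/
theorem card_hom_eq_sum [Finite W] {X : Type*} [AddCommGroup X] [Module R X] [Finite X]
    (K : Submodule R W) [Fintype (Submodule R W)] [DecidableLE (Submodule R W)] :
    Nat.card {f : W →ₗ[R] X // K ≤ LinearMap.ker f} =
      ∑ K' : Submodule R W with K ≤ K', Nat.card {f : W →ₗ[R] X // LinearMap.ker f = K'} := by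
  have : Finite (W →ₗ[R] X) := DFunLike.finite _
  rw [Finset.sum_subtype (p := fun K' => K ≤ K') _ (by simp), ← Nat.card_sigma]
  refine Nat.card_congr ⟨fun f => ⟨⟨_, f.2⟩, ⟨f.1, rfl⟩⟩,
    fun f => ⟨f.2.1, by rw [f.2.2]; exact f.1.2⟩, fun f => rfl, ?_⟩
  rintro ⟨⟨K', hK'⟩, ⟨f, hf⟩⟩
  exact Sigma.subtype_ext (Subtype.ext hf) rfl

/-- Lovász: if for every submodule `K` of `W` there are as many homomorphisms from `W / K` to `X`
as to `W`, then `W` embeds into `X`. -/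
theorem exists_injective_of_card_hom_eq [Finite W] {X : Type*} [AddCommGroup X] [Module R X]
    [Finite X]
    (h : ∀ K : Submodule R W, Nat.card {f : W →ₗ[R] X // K ≤ LinearMap.ker f} =
      Nat.card {f : W →ₗ[R] W // K ≤ LinearMap.ker f}) :
    ∃ f : W →ₗ[R] X, Function.Injective f := by
  classical
  have : Finite (Submodule R W) := Finite.of_injective (fun K : Submodule R W => (K : Set W))
    SetLike.coe_injective
  let _ : Fintype (Submodule R W) := Fintype.ofFinite _
  -- Induction from the top of the submodule lattice: the contributions of kernels strictly
  -- containing `K` agree and cancel. At `K = ⊥` the identity of `W` then forces an injective map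
  -- into `X`.
  have key : ∀ K : Submodule R W, Nat.card {f : W →ₗ[R] X // LinearMap.ker f = K} =
      Nat.card {f : W →ₗ[R] W // LinearMap.ker f = K} := by
    intro K
    induction K using WellFoundedGT.induction with
    | ind K ih =>
      have h1 := h K
      rw [card_hom_eq_sum, card_hom_eq_sum] at h1
      have hK : K ∈ Finset.univ.filter fun K' => K ≤ K' := by simp
      rw [← Finset.add_sum_erase _ (fun K' => Nat.card {f : W →ₗ[R] X // LinearMap.ker f = K'}) hK,
        ← Finset.add_sum_erase _ (fun K' => Nat.card {f : W →ₗ[R] W // LinearMap.ker f = K'}) hK,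
        Finset.sum_congr rfl (g := fun K' => Nat.card {f : W →ₗ[R] W // LinearMap.ker f = K'})]
        at h1
      · exact Nat.add_right_cancel h1
      · intro K' hK'
        rw [Finset.mem_erase, Finset.mem_filter] at hK'
        exact ih K' (lt_of_le_of_ne hK'.2.2 (Ne.symm hK'.1))
  have hpos : 0 < Nat.card {f : W →ₗ[R] X // LinearMap.ker f = ⊥} := by
    have : Finite (W →ₗ[R] W) := DFunLike.finite _
    rw [key]
    have : Nonempty {f : W →ₗ[R] W // LinearMap.ker f = ⊥} := ⟨⟨LinearMap.id, LinearMap.ker_id⟩⟩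
    exact Nat.card_pos
  obtain ⟨⟨f, hf⟩⟩ := (Nat.card_pos_iff.1 hpos).1
  exact ⟨f, LinearMap.ker_eq_bot.1 hf⟩

end Counting

end TauSheaf

namespace TauSheaf

/-! ### Two Frobenius maps on one finite-dimensional space -/

section FiniteLevel

variable {R k P : Type*} [CommRing R] [Field k] [AddCommGroup P] [Module R P] [Module k P]
  [SMulCommClass R k P]

/-- The homomorphisms `W → P` that vanish on `K`. -/
def homVanishing (k : Type*) [Field k] [Module k P] [SMulCommClass R k P] {W : Type*}
    [AddCommGroup W] [Module R W] (K : Submodule R W) :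
    Submodule k (W →ₗ[R] P) where
  carrier := {f | K ≤ LinearMap.ker f}
  add_mem' := fun {f g} hf hg x hx => by
    rw [LinearMap.mem_ker, LinearMap.add_apply, LinearMap.mem_ker.1 (hf hx),
      LinearMap.mem_ker.1 (hg hx), add_zero]
  zero_mem' := fun x _ => rfl
  smul_mem' := fun c f hf x hx => by
    rw [LinearMap.mem_ker, LinearMap.smul_apply, LinearMap.mem_ker.1 (hf hx), smul_zero]

theorem finite_homVanishing [Module.Finite k P] {W : Type*} [AddCommGroup W] [Module R W] [Finite W]
    (K : Submodule R W) : Module.Finite k (homVanishing k (P := P) K) := by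
  let ev : homVanishing k (P := P) K →ₗ[k] (W → P) :=
    { toFun := fun f => f.1
      map_add' := fun _ _ => rfl
      map_smul' := fun _ _ => rfl }
  exact Module.Finite.of_injective ev fun f g h => Subtype.ext (DFunLike.coe_injective h)

theorem exists_common_period {ι X : Type*} [Finite ι] (φ : X → X) (x : ι → X)
    (h : ∀ i, ∃ N, 0 < N ∧ φ^[N] (x i) = x i) : ∃ N, 0 < N ∧ ∀ i, φ^[N] (x i) = x i := by
  cases nonempty_fintype ι
  choose N hN hx using h
  refine ⟨∏ i, N i, Finset.prod_pos fun i _ => hN i, fun i => ?_⟩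
  exact Function.IsPeriodicPt.trans_dvd (f := φ) (hx i) (Finset.dvd_prod_of_mem N (Finset.mem_univ i))

/-- Counting the homomorphisms into the fixed points of a Frobenius-semilinear map. -/
theorem card_hom_fixed (F : Type*) [Field F] [Fintype F] [Algebra F k] [Module.Finite k P]
    (hk : HasSubfields (Fintype.card F) k) (φ : P →ₗ[R] P)
    (hφ : ∀ (c : k) y, φ (c • y) = c ^ Fintype.card F • φ y)
    (hper : ∀ y, ∃ N, 0 < N ∧ φ^[N] y = y)
    {W : Type*} [AddCommGroup W] [Module R W] [Finite W] (K : Submodule R W) :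
    Nat.card {f : W →ₗ[R] LinearMap.eqLocus φ LinearMap.id // K ≤ LinearMap.ker f} =
      Fintype.card F ^ Module.finrank k (homVanishing k (P := P) K) := by
  have := finite_homVanishing (k := k) (P := P) K
  -- Composition with `φ` is again Frobenius-semilinear, and its fixed points are the maps with
  -- values in the fixed points of `φ`; so `card_fixed` applies to the space of maps.
  let Φ : homVanishing k (P := P) K →+ homVanishing k (P := P) K :=
    { toFun := fun f => ⟨φ ∘ₗ f.1, fun x hx => by
        rw [LinearMap.mem_ker, LinearMap.comp_apply, LinearMap.mem_ker.1 (f.2 hx), map_zero]⟩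
      map_zero' := Subtype.ext (LinearMap.comp_zero φ)
      map_add' := fun f g => Subtype.ext (LinearMap.comp_add _ _ _) }
  have hΦ : ∀ (N : ℕ) f w, (Φ^[N] f).1 w = φ^[N] (f.1 w) := by
    intro N f w
    induction N with
    | zero => rfl
    | succ N ih => rw [Function.iterate_succ_apply', Function.iterate_succ_apply', ← ih]; rfl
  rw [← card_fixed F hk Φ]
  · refine Nat.card_congr ⟨fun f => ⟨⟨(LinearMap.eqLocus φ LinearMap.id).subtype ∘ₗ f.1, ?_⟩, ?_⟩,
      fun f => ⟨f.1.1.codRestrict _ fun w => ?_, ?_⟩, fun f => rfl, fun f => rfl⟩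
    · intro x hx
      rw [LinearMap.mem_ker, LinearMap.comp_apply, LinearMap.mem_ker.1 (f.2 hx), map_zero]
    · exact Subtype.ext (LinearMap.ext fun w => (f.1 w).2)
    · exact DFunLike.congr_fun (congrArg Subtype.val f.2) w
    · exact fun x hx => Subtype.ext (f.1.2 hx)
  · intro c f
    exact Subtype.ext (LinearMap.ext fun w => hφ c (f.1 w))
  · intro f
    -- `W` is finite, so the values of `f` have a common period, which is then a period of `f`.
    obtain ⟨N, hN, h⟩ := exists_common_period φ f.1 fun w => hper (f.1 w)
    exact ⟨N, hN, Subtype.ext (LinearMap.ext fun w => (hΦ N f w).trans (h w))⟩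

theorem card_hom_pi {W T : Type*} [AddCommGroup W] [Module R W] [AddCommGroup T] [Module R T]
    (e : ℕ) (K : Submodule R W) :
    Nat.card {f : W →ₗ[R] (Fin e → T) // K ≤ LinearMap.ker f} =
      Nat.card {f : W →ₗ[R] T // K ≤ LinearMap.ker f} ^ e := by
  have h : Nat.card (Fin e → {f : W →ₗ[R] T // K ≤ LinearMap.ker f}) =
      Nat.card {f : W →ₗ[R] T // K ≤ LinearMap.ker f} ^ e := by
    rw [Nat.card_fun, Nat.card_eq_fintype_card (α := Fin e), Fintype.card_fin]
  rw [← h]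
  refine Nat.card_congr ⟨fun f i => ⟨LinearMap.proj i ∘ₗ f.1, fun x hx => ?_⟩,
    fun g => ⟨LinearMap.pi fun i => (g i).1, fun x hx => ?_⟩, fun f => rfl, fun g => rfl⟩
  · exact congrFun (f.2 hx) i
  · exact funext fun i => (g i).2 hx

/-- The fixed points of an `F`-Frobenius and of an `L`-Frobenius which commute with `R`. -/
theorem nonempty_equiv_fixed (F L : Type*) [Field F] [Fintype F] [Field L] [Fintype L]
    [Algebra F k] [Algebra L k] {e : ℕ} (he : 0 < e) (hcard : Fintype.card L = Fintype.card F ^ e)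
    (hk : HasSubfields (Fintype.card F) k) (φ ψ : P →ₗ[R] P)
    (hφ : ∀ (c : k) y, φ (c • y) = c ^ Fintype.card F • φ y)
    (hψ : ∀ (c : k) y, ψ (c • y) = c ^ Fintype.card L • ψ y)
    (hφp : ∀ y, ∃ N, 0 < N ∧ φ^[N] y = y) (hψp : ∀ y, ∃ N, 0 < N ∧ ψ^[N] y = y)
    [Finite (LinearMap.eqLocus ψ LinearMap.id)] :
    Finite (LinearMap.eqLocus φ LinearMap.id) ∧
    Nonempty (LinearMap.eqLocus ψ LinearMap.id ≃ₗ[R] (Fin e → LinearMap.eqLocus φ LinearMap.id)) := by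
  have hkL : HasSubfields (Fintype.card L) k := hcard ▸ hk.pow he
  -- The finitely many fixed points of `ψ` already span `P`.
  have : Module.Finite k P := by
    refine ⟨Submodule.fg_def.2 ⟨{y | ψ y = y},
      (inferInstance : Finite (LinearMap.eqLocus ψ LinearMap.id)), ?_⟩⟩
    refine eq_top_iff.2 fun y _ => ?_
    obtain ⟨N, hN, hy⟩ := hψp y
    exact mem_span_fixed (φ := ψ.toAddMonoidHom) Fintype.one_lt_card hkL hψ hN hy
  have hT : Nat.card (LinearMap.eqLocus φ LinearMap.id) = _ :=
    card_fixed F hk φ.toAddMonoidHom hφ hφp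
  have hW : Nat.card (LinearMap.eqLocus ψ LinearMap.id) = _ :=
    card_fixed L hkL ψ.toAddMonoidHom hψ hψp
  have hTfin : Finite (LinearMap.eqLocus φ LinearMap.id) :=
    Nat.finite_of_card_ne_zero (by rw [hT]; positivity)
  refine ⟨hTfin, ?_⟩
  -- Both counts equal `|F| ^ (e · h)`, with `h` the dimension of the space of maps into `P`
  -- vanishing on `K`, which does not involve `φ` or `ψ`. The case of cardinalities then upgrades
  -- the embedding to an isomorphism.
  obtain ⟨f, hf⟩ := exists_injective_of_card_hom_eq (R := R)
    (W := LinearMap.eqLocus ψ LinearMap.id) (X := Fin e → LinearMap.eqLocus φ LinearMap.id)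
    (fun K => by
      rw [card_hom_pi, card_hom_fixed F hk φ hφ hφp, card_hom_fixed L hkL ψ hψ hψp, hcard,
        ← pow_mul, ← pow_mul, mul_comm])
  refine ⟨LinearEquiv.ofBijective f ((Nat.bijective_iff_injective_and_card f).2 ⟨hf, ?_⟩)⟩
  rw [Nat.card_fun, Nat.card_eq_fintype_card (α := Fin e), Fintype.card_fin, hT, hW, hcard,
    ← pow_mul, ← pow_mul, mul_comm]

end FiniteLevel

end TauSheaf

namespace TauSheaf

/-! ## Intertwining maps -/

section Intertwiners

variable {K V V' : Type*} [CommRing K] [AddCommGroup V] [Module K V] [AddCommGroup V'] [Module K V']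

/-- The linear maps `g` with `g ∘ f = f' ∘ g`. -/
def intertwiners (f : Module.End K V) (f' : Module.End K V') : Submodule K (V →ₗ[K] V') where
  carrier := {g | g ∘ₗ f = f' ∘ₗ g}
  add_mem' := fun {a b} ha hb => by
    change (a + b) ∘ₗ f = f' ∘ₗ (a + b)
    rw [LinearMap.add_comp, LinearMap.comp_add, show a ∘ₗ f = _ from ha, show b ∘ₗ f = _ from hb]
  zero_mem' := by
    change (0 : V →ₗ[K] V') ∘ₗ f = f' ∘ₗ 0
    rw [LinearMap.zero_comp, LinearMap.comp_zero]
  smul_mem' := fun c a ha => by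
    change (c • a) ∘ₗ f = f' ∘ₗ (c • a)
    rw [LinearMap.smul_comp, LinearMap.comp_smul, show a ∘ₗ f = _ from ha]

theorem mem_intertwiners {f : Module.End K V} {f' : Module.End K V'} {g : V →ₗ[K] V'} :
    g ∈ intertwiners f f' ↔ ∀ x, g (f x) = f' (g x) :=
  LinearMap.ext_iff

/-- The linear map `g ↦ g ∘ f - f' ∘ g` whose kernel consists of the intertwining maps. -/
def commutatorMap (f : Module.End K V) (f' : Module.End K V') :
    (V →ₗ[K] V') →ₗ[K] (V →ₗ[K] V') :=
  LinearMap.lcomp K V' f - LinearMap.compRight K f'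

theorem commutatorMap_apply (f : Module.End K V) (f' : Module.End K V') (g : V →ₗ[K] V') :
    commutatorMap f f' g = g ∘ₗ f - f' ∘ₗ g := rfl

theorem ker_commutatorMap (f : Module.End K V) (f' : Module.End K V') :
    LinearMap.ker (commutatorMap f f') = intertwiners f f' := by
  ext g
  rw [LinearMap.mem_ker]
  exact sub_eq_zero

variable {V₁ V₁' : Type*} [AddCommGroup V₁] [Module K V₁] [AddCommGroup V₁'] [Module K V₁']

/-- Intertwining maps of conjugate endomorphisms. -/
def intertwinersCongr {f : Module.End K V} {f' : Module.End K V'} {f₁ : Module.End K V₁}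
    {f₁' : Module.End K V₁'} (e : V ≃ₗ[K] V₁) (e' : V' ≃ₗ[K] V₁') (h : ∀ x, e (f x) = f₁ (e x))
    (h' : ∀ x, e' (f' x) = f₁' (e' x)) : intertwiners f f' ≃ₗ[K] intertwiners f₁ f₁' :=
  LinearEquiv.ofSubmodules (e.arrowCongr e') _ _ (by
    ext g
    rw [Submodule.mem_map_equiv, mem_intertwiners, mem_intertwiners]
    have hs : ∀ x, e.symm (f₁ x) = f (e.symm x) := fun x => by
      rw [LinearEquiv.symm_apply_eq, h, LinearEquiv.apply_symm_apply]
    have hs' : ∀ x, e'.symm (f₁' x) = f' (e'.symm x) := fun x => by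
      rw [LinearEquiv.symm_apply_eq, h', LinearEquiv.apply_symm_apply]
    have hg : ∀ x, (e.arrowCongr e').symm g x = e'.symm (g (e x)) := fun x => rfl
    simp_rw [hg, h, ← hs', e'.symm.injective.eq_iff]
    exact (e.surjective.forall (p := fun x => g (f₁ x) = f₁' (g x))).symm)

/-- The endomorphism of `V ^ e` induced by `f`. -/
def piEnd (e : ℕ) (f : Module.End K V) : Module.End K (Fin e → V) :=
  LinearMap.pi fun i => f ∘ₗ LinearMap.proj i

@[simp] theorem piEnd_apply (e : ℕ) (f : Module.End K V) (x : Fin e → V) (i : Fin e) :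
    piEnd e f x i = f (x i) := rfl

/-- Intertwining maps of powers. -/
def intertwinersPi (e : ℕ) (f : Module.End K V) (f' : Module.End K V') :
    intertwiners (piEnd e f) (piEnd e f') ≃ₗ[K] (Fin e → Fin e → intertwiners f f') where
  toFun g i j := ⟨LinearMap.proj i ∘ₗ g.1 ∘ₗ LinearMap.single K (fun _ => V) j,
    mem_intertwiners.2 fun x => by
      have h := congrFun (mem_intertwiners.1 g.2 (Pi.single j x)) i
      have hs : piEnd e f (Pi.single j x) = Pi.single j (f x) := by
        ext j'
        rw [piEnd_apply]
        rcases eq_or_ne j' j with rfl | hj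
        · simp
        · simp [hj]
      rwa [hs, piEnd_apply] at h⟩
  map_add' _ _ := rfl
  map_smul' _ _ := rfl
  invFun h := ⟨LinearMap.pi fun i => ∑ j, (h i j).1 ∘ₗ LinearMap.proj j,
    mem_intertwiners.2 fun x => by
      ext i
      simp only [LinearMap.pi_apply, LinearMap.sum_apply, LinearMap.comp_apply,
        LinearMap.proj_apply, piEnd_apply, map_sum]
      exact Finset.sum_congr rfl fun j _ => mem_intertwiners.1 (h i j).2 (x j)⟩
  left_inv g := by
    refine Subtype.ext (LinearMap.ext fun x => funext fun i => ?_)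
    simp only [LinearMap.pi_apply, LinearMap.sum_apply, LinearMap.comp_apply,
      LinearMap.proj_apply]
    rw [← Finset.sum_apply, ← map_sum]
    exact congrFun (congrArg g.1 (LinearMap.sum_single_apply (fun _ => V) x)) i
  right_inv h := by
    ext i j x
    simp only [LinearMap.pi_apply, LinearMap.sum_apply, LinearMap.comp_apply,
      LinearMap.proj_apply, LinearMap.single_apply]
    rw [Finset.sum_eq_single j]
    · simp
    · intro b _ hb
      simp [hb]
    · simp

theorem finrank_intertwiners_piEnd {K V V' : Type*} [Field K] [AddCommGroup V] [Module K V]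
    [AddCommGroup V'] [Module K V'] [Module.Finite K V] [Module.Finite K V'] (e : ℕ)
    (f : Module.End K V) (f' : Module.End K V') :
    Module.finrank K (intertwiners (piEnd e f) (piEnd e f')) =
      e * (e * Module.finrank K (intertwiners f f')) := by
  rw [(intertwinersPi e f f').finrank_eq, Module.finrank_pi_fintype]
  simp [Module.finrank_pi_fintype]

/-- The space of intertwining maps is compatible with extension of the base field. -/
theorem finrank_intertwiners_baseChange {K V V' : Type*} [Field K] [AddCommGroup V] [Module K V]
    [AddCommGroup V'] [Module K V'] [Module.Finite K V] [Module.Finite K V'] (E : Type*) [Field E]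
    [Algebra K E] (f : Module.End K V) (f' : Module.End K V') :
    Module.finrank E (intertwiners (f.baseChange E) (f'.baseChange E)) =
      Module.finrank K (intertwiners f f') := by
  -- Intertwining maps form the kernel of the commutator map; both the space of linear maps (in
  -- finite dimension) and kernels are compatible with extension of the field.
  let Θ := commutatorMap f f'
  have hb : IsBaseChange E (LinearMap.baseChangeHom K E V V') :=
    have := Module.finitePresentation_of_finite K V
    Module.FinitePresentation.isBaseChange_map K V V' E
  have hker : (LinearMap.ker (TensorProduct.AlgebraTensorModule.lTensor E E Θ)).map
      (hb.equiv : E ⊗[K] (V →ₗ[K] V') →ₗ[E] (E ⊗[K] V →ₗ[E] E ⊗[K] V')) =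
      intertwiners (f.baseChange E) (f'.baseChange E) := by
    let Θ' := commutatorMap (f.baseChange E) (f'.baseChange E)
    have hcomm : Θ' ∘ₗ (hb.equiv : E ⊗[K] (V →ₗ[K] V') →ₗ[E] (E ⊗[K] V →ₗ[E] E ⊗[K] V')) =
        (hb.equiv : E ⊗[K] (V →ₗ[K] V') →ₗ[E] (E ⊗[K] V →ₗ[E] E ⊗[K] V')) ∘ₗ
          TensorProduct.AlgebraTensorModule.lTensor E E Θ := by
      refine TensorProduct.AlgebraTensorModule.ext fun a g => ?_
      have h1 : Θ' (LinearMap.baseChangeHom K E V V' g) = LinearMap.baseChangeHom K E V V' (Θ g) := by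
        refine TensorProduct.AlgebraTensorModule.ext fun b x => ?_
        simp [Θ, Θ', commutatorMap_apply]
      simp only [LinearMap.comp_apply, LinearEquiv.coe_coe,
        TensorProduct.AlgebraTensorModule.lTensor_tmul, hb.equiv_tmul, map_smul, h1]
    ext g
    rw [Submodule.mem_map_equiv, LinearMap.mem_ker, ← ker_commutatorMap, LinearMap.mem_ker]
    have h2 := LinearMap.congr_fun hcomm (hb.equiv.symm g)
    simp only [LinearMap.comp_apply, LinearEquiv.coe_coe, LinearEquiv.apply_symm_apply] at h2
    rw [← hb.equiv.map_eq_zero_iff, ← h2]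
  rw [← hker, LinearEquiv.finrank_map_eq, ← (LinearMap.tensorKerEquiv E E Θ).finrank_eq,
    Module.finrank_baseChange, ker_commutatorMap]

/-- Intertwining maps out of a product. -/
def intertwinersProdLeft (f : Module.End K V) (f₁ : Module.End K V₁) (f' : Module.End K V') :
    intertwiners (f.prodMap f₁) f' ≃ₗ[K] intertwiners f f' × intertwiners f₁ f' where
  toFun g := ⟨⟨g.1 ∘ₗ LinearMap.inl K V V₁, mem_intertwiners.2 fun x => by
      simpa using mem_intertwiners.1 g.2 (x, 0)⟩,
    ⟨g.1 ∘ₗ LinearMap.inr K V V₁, mem_intertwiners.2 fun x => by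
      simpa using mem_intertwiners.1 g.2 (0, x)⟩⟩
  map_add' _ _ := rfl
  map_smul' _ _ := rfl
  invFun h := ⟨h.1.1.coprod h.2.1, mem_intertwiners.2 fun x => by
    simp [mem_intertwiners.1 h.1.2, mem_intertwiners.1 h.2.2]⟩
  left_inv g := Subtype.ext (LinearMap.ext fun x => by
    change g.1 (x.1, 0) + g.1 (0, x.2) = g.1 x
    rw [← map_add]
    simp)
  right_inv h := by ext <;> simp

end Intertwiners

/-! ## Semisimple endomorphisms -/

section Semisimple

universe u

/-- `f` has no invariant subspaces besides `0` and the whole space. -/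
def IsSimpleEnd {K V : Type*} [Field K] [AddCommGroup V] [Module K V] (f : Module.End K V) : Prop :=
  Nontrivial V ∧ ∀ p ∈ f.invtSubmodule, p = ⊥ ∨ p = ⊤

/-- Semisimple endomorphisms are built from simple ones. -/
theorem semisimple_induction {K : Type*} [Field K]
    {motive : ∀ (V : Type u) [AddCommGroup V] [Module K V], Module.End K V → Prop}
    (subsingleton : ∀ (V : Type u) [AddCommGroup V] [Module K V] (f : Module.End K V)
      [Subsingleton V], motive V f)
    (prod : ∀ (V₁ V₂ : Type u) [AddCommGroup V₁] [Module K V₁] [AddCommGroup V₂] [Module K V₂]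
      [Module.Finite K V₁] [Module.Finite K V₂]
      (f₁ : Module.End K V₁) (f₂ : Module.End K V₂), IsSimpleEnd f₁ → motive V₂ f₂ →
        motive (V₁ × V₂) (f₁.prodMap f₂))
    (congr : ∀ (V₁ V₂ : Type u) [AddCommGroup V₁] [Module K V₁] [AddCommGroup V₂] [Module K V₂]
      [Module.Finite K V₁] [Module.Finite K V₂]
      (f₁ : Module.End K V₁) (f₂ : Module.End K V₂) (e : V₁ ≃ₗ[K] V₂),
      (∀ x, e (f₁ x) = f₂ (e x)) → motive V₁ f₁ → motive V₂ f₂)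
    (V : Type u) [AddCommGroup V] [Module K V] [Module.Finite K V] (f : Module.End K V)
    (hf : f.IsSemisimple) : motive V f := by
  induction hn : Module.finrank K V using Nat.strong_induction_on generalizing V with
  | _ n ih =>
    by_cases hV : Subsingleton V
    · exact subsingleton V f
    have : Nontrivial V := not_subsingleton_iff_nontrivial.1 hV
    -- A minimal nonzero invariant subspace carries a simple endomorphism, and semisimplicity
    -- supplies an invariant complement of smaller dimension.
    obtain ⟨S, ⟨hS, hS0⟩, hmin⟩ := WellFounded.has_min
      (wellFounded_lt (α := Submodule K V)) {p | p ∈ f.invtSubmodule ∧ p ≠ ⊥}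
      ⟨⊤, Module.End.invtSubmodule.top_mem f, top_ne_bot⟩
    obtain ⟨S', hS', hc⟩ := Module.End.isSemisimple_iff.1 hf S hS
    have hlt : Module.finrank K S' < n := by
      have h1 := Submodule.finrank_add_eq_of_isCompl hc
      have h2 : 0 < Module.finrank K S := by
        have : Nontrivial S := Submodule.nontrivial_iff_ne_bot.2 hS0
        exact Module.finrank_pos
      omega
    refine congr (S × S') V ((f.restrict hS).prodMap (f.restrict hS')) f
      (Submodule.prodEquivOfIsCompl S S' hc) (fun x => ?_)
      (prod _ _ _ _ ⟨Submodule.nontrivial_iff_ne_bot.2 hS0, fun p hp => ?_⟩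
        (ih _ hlt S' _ (hf.restrict hS') rfl))
    · simp only [Submodule.coe_prodEquivOfIsCompl', LinearMap.prodMap_apply, map_add]
      rfl
    · have h1 := Module.End.invtSubmodule.map_subtype_mem_of_mem_invtSubmodule f hS hp
      by_cases hp0 : p = ⊥
      · exact Or.inl hp0
      · right
        have h2 : p.map S.subtype ≠ ⊥ := fun h => hp0
          (Submodule.map_injective_of_injective S.injective_subtype
            (h.trans (Submodule.map_bot _).symm))
        have h3 : ¬ p.map S.subtype < S := hmin _ ⟨h1, h2⟩
        have h4 : p.map S.subtype = S := eq_of_le_of_not_lt (Submodule.map_subtype_le S p) h3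
        exact Submodule.map_injective_of_injective S.injective_subtype
          (by rw [h4, Submodule.map_subtype_top])

variable {K V V' : Type*} [Field K] [AddCommGroup V] [Module K V] [AddCommGroup V'] [Module K V']

open Polynomial

theorem ker_aeval_mem_invtSubmodule (f : Module.End K V) (p : K[X]) :
    LinearMap.ker (aeval f p) ∈ f.invtSubmodule := by
  intro x hx
  rw [Submodule.mem_comap, LinearMap.mem_ker]
  rw [LinearMap.mem_ker] at hx
  have h : aeval f (p * X) = aeval f (X * p) := by rw [mul_comm]
  rw [map_mul, map_mul, aeval_X] at h
  have := LinearMap.congr_fun h x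
  rw [Module.End.mul_apply, Module.End.mul_apply, hx, map_zero] at this
  exact this

namespace IsSimpleEnd

variable {f : Module.End K V} (hf : IsSimpleEnd f)
include hf

/-- The kernel of `p(f)` is invariant and contains `v ≠ 0`, so it is everything. -/
theorem aeval_eq_zero {p : K[X]} {v : V} (hv : v ≠ 0) (h : aeval f p v = 0) : aeval f p = 0 := by
  rcases hf.2 _ (ker_aeval_mem_invtSubmodule f p) with h1 | h1
  · exact (hv ((Submodule.eq_bot_iff _).1 h1 v h)).elim
  · exact LinearMap.ker_eq_top.1 h1

/-- Every nonzero vector is cyclic, since the vectors `p(f) v` form a nonzero invariant subspace.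
Thus `V` is a quotient of `K[X]`. -/
theorem exists_aeval {v : V} (hv : v ≠ 0) (w : V) : ∃ p : K[X], aeval f p v = w := by
  let φ : K[X] →ₗ[K] V := LinearMap.applyₗ v ∘ₗ (aeval f).toLinearMap
  have hφ : ∀ p, φ p = aeval f p v := fun p => rfl
  have hinv : LinearMap.range φ ∈ f.invtSubmodule := by
    rintro _ ⟨p, rfl⟩
    refine ⟨X * p, ?_⟩
    rw [hφ, hφ, map_mul, aeval_X]
    rfl
  rcases hf.2 _ hinv with h | h
  · refine (hv ?_).elim
    have : φ 1 ∈ LinearMap.range φ := ⟨1, rfl⟩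
    rw [h, Submodule.mem_bot, hφ, map_one] at this
    exact this
  · exact LinearMap.range_eq_top.1 h w

/-- Cyclicity lets polynomials of degree below that of the minimal polynomial map onto `V`, so its
degree is at least `dim V`; it also divides the characteristic polynomial. -/
theorem charpoly_eq_minpoly [Module.Finite K V] : f.charpoly = minpoly K f := by
  have := hf.1
  obtain ⟨v, hv⟩ := exists_ne (0 : V)
  have hint : IsIntegral K f := LinearMap.isIntegral f
  have hmon := minpoly.monic hint
  refine eq_of_monic_of_dvd_of_natDegree_le hmon f.charpoly_monic
    (LinearMap.minpoly_dvd_charpoly f) ?_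
  rw [LinearMap.charpoly_natDegree]
  let φ : degreeLT K (minpoly K f).natDegree →ₗ[K] V :=
    LinearMap.applyₗ v ∘ₗ (aeval f).toLinearMap ∘ₗ (degreeLT K _).subtype
  have hφ : Function.Surjective φ := by
    intro w
    obtain ⟨p, hp⟩ := hf.exists_aeval hv w
    refine ⟨⟨p %ₘ minpoly K f, mem_degreeLT.2 ?_⟩, ?_⟩
    · rw [← degree_eq_natDegree hmon.ne_zero]
      exact degree_modByMonic_lt p hmon
    · change aeval f (p %ₘ minpoly K f) v = w
      rw [aeval_modByMonic_eq_self_of_root (minpoly.aeval K f), hp]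
  have := LinearMap.finrank_le_finrank_of_surjective hφ
  rwa [(degreeLTEquiv K _).finrank_eq, Module.finrank_fin_fun] at this

/-- If `a(f) b(f) = 0` and `b(f) w ≠ 0`, then `a(f)` kills a nonzero vector and hence vanishes: the
minimal polynomial is prime. -/
theorem irreducible_charpoly [Module.Finite K V] : Irreducible f.charpoly := by
  have := hf.1
  rw [hf.charpoly_eq_minpoly]
  have hint : IsIntegral K f := LinearMap.isIntegral f
  rw [irreducible_iff_prime]
  refine ⟨(minpoly.monic hint).ne_zero, minpoly.not_isUnit K f, fun a b hab => ?_⟩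
  rw [minpoly.dvd_iff, minpoly.dvd_iff]
  have h : aeval f a * aeval f b = 0 := by rw [← map_mul, minpoly.dvd_iff.1 hab]
  by_contra! hcon
  obtain ⟨w, hw⟩ : ∃ w, aeval f b w ≠ 0 := by
    by_contra! h2
    exact hcon.2 (LinearMap.ext h2)
  exact hcon.1 (hf.aeval_eq_zero hw (LinearMap.congr_fun h w))

theorem aeval_eq_zero_iff [Module.Finite K V] {p : K[X]} : aeval f p = 0 ↔ f.charpoly ∣ p := by
  rw [hf.charpoly_eq_minpoly, minpoly.dvd_iff]

/-- Evaluation at a vector identifies the intertwining maps from a simple endomorphism. -/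
theorem finrank_intertwiners [Module.Finite K V] (f' : Module.End K V') :
    Module.finrank K (intertwiners f f') =
      Module.finrank K (LinearMap.ker (aeval f' f.charpoly)) := by
  have := hf.1
  obtain ⟨v, hv⟩ := exists_ne (0 : V)
  have hcomm : ∀ g ∈ intertwiners f f', ∀ p : K[X], g (aeval f p v) = aeval f' p (g v) := by
    intro g hg p
    induction p using Polynomial.induction_on' with
    | add p q hp hq => simp [hp, hq]
    | monomial n a =>
      have h : ∀ m, g ((f ^ m) v) = (f' ^ m) (g v) := by
        intro m
        induction m with
        | zero => rfl
        | succ m ih => rw [pow_succ', pow_succ', Module.End.mul_apply, Module.End.mul_apply,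
            mem_intertwiners.1 hg, ih]
      simp [aeval_monomial, h]
  let ev : intertwiners f f' →ₗ[K] LinearMap.ker (aeval f' f.charpoly) :=
    (LinearMap.applyₗ v ∘ₗ (intertwiners f f').subtype).codRestrict _ fun g => by
      rw [LinearMap.mem_ker]
      change aeval f' f.charpoly (g.1 v) = 0
      rw [← hcomm g.1 g.2, LinearMap.aeval_self_charpoly]
      exact map_zero g.1
  have hev : ∀ g, (ev g : V') = g.1 v := fun g => rfl
  refine (LinearEquiv.ofBijective ev ⟨?_, ?_⟩).finrank_eq
  · rw [injective_iff_map_eq_zero]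
    intro g hg
    refine Subtype.ext (LinearMap.ext fun w => ?_)
    obtain ⟨p, rfl⟩ := hf.exists_aeval hv w
    have h0 : g.1 v = 0 := by rw [← hev, hg]; rfl
    rw [hcomm g.1 g.2, h0, map_zero]
    rfl
  · intro w
    let φ : K[X] →ₗ[K] V := LinearMap.applyₗ v ∘ₗ (aeval f).toLinearMap
    let φ' : K[X] →ₗ[K] V' := LinearMap.applyₗ (w : V') ∘ₗ (aeval f').toLinearMap
    have hφ : ∀ p, φ p = aeval f p v := fun p => rfl
    have hφ' : ∀ p, φ' p = aeval f' p (w : V') := fun p => rfl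
    have hsurj : Function.Surjective φ := fun x => hf.exists_aeval hv x
    -- `V` is `K[X]` modulo the characteristic polynomial, so `v` may be sent to any vector that
    -- this polynomial of `f'` kills.
    have hker : LinearMap.ker φ ≤ LinearMap.ker φ' := by
      intro p hp
      rw [LinearMap.mem_ker, hφ] at hp
      obtain ⟨r, rfl⟩ := hf.aeval_eq_zero_iff.1 (hf.aeval_eq_zero hv hp)
      rw [LinearMap.mem_ker, hφ', mul_comm, map_mul, Module.End.mul_apply,
        LinearMap.mem_ker.1 w.2, map_zero]
    let g : V →ₗ[K] V' := (LinearMap.ker φ).liftQ φ' hker ∘ₗ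
      (φ.quotKerEquivOfSurjective hsurj).symm.toLinearMap
    have hg : ∀ p : K[X], g (aeval f p v) = aeval f' p (w : V') := by
      intro p
      have h1 : (φ.quotKerEquivOfSurjective hsurj).symm (φ p) = (LinearMap.ker φ).mkQ p := by
        rw [LinearEquiv.symm_apply_eq]
        rfl
      change (LinearMap.ker φ).liftQ φ' hker ((φ.quotKerEquivOfSurjective hsurj).symm (φ p)) = _
      rw [h1]
      rfl
    refine ⟨⟨g, mem_intertwiners.2 fun x => ?_⟩, Subtype.ext ?_⟩
    · obtain ⟨p, rfl⟩ := hf.exists_aeval hv x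
      rw [hg]
      have h1 : f (aeval f p v) = aeval f (X * p) v := by rw [map_mul, aeval_X]; rfl
      rw [h1, hg, map_mul, aeval_X]
      rfl
    · rw [hev]
      simpa using hg 1

end IsSimpleEnd

/-! ### The pairing `r` -/

open UniqueFactorizationMonoid

-- Summing over factors with repetition, rather than over distinct ones, makes the pairing visibly
-- additive in both arguments.
open Classical in
theorem rPairing_eq_sum (f g : K[X]) :
    rPairing f g = ((normalizedFactors f).map fun μ =>
      (normalizedFactors g).count μ * μ.natDegree).sum := by
  rw [Finset.sum_multiset_map_count, rPairing]
  simp [mul_assoc]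

theorem rPairing_mul_left {f g h : K[X]} (hf : f ≠ 0) (hg : g ≠ 0) :
    rPairing (f * g) h = rPairing f h + rPairing g h := by
  classical
  simp only [rPairing_eq_sum, normalizedFactors_mul hf hg, Multiset.map_add, Multiset.sum_add]

theorem rPairing_mul_right {f g h : K[X]} (hg : g ≠ 0) (hh : h ≠ 0) :
    rPairing f (g * h) = rPairing f g + rPairing f h := by
  classical
  simp only [rPairing_eq_sum, normalizedFactors_mul hg hh, Multiset.count_add, add_mul,
    Multiset.sum_map_add]

theorem rPairing_one_left (g : K[X]) : rPairing 1 g = 0 := by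
  simp [rPairing_eq_sum]

theorem rPairing_one_right (g : K[X]) : rPairing g 1 = 0 := by
  simp [rPairing_eq_sum]

open Classical in
theorem rPairing_irreducible {f g : K[X]} (hf : Irreducible f) (hg : Irreducible g) (hf1 : f.Monic)
    (hg1 : g.Monic) : rPairing f g = if f = g then f.natDegree else 0 := by
  rw [rPairing_eq_sum, normalizedFactors_irreducible hf, normalizedFactors_irreducible hg,
    hf1.normalize_eq_self, hg1.normalize_eq_self]
  simp [Multiset.count_singleton]

theorem finrank_ker_aeval_prodMap {V₁ V₂ : Type*} [AddCommGroup V₁] [Module K V₁]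
    [AddCommGroup V₂] [Module K V₂] [Module.Finite K V₁] [Module.Finite K V₂]
    (f₁ : Module.End K V₁) (f₂ : Module.End K V₂) (p : K[X]) :
    Module.finrank K (LinearMap.ker (aeval (f₁.prodMap f₂) p)) =
      Module.finrank K (LinearMap.ker (aeval f₁ p)) +
        Module.finrank K (LinearMap.ker (aeval f₂ p)) := by
  have h : aeval (f₁.prodMap f₂) p = (aeval f₁ p).prodMap (aeval f₂ p) := by
    have h1 := aeval_algHom_apply (LinearMap.prodMapAlgHom K V₁ V₂) (f₁, f₂) p
    rw [aeval_prod_apply] at h1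
    exact h1
  rw [h, LinearMap.ker_prodMap, ← Module.finrank_prod]
  exact LinearEquiv.finrank_eq
    { toFun := fun x => (⟨x.1.1, x.2.1⟩, ⟨x.1.2, x.2.2⟩)
      map_add' := fun _ _ => rfl
      map_smul' := fun _ _ => rfl
      invFun := fun x => ⟨(x.1.1, x.2.1), x.1.2, x.2.2⟩
      left_inv := fun _ => rfl
      right_inv := fun _ => rfl }

/-- Both sides are additive over simple summands. On a simple summand the kernel of `μ` is
invariant, so it is everything or zero according to whether `μ` is the characteristic polynomial
there. -/
theorem finrank_ker_aeval_of_isSemisimple {V : Type u} [AddCommGroup V] [Module K V]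
    [Module.Finite K V] (f : Module.End K V) (hf : f.IsSemisimple) {μ : K[X]} (hμ : Irreducible μ)
    (hμ1 : μ.Monic) :
    Module.finrank K (LinearMap.ker (aeval f μ)) = rPairing μ (charPoly f) := by
  revert hf
  refine fun hf => semisimple_induction (motive := fun V _ _ f =>
    Module.finrank K (LinearMap.ker (aeval f μ)) = rPairing μ (charPoly f)) ?_ ?_ ?_ V f hf
  · intro V _ _ f _
    have : Module.Finite K V := inferInstance
    rw [charPoly, dif_pos this]
    have h1 : f.charpoly = 1 := eq_one_of_monic_natDegree_zero f.charpoly_monic (by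
      rw [LinearMap.charpoly_natDegree, Module.finrank_zero_of_subsingleton])
    rw [h1, rPairing_one_right, Module.finrank_zero_of_subsingleton]
  · intro V₁ V₂ _ _ _ _ _ _ f₁ f₂ hf₁ ih
    have h1 : Module.Finite K (V₁ × V₂) := inferInstance
    have h2 : Module.Finite K V₂ := inferInstance
    rw [charPoly, dif_pos h2] at ih
    rw [finrank_ker_aeval_prodMap, ih, charPoly, dif_pos h1, LinearMap.charpoly_prodMap,
      rPairing_mul_right f₁.charpoly_monic.ne_zero f₂.charpoly_monic.ne_zero,
      rPairing_irreducible hμ hf₁.irreducible_charpoly hμ1 f₁.charpoly_monic]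
    congr 1
    split_ifs with h
    · rw [h, LinearMap.aeval_self_charpoly, LinearMap.ker_zero, finrank_top,
        LinearMap.charpoly_natDegree]
    · rcases hf₁.2 _ (ker_aeval_mem_invtSubmodule f₁ μ) with h0 | h0
      · rw [h0, finrank_bot]
      · refine (h ?_).elim
        have h3 := hf₁.aeval_eq_zero_iff.1 (LinearMap.ker_eq_top.1 h0)
        exact (eq_of_monic_of_associated f₁.charpoly_monic hμ1
          (hf₁.irreducible_charpoly.associated_of_dvd hμ h3)).symm
  · intro V₁ V₂ _ _ _ _ hfin₁ hfin₂ f₁ f₂ e he ih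
    have hconj : f₂ = e.conj f₁ := by
      ext x
      rw [LinearEquiv.conj_apply_apply, he, e.apply_symm_apply]
    rw [charPoly, dif_pos hfin₁] at ih
    rw [charPoly, dif_pos hfin₂, hconj, LinearEquiv.charpoly_conj, ← ih]
    have h3 : aeval (e.conj f₁) μ = e.conj (aeval f₁ μ) :=
      aeval_algHom_apply (e.conjAlgEquiv K : Module.End K V₁ →ₐ[K] Module.End K V₂) f₁ μ
    have h4 : LinearMap.ker (e.conj (aeval f₁ μ)) =
        (LinearMap.ker (aeval f₁ μ)).map (e : V₁ →ₗ[K] V₂) := by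
      ext x
      rw [Submodule.mem_map_equiv, LinearMap.mem_ker, LinearMap.mem_ker,
        LinearEquiv.conj_apply_apply, e.map_eq_zero_iff]
    rw [h3, h4, LinearEquiv.finrank_map_eq]

/-- The dimension of the space of intertwining maps between semisimple endomorphisms. -/
theorem finrank_intertwiners_of_isSemisimple {V : Type u} [AddCommGroup V] [Module K V]
    [Module.Finite K V] {V' : Type*} [AddCommGroup V'] [Module K V'] [Module.Finite K V']
    (f : Module.End K V) (f' : Module.End K V') (hf : f.IsSemisimple) (hf' : f'.IsSemisimple) :
    Module.finrank K (intertwiners f f') = rPairing (charPoly f) (charPoly f') := by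
  refine semisimple_induction (motive := fun V _ _ f =>
    Module.finrank K (intertwiners f f') = rPairing (charPoly f) (charPoly f')) ?_ ?_ ?_ V f hf
  · intro V _ _ f _
    have : Module.Finite K V := inferInstance
    rw [charPoly, dif_pos this]
    have h1 : f.charpoly = 1 := eq_one_of_monic_natDegree_zero f.charpoly_monic (by
      rw [LinearMap.charpoly_natDegree, Module.finrank_zero_of_subsingleton])
    rw [h1, rPairing_one_left, Module.finrank_zero_of_subsingleton]
  · intro V₁ V₂ _ _ _ _ _ _ f₁ f₂ hf₁ ih
    have h1 : Module.Finite K (V₁ × V₂) := inferInstance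
    have h2 : Module.Finite K V₂ := inferInstance
    rw [charPoly, dif_pos h2] at ih
    -- For the simple summand `f₁` with characteristic polynomial `χ₁` the intertwining maps
    -- correspond to the kernel of `χ₁(f')`, whose dimension the multiplicity of `χ₁` for `f'`
    -- determines.
    rw [(intertwinersProdLeft f₁ f₂ f').finrank_eq, Module.finrank_prod, ih,
      hf₁.finrank_intertwiners, finrank_ker_aeval_of_isSemisimple f' hf' hf₁.irreducible_charpoly
        f₁.charpoly_monic, charPoly, charPoly, dif_pos h1, LinearMap.charpoly_prodMap,
      rPairing_mul_left f₁.charpoly_monic.ne_zero f₂.charpoly_monic.ne_zero]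
  · intro V₁ V₂ _ _ _ _ hfin₁ hfin₂ f₁ f₂ e he ih
    have hconj : f₂ = e.conj f₁ := by
      ext x
      rw [LinearEquiv.conj_apply_apply, he, e.apply_symm_apply]
    rw [charPoly, dif_pos hfin₁] at ih
    have h3 := (intertwinersCongr (f' := f') (f₁' := f') e (LinearEquiv.refl K V') he
      fun _ => rfl).finrank_eq
    rw [charPoly, dif_pos hfin₂, ← h3, ih, hconj, LinearEquiv.charpoly_conj]

end Semisimple

end TauSheaf

namespace TauSheaf

/-! ## Semilinear endomorphisms -/

section Semilinear

variable {F L : Type*} [Field F] [Fintype F] [Field L] [Fintype L] [Algebra F L]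

variable (F L) in
theorem sum_units_pow [DecidableEq L] (i j : Fin (Module.finrank F L)) :
    ∑ c : Lˣ, ((c : L) ^ Fintype.card F ^ (i : ℕ) * ((c : L) ^ Fintype.card F ^ (j : ℕ))⁻¹) =
      if i = j then -1 else 0 := by
  rw [sum_units_pow_mul_inv_pow L Fintype.one_lt_card (Module.card_eq_pow_finrank (K := F)) i.2 j.2]
  simp [Fin.ext_iff]

theorem pow_card_pow_finrank (c : L) : c ^ Fintype.card F ^ Module.finrank F L = c := by
  rw [← Module.card_eq_pow_finrank (K := F) (V := L), FiniteField.pow_card]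

theorem sum_pow_eq_trace (c : L) :
    ∑ j : Fin (Module.finrank F L), c ^ Fintype.card F ^ (j : ℕ) =
      algebraMap F L (Algebra.trace F L c) := by
  rw [FiniteField.algebraMap_trace_eq_sum_pow, Nat.card_eq_fintype_card,
    Fin.sum_univ_eq_sum_range (fun j => c ^ Fintype.card F ^ j)]

theorem exists_pow_card_pow (c : L) (j : ℕ) : ∃ b : L, b ^ Fintype.card F ^ j = c := by
  have h : Function.Bijective ⇑((FiniteField.frobeniusAlgHom F L) ^ j) :=
    Finite.injective_iff_bijective.1 ((FiniteField.frobeniusAlgHom F L) ^ j).toRingHom.injective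
  obtain ⟨b, hb⟩ := h.2 c
  refine ⟨b, ?_⟩
  rw [← hb, AlgHom.coe_pow, FiniteField.coe_frobeniusAlgHom, pow_iterate]

-- Expanding the trace as `∑ x^{q^j} c^{-q^j}`, orthogonality over `c` kills all terms except `j =
-- 0`. The formula recovers `x` from its traces without choosing dual bases, with all units as
-- indices.
variable (F) in
theorem eq_neg_sum_trace_smul [DecidableEq L] (x : L) :
    x = -∑ c : Lˣ, Algebra.trace F L (x * (c : L)⁻¹) • (c : L) := by
  obtain ⟨i₀, hi₀⟩ : ∃ i : Fin (Module.finrank F L), (i : ℕ) = 0 := ⟨⟨0, Module.finrank_pos⟩, rfl⟩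
  have h : ∀ c : Lˣ, Algebra.trace F L (x * (c : L)⁻¹) • (c : L) =
      ∑ j : Fin (Module.finrank F L), x ^ Fintype.card F ^ (j : ℕ) *
        ((c : L) ^ Fintype.card F ^ (i₀ : ℕ) *
          ((c : L) ^ Fintype.card F ^ (j : ℕ))⁻¹) := by
    intro c
    rw [Algebra.smul_def, ← sum_pow_eq_trace, Finset.sum_mul]
    refine Finset.sum_congr rfl fun j _ => ?_
    rw [mul_pow, inv_pow, hi₀, pow_zero, pow_one]
    ring
  simp_rw [h]
  rw [Finset.sum_comm]
  simp_rw [← Finset.mul_sum, sum_units_pow F L]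
  simp [hi₀]

variable {K V V' : Type*} [Field K] [Algebra F K]
  [AddCommGroup V] [Module K V] [Module L V] [SMulCommClass K L V]
  [AddCommGroup V'] [Module K V'] [Module L V'] [SMulCommClass K L V']

variable (L) in
/-- The `L`-linear intertwining maps. -/
def linearIntertwiners (φ : Module.End K V) (φ' : Module.End K V') : Submodule K (V →ₗ[K] V') where
  carrier := {g | g ∈ intertwiners φ φ' ∧ ∀ (b : L) x, g (b • x) = b • g x}
  add_mem' := fun {f g} hf hg => ⟨add_mem hf.1 hg.1, fun b x => by
    rw [LinearMap.add_apply, LinearMap.add_apply, hf.2, hg.2, smul_add]⟩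
  zero_mem' := ⟨zero_mem _, fun b x => (smul_zero b).symm⟩
  smul_mem' := fun a f hf => ⟨Submodule.smul_mem _ a hf.1, fun b x => by
    rw [LinearMap.smul_apply, LinearMap.smul_apply, hf.2, smul_comm]⟩

omit [Field F] [Fintype L] [Algebra F L] [Algebra F K] [SMulCommClass K L V] in
theorem pow_apply_smul {φ : Module.End K V} (hφ : ∀ (b : L) x, φ (b • x) = b ^ Fintype.card F • φ x)
    (j : ℕ) (b : L) (x : V) : (φ ^ j) (b • x) = b ^ Fintype.card F ^ j • (φ ^ j) x := by
  induction j with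
  | zero => simp
  | succ j ih => rw [pow_succ' φ, Module.End.mul_apply, ih, hφ, Module.End.mul_apply, ← pow_mul,
      ← pow_succ]

theorem mem_intertwiners_pow {φ : Module.End K V} {φ' : Module.End K V'} {g : V →ₗ[K] V'}
    (hg : g ∈ intertwiners φ φ') (j : ℕ) (x : V) : g ((φ ^ j) x) = (φ' ^ j) (g x) := by
  induction j with
  | zero => rfl
  | succ j ih => rw [pow_succ', pow_succ', Module.End.mul_apply, Module.End.mul_apply,
      mem_intertwiners.1 hg, ih]

variable (φ : Module.End K V) (φ' : Module.End K V')
  (hφ : ∀ (b : L) x, φ (b • x) = b ^ Fintype.card F • φ x)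
  (hφ' : ∀ (b : L) x, φ' (b • x) = b ^ Fintype.card F • φ' x)
  (hbij : Function.Bijective φ)
  (hF : ∀ (a : F) (x : V), algebraMap F L a • x = algebraMap F K a • x)
  (hF' : ∀ (a : F) (x : V'), algebraMap F L a • x = algebraMap F K a • x)

include hφ hφ' hbij hF hF' in
/-- Intertwining maps are sums of Frobenius-semilinear ones. -/
theorem finrank_intertwiners_eq_mul [Module.Finite K V] [Module.Finite K V'] :
    Module.finrank K (intertwiners (φ ^ Module.finrank F L) (φ' ^ Module.finrank F L)) =
      Module.finrank F L * Module.finrank K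
        (linearIntertwiners L (φ ^ Module.finrank F L) (φ' ^ Module.finrank F L)) := by
  classical
  set e := Module.finrank F L with he
  set q := Fintype.card F
  have hbijj : ∀ j : ℕ, Function.Bijective ⇑(φ ^ j) := fun j => by
    rw [Module.End.coe_pow]
    exact hbij.iterate j
  have hcommφ : ∀ j x, (φ ^ j) ((φ ^ e) x) = (φ ^ e) ((φ ^ j) x) := fun j x => by
    rw [← Module.End.mul_apply, ← Module.End.mul_apply, ← pow_add, ← pow_add, add_comm]
  have hπ : ∀ (b : L) x, (φ ^ e) (b • x) = b • (φ ^ e) x := fun b x => by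
    rw [pow_apply_smul hφ, pow_card_pow_finrank]
  have hπ' : ∀ (b : L) x, (φ' ^ e) (b • x) = b • (φ' ^ e) x := fun b x => by
    rw [pow_apply_smul hφ', pow_card_pow_finrank]
  -- The composite `h_j ∘ φ^j` is the `q^j`-semilinear component of the image; the claim is that
  -- these components exist and are unique.
  let S : (Fin e → linearIntertwiners L (φ ^ e) (φ' ^ e)) →ₗ[K] intertwiners (φ ^ e) (φ' ^ e) :=
    { toFun := fun h => ⟨∑ j, (h j).1 ∘ₗ φ ^ (j : ℕ), mem_intertwiners.2 fun x => by
        simp only [LinearMap.sum_apply, LinearMap.comp_apply, map_sum]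
        refine Finset.sum_congr rfl fun j _ => ?_
        rw [hcommφ, mem_intertwiners.1 (h j).2.1]⟩
      map_add' := fun h h' => Subtype.ext (LinearMap.ext fun x => by
        simp [LinearMap.sum_apply, Finset.sum_add_distrib])
      map_smul' := fun a h => Subtype.ext (LinearMap.ext fun x => by
        simp [LinearMap.sum_apply, Finset.smul_sum]) }
  have hS : ∀ h x, (S h).1 x = ∑ j, (h j).1 ((φ ^ (j : ℕ)) x) := fun h x => by
    simp [S, LinearMap.sum_apply]
  have hSbij : Function.Bijective S := by
    constructor
    · rw [injective_iff_map_eq_zero]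
      intro h hh
      ext j v
      obtain ⟨v, rfl⟩ := (hbijj j).2 v
      have h1 : ∀ c : L, ∑ i : Fin e, c ^ q ^ (i : ℕ) • (h i).1 ((φ ^ (i : ℕ)) v) = 0 := by
        intro c
        have h2 := hS h (c • v)
        rw [hh] at h2
        simp_rw [pow_apply_smul hφ, (h _).2.2] at h2
        exact h2.symm
      -- Evaluating at `c • v` multiplies the `i`-th component by `c^{q^i}`; pairing with `c^{-q^j}`
      -- isolates the `j`-th.
      have h3 : ∑ c : Lˣ, ((c : L) ^ q ^ (j : ℕ))⁻¹ •
          ∑ i : Fin e, (c : L) ^ q ^ (i : ℕ) • (h i).1 ((φ ^ (i : ℕ)) v) = 0 :=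
        Finset.sum_eq_zero fun c _ => by rw [h1, smul_zero]
      simp_rw [Finset.smul_sum, smul_smul] at h3
      rw [Finset.sum_comm] at h3
      simp_rw [← Finset.sum_smul, mul_comm (_)⁻¹] at h3
      have h4 : ∀ i : Fin e, ∑ c : Lˣ, ((c : L) ^ q ^ (i : ℕ) * ((c : L) ^ q ^ (j : ℕ))⁻¹) =
        if i = j then -1 else 0 := fun i => sum_units_pow F L i j
      simp_rw [h4] at h3
      simpa using h3
    · intro f
      -- The projection of `f` onto its `q^j`-semilinear part, obtained by averaging over `Lˣ`;
      -- semilinearity is the substitution `c ↦ c b`.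
      have hg : ∀ j : Fin e, ∃ g : V →ₗ[K] V',
          ∀ v, g v = -∑ c : Lˣ, ((c : L) ^ q ^ (j : ℕ))⁻¹ • f.1 ((c : L) • v) := fun j =>
        ⟨-∑ c : Lˣ, ((c : L) ^ q ^ (j : ℕ))⁻¹ • f.1 ∘ₗ
          { toFun := fun v => (c : L) • v
            map_add' := fun _ _ => smul_add _ _ _
            map_smul' := fun a v => (smul_comm a _ v).symm }, fun v => by simp [LinearMap.sum_apply]⟩
      choose g hg using hg
      have hgs : ∀ j (b : L) v, g j (b • v) = b ^ q ^ (j : ℕ) • g j v := by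
        intro j b v
        rcases eq_or_ne b 0 with rfl | hb
        · rw [zero_smul, map_zero, zero_pow (pow_ne_zero _ Fintype.card_ne_zero), zero_smul]
        · rw [hg, hg, smul_neg, Finset.smul_sum]
          congr 1
          refine Fintype.sum_equiv (Equiv.mulRight (Units.mk0 b hb)) _ _ fun c => ?_
          rw [Equiv.coe_mulRight, Units.val_mul, Units.val_mk0, smul_smul, smul_smul, mul_pow,
            mul_inv, mul_left_comm, mul_inv_cancel₀ (pow_ne_zero _ hb), mul_one]
      let h : Fin e → (V →ₗ[K] V') := fun j =>
        g j ∘ₗ (LinearEquiv.ofBijective (φ ^ (j : ℕ)) (hbijj j)).symm.toLinearMap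
      have hh : ∀ j v, h j ((φ ^ (j : ℕ)) v) = g j v := fun j v => by
        change g j ((LinearEquiv.ofBijective (φ ^ (j : ℕ)) (hbijj j)).symm
          (LinearEquiv.ofBijective (φ ^ (j : ℕ)) (hbijj j) v)) = _
        rw [LinearEquiv.symm_apply_apply]
      refine ⟨fun j => ⟨h j, mem_intertwiners.2 fun x => ?_, fun b x => ?_⟩, ?_⟩
      · obtain ⟨v, rfl⟩ := (hbijj j).2 x
        rw [← hcommφ, hh, hh, hg, hg, map_neg, map_sum]
        congr 1
        refine Finset.sum_congr rfl fun c _ => ?_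
        rw [← hπ, mem_intertwiners.1 f.2, hπ']
      · obtain ⟨v, rfl⟩ := (hbijj j).2 x
        obtain ⟨b, rfl⟩ := exists_pow_card_pow (F := F) b j
        rw [← pow_apply_smul hφ, hh, hh, hgs]
      · refine Subtype.ext (LinearMap.ext fun v => ?_)
        rw [hS]
        simp only [hh, hg]
        -- The projections add up to `f`: summing over `j` produces `-∑ Tr(c⁻¹) • f (c • v)`. The
        -- traces lie in `F`, pass through the `K`-linear map `f`, and leave `-∑ Tr(c⁻¹) c = 1`
        -- inside.
        have key := eq_neg_sum_trace_smul F (1 : L)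
        rw [Finset.sum_neg_distrib, Finset.sum_comm]
        simp_rw [← Finset.sum_smul]
        have h1 : ∀ c : Lˣ, ∑ j : Fin e, ((c : L) ^ q ^ (j : ℕ))⁻¹ =
            algebraMap F L (Algebra.trace F L (1 * (c : L)⁻¹)) := fun c => by
          rw [← sum_pow_eq_trace]
          simp [q, e]
        simp_rw [h1, hF', ← map_smul, ← hF, smul_smul, ← map_sum, ← map_neg, ← Finset.sum_smul,
          ← neg_smul, ← Algebra.smul_def]
        rw [← key, one_smul]
  rw [← (LinearEquiv.ofBijective S hSbij).finrank_eq, Module.finrank_pi_fintype]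
  simp

omit [SMulCommClass K L V] in
include hφ hφ' hbij hF' in
/-- Galois descent for intertwining maps. -/
theorem finrank_linearIntertwiners_pow [Module.Finite K V] [Module.Finite K V'] :
    Module.finrank K (linearIntertwiners L (φ ^ Module.finrank F L) (φ' ^ Module.finrank F L)) =
      Module.finrank F L * Module.finrank K (linearIntertwiners L φ φ') := by
  classical
  set e := Module.finrank F L with he
  set q := Fintype.card F
  have hbijj : ∀ j : ℕ, Function.Bijective ⇑(φ ^ j) := fun j => by
    rw [Module.End.coe_pow]
    exact hbij.iterate j
  let b : Module.Basis (Fin e) F L := Module.finBasis F L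
  -- The map `f ↦ φ' f φ⁻¹` is Frobenius-semilinear on the target and its `e`-th iterate is trivial;
  -- its fixed maps commute with `φ`. Descent says that an `F`-basis of `L` combines fixed maps
  -- uniquely into all maps.
  let S : (Fin e → linearIntertwiners L φ φ') →ₗ[K] linearIntertwiners L (φ ^ e) (φ' ^ e) :=
    { toFun := fun h => ⟨∑ i, b i • (h i).1, mem_intertwiners.2 fun x => by
          simp only [LinearMap.sum_apply, LinearMap.smul_apply, map_sum]
          refine Finset.sum_congr rfl fun i _ => ?_
          rw [mem_intertwiners_pow (h i).2.1, pow_apply_smul hφ', pow_card_pow_finrank],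
        fun c x => by
          simp only [LinearMap.sum_apply, LinearMap.smul_apply, Finset.smul_sum]
          refine Finset.sum_congr rfl fun i _ => ?_
          rw [(h i).2.2, smul_comm]⟩
      map_add' := fun h h' => Subtype.ext (by simp [Finset.sum_add_distrib])
      map_smul' := fun a h => Subtype.ext (LinearMap.ext fun x => by
        simp only [LinearMap.sum_apply, LinearMap.smul_apply, Finset.smul_sum, RingHom.id_apply,
          Pi.smul_apply, Submodule.coe_smul]
        exact Finset.sum_congr rfl fun i _ => (smul_comm a (b i) _).symm) }
  have hS : ∀ h x, (S h).1 x = ∑ i, b i • (h i).1 x := fun h x => by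
    simp [S, LinearMap.sum_apply]
  have hSbij : Function.Bijective S := by
    constructor
    · rw [injective_iff_map_eq_zero]
      intro h hh
      -- Applying `φ'^j` to the relation raises its coefficients to the power `q^j`, and `φ^j` is
      -- onto.
      have h1 : ∀ (j : ℕ) w, ∑ i, b i ^ q ^ j • (h i).1 w = 0 := by
        intro j w
        obtain ⟨v, rfl⟩ := (hbijj j).2 w
        have h2 := congrArg (φ' ^ j) (hS h v)
        rw [hh, map_sum] at h2
        simp_rw [pow_apply_smul hφ', ← mem_intertwiners_pow (h _).2.1] at h2
        rw [← h2]
        exact map_zero (φ' ^ j)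
      ext i₀ w
      have h3 : ∑ i, (algebraMap F L (b.coord i₀ (b i))) • (h i).1 w = 0 := by
        -- By the trace formula each coordinate function is an `L`-combination of the maps `x ↦
        -- x^{q^j}`. So the conjugated relations imply the relation with coordinates as
        -- coefficients, which isolates `h i₀`.
        have h4 : ∀ x, algebraMap F L (b.coord i₀ x) = -∑ c : Lˣ, ∑ j : Fin e,
            algebraMap F L (b.coord i₀ (c : L)) * ((c : L)⁻¹) ^ q ^ (j : ℕ) * x ^ q ^ (j : ℕ) := by
          intro x
          conv_lhs => rw [eq_neg_sum_trace_smul F x]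
          rw [map_neg, map_neg, map_sum, map_sum]
          congr 1
          refine Finset.sum_congr rfl fun c _ => ?_
          rw [map_smul, smul_eq_mul, map_mul, ← sum_pow_eq_trace, Finset.sum_mul]
          refine Finset.sum_congr rfl fun j _ => ?_
          rw [mul_pow]
          ring
        rw [Finset.sum_congr rfl fun i _ => by rw [h4 (b i)]]
        simp_rw [neg_smul, Finset.sum_smul, mul_smul]
        rw [Finset.sum_neg_distrib, Finset.sum_comm]
        refine neg_eq_zero.2 (Finset.sum_eq_zero fun c _ => ?_)
        rw [Finset.sum_comm]
        refine Finset.sum_eq_zero fun j _ => ?_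
        rw [← Finset.smul_sum, ← Finset.smul_sum, h1, smul_zero, smul_zero]
      rw [Finset.sum_eq_single i₀] at h3
      · simpa using h3
      · intro i _ hi
        simp [hi]
      · simp
    · intro f
      -- The trace of `c f` under conjugation. It commutes with `φ` because the sum telescopes, and
      -- it closes up since `c^{q^e} = c` and `f` commutes with the `e`-th powers.
      have hg : ∀ c : L, ∃ g : linearIntertwiners L φ φ', ∀ (v : V), g.1 v =
          ∑ j ∈ Finset.range e, c ^ q ^ j •
            (φ' ^ j) (f.1 ((LinearEquiv.ofBijective (φ ^ j) (hbijj j)).symm v)) := by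
        intro c
        let g : V →ₗ[K] V' := ∑ j ∈ Finset.range e, c ^ q ^ j • (φ' ^ j) ∘ₗ f.1 ∘ₗ
          (LinearEquiv.ofBijective (φ ^ j) (hbijj j)).symm.toLinearMap
        have hg : ∀ v, g v = ∑ j ∈ Finset.range e, c ^ q ^ j •
            (φ' ^ j) (f.1 ((LinearEquiv.ofBijective (φ ^ j) (hbijj j)).symm v)) := fun v => by
          simp [g, LinearMap.sum_apply]
        have hsymm : ∀ j v, (LinearEquiv.ofBijective (φ ^ j) (hbijj j)).symm ((φ ^ j) v) = v :=
          fun j v => (LinearEquiv.ofBijective (φ ^ j) (hbijj j)).symm_apply_apply v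
        refine ⟨⟨g, mem_intertwiners.2 fun v => ?_, fun b v => ?_⟩, hg⟩
        · rw [hg, hg, map_sum, ← sub_eq_zero]
          let u : ℕ → V' := fun j => c ^ q ^ j • (φ' ^ j)
            (f.1 ((LinearEquiv.ofBijective (φ ^ j) (hbijj j)).symm (φ v)))
          have hu : ∀ j, φ' (c ^ q ^ j •
              (φ' ^ j) (f.1 ((LinearEquiv.ofBijective (φ ^ j) (hbijj j)).symm v))) = u (j + 1) := by
            intro j
            obtain ⟨w, rfl⟩ := (hbijj j).2 v
            simp only [u]
            rw [← Module.End.mul_apply φ, ← pow_succ', hsymm, hsymm, hφ', ← pow_mul, ← pow_succ,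
              ← Module.End.mul_apply φ', ← pow_succ']
          simp_rw [hu]
          change ∑ j ∈ Finset.range e, u j - _ = 0
          rw [← Finset.sum_sub_distrib, ← neg_eq_zero, ← Finset.sum_neg_distrib]
          simp_rw [neg_sub]
          rw [Finset.sum_range_sub, sub_eq_zero]
          simp only [u]
          rw [pow_card_pow_finrank, ← mem_intertwiners.1 f.2.1, pow_zero, pow_one]
          congr 1
          change f.1 ((LinearEquiv.ofBijective (φ ^ e) (hbijj e))
            ((LinearEquiv.ofBijective (φ ^ e) (hbijj e)).symm (φ v))) = _
          rw [LinearEquiv.apply_symm_apply]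
          change _ = f.1 ((LinearEquiv.ofBijective (φ ^ 0) (hbijj 0)).symm ((φ ^ 0) (φ v)))
          rw [hsymm]
        · rw [hg, hg, Finset.smul_sum]
          refine Finset.sum_congr rfl fun j _ => ?_
          obtain ⟨w, rfl⟩ := (hbijj j).2 v
          obtain ⟨b, rfl⟩ := exists_pow_card_pow (F := F) b j
          rw [← pow_apply_smul hφ, hsymm, hsymm, f.2.2, pow_apply_smul hφ', smul_comm]
      choose g hg using hg
      have key : ∀ v, f.1 v = -∑ c : Lˣ, (c : L)⁻¹ • (g (c : L)).1 v := by
        intro v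
        obtain ⟨i₀, hi₀⟩ : ∃ i : Fin e, (i : ℕ) = 0 := ⟨⟨0, Module.finrank_pos⟩, rfl⟩
        have h1 : ∀ c : Lˣ, (c : L)⁻¹ • (g (c : L)).1 v = ∑ j : Fin e,
            ((c : L) ^ q ^ (j : ℕ) * ((c : L) ^ q ^ (i₀ : ℕ))⁻¹) •
              (φ' ^ (j : ℕ)) (f.1 ((LinearEquiv.ofBijective (φ ^ (j : ℕ)) (hbijj j)).symm v)) := by
          intro c
          rw [hg, Finset.smul_sum, Finset.sum_range]
          refine Finset.sum_congr rfl fun j _ => ?_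
          rw [smul_smul, hi₀, pow_zero, pow_one, mul_comm]
        simp_rw [h1]
        rw [Finset.sum_comm]
        simp_rw [← Finset.sum_smul]
        have h4 : ∀ i : Fin e, ∑ c : Lˣ, ((c : L) ^ q ^ (i : ℕ) * ((c : L) ^ q ^ (i₀ : ℕ))⁻¹) =
          if i = i₀ then -1 else 0 := fun i => sum_units_pow F L i i₀
        simp_rw [h4]
        simp only [ite_smul, neg_smul, one_smul, zero_smul, Finset.sum_ite_eq', Finset.mem_univ,
          if_true, neg_neg, hi₀]
        change f.1 v = f.1 _
        congr 1
        rw [LinearEquiv.eq_symm_apply]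
        rfl
      -- Expanding `c⁻¹` in the basis `b` turns the reconstruction `f = -∑ c⁻¹ g_c` into a
      -- combination of fixed maps with basis coefficients.
      refine ⟨fun i => -∑ c : Lˣ, algebraMap F K (b.coord i (c : L)⁻¹) • g (c : L),
        Subtype.ext (LinearMap.ext fun v => ?_)⟩
      rw [hS, key]
      have h1 : ∀ i, (-∑ c : Lˣ, algebraMap F K (b.coord i (c : L)⁻¹) • g (c : L)).1 v =
          -∑ c : Lˣ, algebraMap F L (b.coord i (c : L)⁻¹) • (g (c : L)).1 v := by
        intro i
        simp_rw [hF']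
        simp [LinearMap.sum_apply]
      simp_rw [h1, smul_neg]
      rw [Finset.sum_neg_distrib]
      simp_rw [Finset.smul_sum, smul_smul]
      rw [Finset.sum_comm]
      congr 1
      refine Finset.sum_congr rfl fun c _ => ?_
      rw [← Finset.sum_smul]
      congr 1
      conv_rhs => rw [← b.sum_repr (c : L)⁻¹]
      refine Finset.sum_congr rfl fun i _ => ?_
      rw [Algebra.smul_def, mul_comm]
      rfl
  rw [← (LinearEquiv.ofBijective S hSbij).finrank_eq, Module.finrank_pi_fintype]
  simp

end Semilinear

end TauSheaf

namespace TauSheaf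

universe w

/-! ## Sequences indexed by the integers -/

/-- Recursion in both directions, used to spread a trivialization along the invertible maps `Π_i`.
-/
theorem exists_int_sequence {X : ℤ → Type*} (E : ∀ i, X i ≃ X (i + 1)) (x₀ : X 0) :
    ∃ s : ∀ i, X i, s 0 = x₀ ∧ ∀ i, s (i + 1) = E i (s i) := by
  let p : ∀ n : ℕ, X (Int.ofNat n) := fun n => Nat.rec x₀ (fun n x => E (Int.ofNat n) x) n
  let m : ∀ n : ℕ, X (Int.negSucc n) := fun n =>
    Nat.rec ((E (Int.negSucc 0)).symm x₀) (fun n x => (E (Int.negSucc (n + 1))).symm x) n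
  refine ⟨fun i => match i with
    | Int.ofNat n => p n
    | Int.negSucc n => m n, rfl, fun i => ?_⟩
  match i with
  | Int.ofNat n => rfl
  | Int.negSucc 0 => exact ((E (Int.negSucc 0)).apply_symm_apply x₀).symm
  | Int.negSucc (n + 1) => exact ((E (Int.negSucc (n + 1))).apply_symm_apply (m n)).symm

/-! ### Generic fibres and bounded denominators -/

section Sheaves

variable {Fq Q : Type*} [Field Fq] [Field Q] [Algebra Fq Q] {C : PointedCurve Fq Q}
variable {L : Type*} [Field L] [Algebra Fq L]

theorem tmul_smul_eq (F : LatticeSheaf.{w} C L) (b : L) (a : Q) (x : F.V) :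
    (b ⊗ₜ[Fq] a) • x = b • a • x := by
  rw [smul_Q_def, ← algebraMap_smul (L ⊗[Fq] Q) b, smul_smul,
    Algebra.TensorProduct.algebraMap_apply, Algebra.TensorProduct.tmul_mul_tmul]
  simp

theorem smul_L_def (F : LatticeSheaf.{w} C L) (b : L) (x : F.V) :
    b • x = (b ⊗ₜ[Fq] (1 : Q)) • x := rfl

theorem algebraMap_smul_eq (F : LatticeSheaf.{w} C L) (a : Fq) (x : F.V) :
    algebraMap Fq L a • x = algebraMap Fq Q a • x := by
  rw [smul_L_def, smul_Q_def, Algebra.algebraMap_eq_smul_one, Algebra.algebraMap_eq_smul_one,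
    TensorProduct.smul_tmul]

theorem finite_Q_of_finite [Module.Finite Fq L] (F : LatticeSheaf.{w} C L)
    [Module.Finite (L ⊗[Fq] Q) F.V] : Module.Finite Q F.V := by
  obtain ⟨n, s, hs⟩ := Module.Finite.exists_fin (R := L ⊗[Fq] Q) (M := F.V)
  let b := Module.finBasis Fq L
  refine ⟨Submodule.fg_def.2 ⟨Set.range fun ij : _ × Fin n => b ij.1 • s ij.2,
    Set.finite_range _, eq_top_iff.2 fun x _ => ?_⟩⟩
  set W := Submodule.span Q (Set.range fun ij : _ × Fin n => b ij.1 • s ij.2)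
  have hx : x ∈ Submodule.span (L ⊗[Fq] Q) (Set.range s) := by rw [hs]; trivial
  have hLs : ∀ (c : L) i, c • s i ∈ W := by
    intro c i
    rw [← b.sum_repr c, Finset.sum_smul]
    refine Submodule.sum_mem _ fun j _ => ?_
    rw [Algebra.smul_def, mul_smul, algebraMap_smul_eq]
    exact W.smul_mem _ (Submodule.subset_span ⟨(j, i), rfl⟩)
  obtain ⟨c, rfl⟩ := (Submodule.mem_span_range_iff_exists_fun _).1 hx
  refine Submodule.sum_mem _ fun i _ => ?_
  induction c i using TensorProduct.induction_on with
  | zero => rw [zero_smul]; exact W.zero_mem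
  | add y z hy hz => rw [add_smul]; exact W.add_mem hy hz
  | tmul l a => rw [tmul_smul_eq, smul_comm]; exact W.smul_mem _ (hLs l i)

/-- A `Q_L`-linear map as a `Q`-linear map. -/
def toQLin {F F' : LatticeSheaf.{w} C L} (f : F.V →ₗ[L ⊗[Fq] Q] F'.V) : F.V →ₗ[Q] F'.V where
  toFun := f
  map_add' := map_add f
  map_smul' _ x := map_smul f _ x

/-- The fibres are free of equal rank over `Q_L`, hence isomorphic and of the same finite dimension
over `Q`, where injectivity suffices. -/
theorem bijective_of_injective_of_isLocallyFree [Module.Finite Fq L] {F F' : LatticeSheaf.{w} C L}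
    {r : ℕ} (hF : F.IsLocallyFree r) (hF' : F'.IsLocallyFree r) (f : F.V →ₗ[Q] F'.V)
    (hf : Function.Injective f) : Function.Bijective f := by
  have := hF.free
  have := hF.finite
  have := hF'.free
  have := hF'.finite
  have := finite_Q_of_finite F
  let ε : F'.V ≃ₗ[L ⊗[Fq] Q] F.V := LinearEquiv.ofFinrankEq _ _ (hF'.rank.trans hF.rank.symm)
  let g : F.V →ₗ[Q] F.V := toQLin ε.toLinearMap ∘ₗ f
  have hg : Function.Surjective g :=
    LinearMap.injective_iff_surjective.1 (ε.injective.comp hf)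
  refine ⟨hf, fun y => ?_⟩
  obtain ⟨x, hx⟩ := hg (ε y)
  exact ⟨x, ε.injective hx⟩

/-- Every element becomes a section after multiplication with an element of a suitable
multiplicative set. -/
theorem exists_smul_mem {F' : LatticeSheaf.{w} C L} {R : Subalgebra Fq Q} (S : Submonoid Q)
    (hSR : ∀ s ∈ S, s ∈ R) (hS : ∀ a : Q, ∃ s ∈ S, s * a ∈ R) (N' : Submodule (ext L R) F'.V)
    (hN' : Submodule.span (L ⊗[Fq] Q) (N' : Set F'.V) = ⊤) (y : F'.V) :
    ∃ s ∈ S, s • y ∈ N' := by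
  have hR : ∀ s ∈ R, ∀ z ∈ N', s • z ∈ N' := fun s hs z hz =>
    N'.smul_mem (toExt L R ⟨s, hs⟩) hz
  have hy : y ∈ Submodule.span (L ⊗[Fq] Q) (N' : Set F'.V) := by rw [hN']; trivial
  induction hy using Submodule.span_induction with
  | mem z hz => exact ⟨1, S.one_mem, by rwa [one_smul]⟩
  | zero => exact ⟨1, S.one_mem, by rw [smul_zero]; exact N'.zero_mem⟩
  | add y z _ _ hy hz =>
    obtain ⟨s, hs, hy⟩ := hy
    obtain ⟨t, ht, hz⟩ := hz
    refine ⟨s * t, S.mul_mem hs ht, ?_⟩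
    rw [smul_add]
    refine N'.add_mem ?_ ?_
    · rw [mul_comm, mul_smul]; exact hR t (hSR t ht) _ hy
    · rw [mul_smul]; exact hR s (hSR s hs) _ hz
  | smul c y _ hy =>
    obtain ⟨s, hs, hy⟩ := hy
    induction c using TensorProduct.induction_on with
    | zero => exact ⟨1, S.one_mem, by rw [zero_smul, smul_zero]; exact N'.zero_mem⟩
    | add c d hc hd =>
      obtain ⟨t, ht, hc⟩ := hc
      obtain ⟨u, hu, hd⟩ := hd
      refine ⟨t * u, S.mul_mem ht hu, ?_⟩
      rw [add_smul, smul_add]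
      refine N'.add_mem ?_ ?_
      · rw [mul_comm, mul_smul]; exact hR u (hSR u hu) _ hc
      · rw [mul_smul]; exact hR t (hSR t ht) _ hd
    | tmul l a =>
      obtain ⟨t, ht, hta⟩ := hS a
      refine ⟨t * s, S.mul_mem ht hs, ?_⟩
      have h1 : (t * s) • ((l ⊗ₜ[Fq] a) • y) = (l ⊗ₜ[Fq] (t * a)) • (s • y) := by
        rw [smul_Q_def, smul_Q_def, smul_smul, smul_smul, Algebra.TensorProduct.tmul_mul_tmul,
          Algebra.TensorProduct.tmul_mul_tmul, one_mul, mul_one, mul_right_comm]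
      rw [h1]
      exact N'.smul_mem (⟨l ⊗ₜ[Fq] (t * a), ⟨l ⊗ₜ[Fq] (⟨t * a, hta⟩ : R), by simp⟩⟩ : ext L R) hy

/-- Maps between generic fibres map sections to sections up to a bounded denominator. -/
theorem exists_forall_smul_mem {F F' : LatticeSheaf.{w} C L} {R : Subalgebra Fq Q} (S : Submonoid Q)
    (hSR : ∀ s ∈ S, s ∈ R) (hS : ∀ a : Q, ∃ s ∈ S, s * a ∈ R) (N : Submodule (ext L R) F.V)
    (N' : Submodule (ext L R) F'.V) (hN : N.FG)
    (hN' : Submodule.span (L ⊗[Fq] Q) (N' : Set F'.V) = ⊤)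
    (f : F.V →ₗ[L ⊗[Fq] Q] F'.V) : ∃ s ∈ S, ∀ x ∈ N, s • f x ∈ N' := by
  have hR : ∀ s ∈ R, ∀ z ∈ N', s • z ∈ N' := fun s hs z hz =>
    N'.smul_mem (toExt L R ⟨s, hs⟩) hz
  induction N, hN using Submodule.fg_induction with
  | singleton x =>
    obtain ⟨s, hs, hx⟩ := exists_smul_mem S hSR hS N' hN' (f x)
    refine ⟨s, hs, fun z hz => ?_⟩
    obtain ⟨c, rfl⟩ := Submodule.mem_span_singleton.1 hz
    have h1 : s • f (c • x) = c • (s • f x) := by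
      change s • f ((c : L ⊗[Fq] Q) • x) = (c : L ⊗[Fq] Q) • (s • f x)
      rw [map_smul]
      exact (smul_comm (c : L ⊗[Fq] Q) s (f x)).symm
    rw [h1]
    exact N'.smul_mem c hx
  | sup N₁ N₂ _ _ h₁ h₂ =>
    obtain ⟨s, hs, h₁⟩ := h₁
    obtain ⟨t, ht, h₂⟩ := h₂
    refine ⟨s * t, S.mul_mem hs ht, fun x hx => ?_⟩
    obtain ⟨y, hy, z, hz, rfl⟩ := Submodule.mem_sup.1 hx
    rw [map_add, smul_add]
    refine N'.add_mem ?_ ?_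
    · rw [mul_comm, mul_smul]; exact hR t (hSR t ht) _ (h₁ y hy)
    · rw [mul_smul]; exact hR s (hSR s hs) _ (h₂ z hz)

theorem exists_mul_mem_A (C : PointedCurve Fq Q) (a : Q) :
    ∃ b : C.A, b ≠ 0 ∧ (b : Q) * a ∈ C.A := (exists_pole C a).1

theorem exists_pow_mul_mem_O (C : PointedCurve Fq Q) {ϖ : C.O} (hϖ : Irreducible ϖ) (a : Q) :
    ∃ n : ℕ, (ϖ : Q) ^ n * a ∈ C.O := by
  obtain ⟨n, hn⟩ := (exists_pole C a).2
  refine ⟨n, ?_⟩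
  have := hn (ϖ ^ n) (Ideal.pow_mem_pow ((IsLocalRing.mem_maximalIdeal _).2 hϖ.not_isUnit) n)
  simpa using this

theorem exists_smul_mem_aff {r r' : ℕ} {F F' : LatticeSheaf.{w} C L} (hF : F.IsLocallyFree r)
    (hF' : F'.IsLocallyFree r') (f : F.V →ₗ[L ⊗[Fq] Q] F'.V) :
    ∃ a : C.A, a ≠ 0 ∧ ∀ x ∈ F.aff, (a : Q) • f x ∈ F'.aff := by
  let S : Submonoid Q :=
    { carrier := {s | s ∈ C.A ∧ s ≠ 0}
      mul_mem' := fun h h' => ⟨C.A.mul_mem h.1 h'.1, mul_ne_zero h.2 h'.2⟩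
      one_mem' := ⟨C.A.one_mem, one_ne_zero⟩ }
  obtain ⟨s, hs, h⟩ := exists_forall_smul_mem S (fun s hs => hs.1) (fun a => by
    obtain ⟨b, hb, hba⟩ := exists_mul_mem_A C a
    exact ⟨b, ⟨b.2, by simpa using hb⟩, hba⟩) F.aff F'.aff
    (Module.Finite.iff_fg.1 hF.finite_aff) hF'.span_aff f
  exact ⟨⟨s, hs.1⟩, fun h0 => hs.2 (congrArg Subtype.val h0), h⟩

theorem exists_smul_mem_inf {r r' : ℕ} {F F' : LatticeSheaf.{w} C L} (hF : F.IsLocallyFree r)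
    (hF' : F'.IsLocallyFree r') {ϖ : C.O} (hϖ : Irreducible ϖ) (f : F.V →ₗ[L ⊗[Fq] Q] F'.V) :
    ∃ n : ℕ, ∀ x ∈ F.inf, (ϖ : Q) ^ n • f x ∈ F'.inf := by
  obtain ⟨s, ⟨n, rfl⟩, h⟩ := exists_forall_smul_mem (Submonoid.powers (ϖ : Q))
    (by rintro _ ⟨n, rfl⟩; exact C.O.pow_mem ϖ.2 n) (fun a => by
    obtain ⟨n, hn⟩ := exists_pow_mul_mem_O C hϖ a
    exact ⟨_, ⟨n, rfl⟩, hn⟩) F.inf F'.inf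
    (Module.Finite.iff_fg.1 hF.finite_inf) hF'.span_inf f
  exact ⟨n, h⟩

theorem mem_idealInf_pow_smul {F : LatticeSheaf.{w} C L} {ϖ : C.O} (hϖ : Irreducible ϖ) (k : ℕ)
    (x : F.V) : x ∈ (C.idealInf L) ^ k • F.inf ↔ ∃ y ∈ F.inf, (ϖ : Q) ^ k • y = x := by
  have h : C.idealInf L = Ideal.span {toExt L C.O ϖ} := by
    rw [PointedCurve.idealInf, hϖ.maximalIdeal_eq, Ideal.map_span, Set.image_singleton]
  rw [h, Ideal.span_singleton_pow, Submodule.ideal_span_singleton_smul,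
    Submodule.mem_smul_pointwise_iff_exists]
  have h2 : ∀ y : F.V, (toExt L C.O ϖ ^ k) • y = (ϖ : Q) ^ k • y := fun y => by
    rw [← map_pow]
    change ((1 : L) ⊗ₜ[Fq] ((ϖ ^ k : C.O) : Q)) • y = _
    rw [smul_Q_def]
    simp
  simp_rw [h2]

end Sheaves

end TauSheaf

namespace TauSheaf

universe w

instance {Fq Q : Type*} [Field Fq] [Field Q] [Algebra Fq Q] {C : PointedCurve Fq Q} {L : Type*}
    [Field L] [Algebra Fq L] (F : LatticeSheaf.{w} C L) : SMulCommClass Q L F.V :=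
  SMulCommClass.symm _ _ _

/-! ### Quasi-morphisms on the generic fibre -/

namespace AbelianTauSheaf

variable {Fq Q : Type*} [Field Fq] [Fintype Fq] [Field Q] [Algebra Fq Q] {C : PointedCurve Fq Q}
variable {L : Type*} [Field L] [Algebra Fq L] [Finite L] {c : Characteristic C L}

theorem finite_Q (F : AbelianTauSheaf.{w} C c) (i : ℤ) : Module.Finite Q (F.F i).V := by
  have := (F.isLocallyFree i).finite
  have : Module.Finite Fq L := Module.Finite.of_finite
  exact finite_Q_of_finite _

theorem bijective_Pi (F : AbelianTauSheaf.{w} C c) (i : ℤ) : Function.Bijective (F.Pi i) := by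
  have : Module.Finite Fq L := Module.Finite.of_finite
  exact bijective_of_injective_of_isLocallyFree (F.isLocallyFree i) (F.isLocallyFree (i + 1))
    (toQLin (F.Pi i)) (F.injective_Pi i)

/-- `τ_i` as a `Q`-linear map. -/
noncomputable def tauQ (F : AbelianTauSheaf.{w} C c) (i : ℤ) : (F.F i).V →ₗ[Q] (F.F (i + 1)).V where
  toFun := F.tau i
  map_add' := map_add (F.tau i)
  map_smul' a x := by
    rw [smul_Q_def, LinearMap.map_smulₛₗ, sigma_tmul, map_one]
    rfl

theorem tau_smul_L (F : AbelianTauSheaf.{w} C c) (i : ℤ) (b : L) (x : (F.F i).V) :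
    F.tau i (b • x) = b ^ Fintype.card Fq • F.tau i x := by
  rw [smul_L_def, LinearMap.map_smulₛₗ, sigma_tmul]
  rfl

/-- The trivializations `V_i ≃ V_0` given by the `Π_i`. -/
theorem exists_trivialization (F : AbelianTauSheaf.{w} C c) :
    ∃ e : ∀ i, (F.F i).V ≃ₗ[L ⊗[Fq] Q] (F.F 0).V, e 0 = LinearEquiv.refl _ _ ∧
      ∀ i x, e (i + 1) (F.Pi i x) = e i x := by
  obtain ⟨e, he0, he⟩ := exists_int_sequence (X := fun i => (F.F i).V ≃ₗ[L ⊗[Fq] Q] (F.F 0).V)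
    (fun i =>
      { toFun := fun e => (LinearEquiv.ofBijective (F.Pi i) (F.bijective_Pi i)).symm.trans e
        invFun := fun e => (LinearEquiv.ofBijective (F.Pi i) (F.bijective_Pi i)).trans e
        left_inv := fun e => by ext x; simp
        right_inv := fun e => by ext x; simp }) (LinearEquiv.refl _ _)
  refine ⟨e, he0, fun i x => ?_⟩
  rw [he]
  change e i ((LinearEquiv.ofBijective (F.Pi i) (F.bijective_Pi i)).symm
    ((LinearEquiv.ofBijective (F.Pi i) (F.bijective_Pi i)) x)) = _
  rw [LinearEquiv.symm_apply_apply]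

/-- The map `φ = Π_0⁻¹ ∘ τ_0` on the generic fibre. -/
noncomputable def phi (F : AbelianTauSheaf.{w} C c) : Module.End Q (F.F 0).V :=
  toQLin (LinearEquiv.ofBijective (F.Pi 0) (F.bijective_Pi 0)).symm.toLinearMap ∘ₗ F.tauQ 0

theorem Pi_phi (F : AbelianTauSheaf.{w} C c) (x : (F.F 0).V) : F.Pi 0 (F.phi x) = F.tau 0 x :=
  (LinearEquiv.ofBijective (F.Pi 0) (F.bijective_Pi 0)).apply_symm_apply _

theorem phi_smul_L (F : AbelianTauSheaf.{w} C c) (b : L) (x : (F.F 0).V) :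
    F.phi (b • x) = b ^ Fintype.card Fq • F.phi x := by
  apply F.injective_Pi 0
  rw [Pi_phi, tau_smul_L, ← Pi_phi]
  exact (map_smul (F.Pi 0) ((b ^ Fintype.card Fq) ⊗ₜ[Fq] (1 : Q)) (F.phi x)).symm

theorem phi_bijective (F : AbelianTauSheaf.{w} C c) : Function.Bijective F.phi := by
  have := F.finite_Q 0
  have h : Function.Injective F.phi := fun x y h =>
    F.injective_tau 0 (by rw [← Pi_phi, h, Pi_phi])
  exact ⟨h, LinearMap.injective_iff_surjective.1 h⟩

section Trivialization

variable (F : AbelianTauSheaf.{w} C c) (e : ∀ i, (F.F i).V ≃ₗ[L ⊗[Fq] Q] (F.F 0).V)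
  (he0 : e 0 = LinearEquiv.refl _ _) (he : ∀ i x, e (i + 1) (F.Pi i x) = e i x)

include he0 he in
-- The compatibility of `τ` with `Π` makes the claim at `i` equivalent to the claim at `i + 1`, and
-- at `0` it is the definition of `phi`.
theorem trivialization_tau (i : ℤ) (x : (F.F i).V) : e (i + 1) (F.tau i x) = F.phi (e i x) := by
  let P : ℤ → Prop := fun i => ∀ x : (F.F i).V, e (i + 1) (F.tau i x) = F.phi (e i x)
  have hstep : ∀ i, P i ↔ P (i + 1) := by
    intro i
    change (∀ x : (F.F i).V, e (i + 1) (F.tau i x) = F.phi (e i x)) ↔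
      (∀ x : (F.F (i + 1)).V, e (i + 1 + 1) (F.tau (i + 1) x) = F.phi (e (i + 1) x))
    rw [(F.bijective_Pi i).2.forall]
    simp_rw [he, ← F.comm, he]
  have h : ∀ i, P i := by
    clear x i
    intro i
    induction i using Int.induction_on with
    | zero =>
      intro x
      rw [← Pi_phi, he, he0]
      rfl
    | succ i ih => exact (hstep _).1 ih
    | pred i ih => exact (hstep _).2 (by rwa [sub_add_cancel])
  exact h i x

include he in
theorem trivialization_iterPi (i : ℤ) (n : ℕ) (x : (F.F i).V) :
    e (i + n) (iterPi F.F F.Pi i n x) = e i x := by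
  have hcast : ∀ {i j : ℤ} (h : i = j) (x : (F.F i).V), e j (castLin F.F h x) = e i x := by
    intro i j h x
    subst h
    rfl
  induction n with
  | zero => exact hcast _ x
  | succ n ih =>
    change e _ (castLin F.F _ (F.Pi (i + n) (iterPi F.F F.Pi i n x))) = _
    rw [hcast, he, ih]

include he0 he in
-- Away from `∞` each `Π_i` is an isomorphism, so all affine lattices coincide once transported to
-- `V_0`.
theorem mem_aff_iff (i : ℤ) (x : (F.F i).V) : x ∈ (F.F i).aff ↔ e i x ∈ (F.F 0).aff := by
  have hPi : ∀ i (x : (F.F i).V), F.Pi i x ∈ (F.F (i + 1)).aff ↔ x ∈ (F.F i).aff := by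
    intro i x
    refine ⟨fun h => ?_, fun h => (F.mapsSections_Pi i).1 h⟩
    obtain ⟨y, hy, hyx⟩ := F.surjOn_Pi i h
    rwa [← F.injective_Pi i hyx]
  let P : ℤ → Prop := fun i => ∀ x : (F.F i).V, x ∈ (F.F i).aff ↔ e i x ∈ (F.F 0).aff
  have hstep : ∀ i, P i ↔ P (i + 1) := by
    intro i
    change (∀ x : (F.F i).V, x ∈ (F.F i).aff ↔ e i x ∈ (F.F 0).aff) ↔
      (∀ x : (F.F (i + 1)).V, x ∈ (F.F (i + 1)).aff ↔ e (i + 1) x ∈ (F.F 0).aff)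
    rw [(F.bijective_Pi i).2.forall]
    simp_rw [hPi, he]
  have h : ∀ i, P i := by
    clear x i
    intro i
    induction i using Int.induction_on with
    | zero => intro x; rw [he0]; rfl
    | succ i ih => exact (hstep _).1 ih
    | pred i ih => exact (hstep _).2 (by rwa [sub_add_cancel])
  exact h i x

/-- The lattice of germs at infinity, transported to `V_0`. -/
def infSet (i : ℤ) : Set (F.F 0).V := {x | (e i).symm x ∈ (F.F i).inf}

include he in
-- In the trivialization the composite of the `Π`'s is the identity, so periodicity says that the
-- lattice at `i + l` is `ϖ^{-k}` times the one at `i`.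
theorem mem_infSet_add {ϖ : C.O} (hϖ : Irreducible ϖ) {k l : ℕ}
    (hper : ∀ i : ℤ, (F.F i).inf.map ((iterPi F.F F.Pi i l).restrictScalars (C.OL L)) =
      (C.idealInf L) ^ k • (F.F (i + l)).inf) (i : ℤ) (x : (F.F 0).V) :
    x ∈ F.infSet e (i + l) ↔ (ϖ : Q) ^ k • x ∈ F.infSet e i := by
  have hϖ0 : (ϖ : Q) ^ k ≠ 0 := pow_ne_zero _ (by simpa using hϖ.ne_zero)
  have hsmul : ∀ j (a : Q) y, (e j).symm (a • y) = a • (e j).symm y := fun j a y =>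
    map_smul (e j).symm _ y
  have hsmul' : ∀ j (a : Q) y, e j (a • y) = a • e j y := fun j a y => map_smul (e j) _ y
  constructor
  · intro hx
    have h1 : (ϖ : Q) ^ k • (e (i + l)).symm x ∈ (C.idealInf L) ^ k • (F.F (i + l)).inf :=
      (mem_idealInf_pow_smul hϖ k _).2 ⟨_, hx, rfl⟩
    rw [← hper] at h1
    obtain ⟨z, hz, hzx⟩ := h1
    have h2 : e i z = (ϖ : Q) ^ k • x := by
      rw [← F.trivialization_iterPi e he i l z]
      have := congrArg (e (i + l)) hzx
      rw [hsmul', LinearEquiv.apply_symm_apply] at this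
      exact this
    change (e i).symm ((ϖ : Q) ^ k • x) ∈ (F.F i).inf
    rwa [← h2, LinearEquiv.symm_apply_apply]
  · intro hx
    have h1 := Submodule.mem_map_of_mem (f := (iterPi F.F F.Pi i l).restrictScalars (C.OL L)) hx
    rw [hper, mem_idealInf_pow_smul hϖ] at h1
    obtain ⟨y, hy, hyx⟩ := h1
    have h2 := congrArg (e (i + l)) hyx
    rw [hsmul', LinearMap.restrictScalars_apply, F.trivialization_iterPi e he,
      LinearEquiv.apply_symm_apply] at h2
    have h3 := smul_right_injective _ hϖ0 h2
    change (e (i + l)).symm x ∈ (F.F (i + l)).inf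
    rwa [← h3, LinearEquiv.symm_apply_apply]

include he in
theorem mem_infSet_add_mul {ϖ : C.O} (hϖ : Irreducible ϖ) {k l : ℕ}
    (hper : ∀ i : ℤ, (F.F i).inf.map ((iterPi F.F F.Pi i l).restrictScalars (C.OL L)) =
      (C.idealInf L) ^ k • (F.F (i + l)).inf) (i : ℤ) (m : ℕ) (x : (F.F 0).V) :
    x ∈ F.infSet e (i + m * l) ↔ (ϖ : Q) ^ (m * k) • x ∈ F.infSet e i := by
  induction m generalizing x with
  | zero => simp
  | succ m ih =>
    have h : i + ((m + 1 : ℕ) : ℤ) * l = i + m * l + l := by push_cast; ring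
    rw [h, F.mem_infSet_add e he hϖ hper, ih, smul_smul, ← pow_add, Nat.succ_mul]

end Trivialization

theorem subsingleton_of_rank_eq_zero (F : AbelianTauSheaf.{w} C c) (hr : F.r = 0) (i : ℤ) :
    Subsingleton (F.F i).V := by
  have h := F.isLocallyFree i
  have := h.free
  have := h.finite
  exact (Module.finrank_eq_zero_iff_of_free (L ⊗[Fq] Q) _).1 (h.rank.trans hr)

/-- A map of generic fibres has poles of bounded order along `∞`. -/
theorem exists_forall_infSet (F F' : AbelianTauSheaf.{w} C c) (hweight : F.weight = F'.weight)
    (e : ∀ i, (F.F i).V ≃ₗ[L ⊗[Fq] Q] (F.F 0).V) (he : ∀ i x, e (i + 1) (F.Pi i x) = e i x)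
    (e' : ∀ i, (F'.F i).V ≃ₗ[L ⊗[Fq] Q] (F'.F 0).V)
    (he' : ∀ i x, e' (i + 1) (F'.Pi i x) = e' i x)
    {ϖ : C.O} (hϖ : Irreducible ϖ) (g : (F.F 0).V →ₗ[L ⊗[Fq] Q] (F'.F 0).V) :
    ∃ n : ℕ, ∀ i, ∀ x ∈ F.infSet e i, (ϖ : Q) ^ n • g x ∈ F'.infSet e' i := by
  obtain ⟨k, l, hk, hl, hkl, hper⟩ := F.periodic
  obtain ⟨k', l', hk', hl', hkl', hper'⟩ := F'.periodic
  have hzero : ∀ (G : AbelianTauSheaf.{w} C c) (k l : ℕ), 0 < k → 0 < l → l * G.d = k * G.r →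
      G.weight = if G.r = 0 then 0 else (k : ℚ) / l := by
    intro G k l hk hl h
    rw [weight]
    split_ifs with h0
    · rfl
    · rw [div_eq_div_iff (by exact_mod_cast h0) (by exact_mod_cast hl.ne'), mul_comm]
      exact_mod_cast h
  have hw := hzero F k l hk hl hkl
  have hw' := hzero F' k' l' hk' hl' hkl'
  by_cases hr : F.r = 0
  · have := F.subsingleton_of_rank_eq_zero hr 0
    refine ⟨0, fun i x _ => ?_⟩
    rw [Subsingleton.elim x 0, map_zero, smul_zero]
    change (e' i).symm 0 ∈ (F'.F i).inf
    rw [map_zero]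
    exact Submodule.zero_mem _
  by_cases hr' : F'.r = 0
  -- A sheaf of nonzero rank has positive weight `k / l`, so it cannot share its weight with the
  -- zero sheaf.
  · exfalso
    rw [hw, hw', if_neg hr, if_pos hr'] at hweight
    have : (0 : ℚ) < (k : ℚ) / l := by positivity
    exact this.ne' hweight
  have hK : l' * k = l * k' := by
    rw [hw, hw', if_neg hr, if_neg hr', div_eq_div_iff (by exact_mod_cast hl.ne')
      (by exact_mod_cast hl'.ne')] at hweight
    have : k * l' = k' * l := by exact_mod_cast hweight
    linarith
  -- Equal weights give `l' k = l k'`. Hence over the common period `p` both chains of lattices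
  -- scale by the same power `ϖ^K`, and a pole bound at `i` is equivalent to the same bound at `i +
  -- p`.
  set p : ℤ := l' * l with hp
  set K := l' * k
  have hB : ∀ i x, x ∈ F.infSet e (i + p) ↔ (ϖ : Q) ^ K • x ∈ F.infSet e i := fun i x =>
    F.mem_infSet_add_mul e he hϖ (fun i => (hper i).2) i l' x
  have hB' : ∀ i x, x ∈ F'.infSet e' (i + p) ↔ (ϖ : Q) ^ K • x ∈ F'.infSet e' i := fun i x => by
    rw [hp, mul_comm (l' : ℤ), hK]
    exact F'.mem_infSet_add_mul e' he' hϖ (fun i => (hper' i).2) i l x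
  have hϖ0 : (ϖ : Q) ≠ 0 := by simpa using hϖ.ne_zero
  have hg : ∀ (a : Q) x, g (a • x) = a • g x := fun a x => map_smul g _ x
  have hstep : ∀ (n : ℕ) (i : ℤ), (∀ x ∈ F.infSet e i, (ϖ : Q) ^ n • g x ∈ F'.infSet e' i) ↔
      (∀ x ∈ F.infSet e (i + p), (ϖ : Q) ^ n • g x ∈ F'.infSet e' (i + p)) := by
    intro n i
    constructor
    · intro h x hx
      rw [hB', smul_comm, ← hg]
      exact h _ ((hB i x).1 hx)
    · intro h x hx
      have h1 := h (((ϖ : Q) ^ K)⁻¹ • x) (by rwa [hB, smul_inv_smul₀ (pow_ne_zero _ hϖ0)])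
      rwa [hB', hg, smul_comm, smul_inv_smul₀ (pow_ne_zero _ hϖ0)] at h1
  have hloc : ∀ i, ∃ n : ℕ, ∀ x ∈ F.infSet e i, (ϖ : Q) ^ n • g x ∈ F'.infSet e' i := by
    intro i
    obtain ⟨n, hn⟩ := exists_smul_mem_inf (F.isLocallyFree i) (F'.isLocallyFree i) hϖ
      ((e' i).symm.toLinearMap ∘ₗ g ∘ₗ (e i).toLinearMap)
    refine ⟨n, fun x hx => ?_⟩
    have h1 := hn _ hx
    change (e' i).symm ((ϖ : Q) ^ n • g x) ∈ (F'.F i).inf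
    have h2 : (e' i).symm ((ϖ : Q) ^ n • g x) = (ϖ : Q) ^ n • (e' i).symm (g x) :=
      map_smul (e' i).symm _ _
    rw [h2]
    simpa using h1
  choose N hN using hloc
  have hmono : ∀ i (m n : ℕ), m ≤ n → (∀ x ∈ F.infSet e i, (ϖ : Q) ^ m • g x ∈ F'.infSet e' i) →
      ∀ x ∈ F.infSet e i, (ϖ : Q) ^ n • g x ∈ F'.infSet e' i := by
    intro i m n hmn h x hx
    obtain ⟨t, rfl⟩ := Nat.exists_eq_add_of_le' hmn
    rw [pow_add, mul_smul]
    change (e' i).symm ((ϖ : Q) ^ t • (ϖ : Q) ^ m • g x) ∈ (F'.F i).inf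
    have h2 : (e' i).symm ((ϖ : Q) ^ t • (ϖ : Q) ^ m • g x) =
        (ϖ : Q) ^ t • (e' i).symm ((ϖ : Q) ^ m • g x) := map_smul (e' i).symm _ _
    rw [h2]
    have h3 := (F'.F i).inf.smul_mem (toExt L C.O (ϖ ^ t)) (h x hx)
    have h4 : ∀ y : (F'.F i).V, toExt L C.O (ϖ ^ t) • y = (ϖ : Q) ^ t • y := fun y => by
      change ((1 : L) ⊗ₜ[Fq] ((ϖ ^ t : C.O) : Q)) • y = _
      rw [smul_Q_def]
      simp
    rwa [h4] at h3
  have hp0 : 0 < p := by positivity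
  -- The largest pole order over one period.
  refine ⟨(Finset.range p.toNat).sup fun j => N j, fun i => ?_⟩
  have hbase : ∀ j : ℤ, 0 ≤ j → j < p → ∀ x ∈ F.infSet e j,
      (ϖ : Q) ^ ((Finset.range p.toNat).sup fun j => N j) • g x ∈ F'.infSet e' j := by
    intro j hj hjp
    refine hmono j (N j) _ ?_ (hN j)
    lift j to ℕ using hj
    exact Finset.le_sup (f := fun j : ℕ => N j) (Finset.mem_range.2 (by omega))
  have hall : ∀ (t : ℤ) (j : ℤ), 0 ≤ j → j < p → ∀ x ∈ F.infSet e (j + t * p),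
      (ϖ : Q) ^ ((Finset.range p.toNat).sup fun j => N j) • g x ∈ F'.infSet e' (j + t * p) := by
    intro t j hj hjp
    induction t using Int.induction_on with
    | zero => simpa using hbase j hj hjp
    | succ t ih =>
      have := (hstep _ _).1 ih
      rwa [add_assoc, ← add_one_mul] at this
    | pred t ih =>
      refine (hstep _ _).2 ?_
      rwa [add_assoc, ← add_one_mul, sub_add_cancel]
  have := hall (i / p) (i % p) (Int.emod_nonneg _ hp0.ne') (Int.emod_lt_of_pos _ hp0)
  rwa [mul_comm, Int.emod_add_mul_ediv] at this

/-- Quasi-morphisms are determined by the map on generic fibres. -/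
theorem rank_QHom (F F' : AbelianTauSheaf.{w} C c) (hweight : F.weight = F'.weight) :
    Module.rank Q (QHom F F') =
      (Module.finrank Q (linearIntertwiners L F.phi F'.phi) : ℕ) := by
  obtain ⟨e, he0, he⟩ := F.exists_trivialization
  obtain ⟨e', he0', he'⟩ := F'.exists_trivialization
  have := F.finite_Q 0
  have := F'.finite_Q 0
  obtain ⟨ϖ, hϖ⟩ := IsDiscreteValuationRing.exists_irreducible C.O
  -- Restriction to the index `0`.
  let T : QHom F F' →ₗ[Q] linearIntertwiners L F.phi F'.phi :=
    { toFun := fun f => ⟨toQLin (f.1 0), by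
        obtain ⟨D, -, h1, h2⟩ := f.2
        refine ⟨mem_intertwiners.2 fun x => F'.injective_Pi 0 ?_, fun b x =>
          map_smul (f.1 0) (b ⊗ₜ[Fq] (1 : Q)) x⟩
        rw [Pi_phi]
        change F'.Pi 0 (f.1 0 (F.phi x)) = F'.tau 0 (f.1 0 x)
        rw [← h1, Pi_phi, h2]⟩
      map_add' := fun _ _ => rfl
      map_smul' := fun _ _ => rfl }
  have hT : ∀ f x, (T f).1 x = f.1 0 x := fun f x => rfl
  have hTbij : Function.Bijective T := by
    constructor
    -- Commutation with the invertible `Π_i` propagates the component at `0` to all indices.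
    · have key : ∀ f : QHom F F', ∀ i (x : (F.F i).V), e' i (f.1 i x) = f.1 0 (e i x) := by
        intro f i
        obtain ⟨D, -, h1, h2⟩ := f.2
        let P : ℤ → Prop := fun i => ∀ x : (F.F i).V, e' i (f.1 i x) = f.1 0 (e i x)
        have hstep : ∀ i, P i ↔ P (i + 1) := by
          intro i
          change (∀ x : (F.F i).V, e' i (f.1 i x) = f.1 0 (e i x)) ↔
            ∀ x : (F.F (i + 1)).V, e' (i + 1) (f.1 (i + 1) x) = f.1 0 (e (i + 1) x)
          rw [(F.bijective_Pi i).2.forall]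
          simp_rw [h1, he, he']
        induction i using Int.induction_on with
        | zero => intro x; rw [he0, he0']; rfl
        | succ i ih => exact (hstep _).1 ih
        | pred i ih =>
          have h : P (-i - 1 + 1) := by rwa [sub_add_cancel]
          exact (hstep _).2 h
      intro f g hfg
      refine Subtype.ext (funext fun i => LinearMap.ext fun x => (e' i).injective ?_)
      rw [key, key, ← hT, hfg, hT]
    · intro g
      let gL : (F.F 0).V →ₗ[L ⊗[Fq] Q] (F'.F 0).V :=
        { toFun := g.1
          map_add' := map_add g.1
          map_smul' := fun z x => by
            change g.1 (z • x) = z • g.1 x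
            induction z using TensorProduct.induction_on with
            | zero => rw [zero_smul, zero_smul, map_zero]
            | add y z hy hz => rw [add_smul, add_smul, map_add, hy, hz]
            | tmul b a => rw [tmul_smul_eq, tmul_smul_eq, g.2.2, map_smul] }
      have hgL : ∀ x, gL x = g.1 x := fun x => rfl
      -- The divisor has affine part `(a)`, the same for all `i` because the affine lattices
      -- coincide, and multiplicity `n` at `∞`, uniform in `i` because the weights agree.
      obtain ⟨n, hn⟩ := exists_forall_infSet F F' hweight e he e' he' hϖ gL
      obtain ⟨a, ha0, ha⟩ := exists_smul_mem_aff (F.isLocallyFree 0) (F'.isLocallyFree 0) gL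
      let f : ∀ i, (F.F i).V →ₗ[L ⊗[Fq] Q] (F'.F i).V := fun i =>
        (e' i).symm.toLinearMap ∘ₗ gL ∘ₗ (e i).toLinearMap
      have hf : ∀ i x, e' i (f i x) = gL (e i x) := fun i x => (e' i).apply_symm_apply _
      refine ⟨⟨f, ⟨Ideal.span {a}, fun h => ha0 (Ideal.span_singleton_eq_bot.1 h), n⟩,
        fun i => ⟨fun x hx y hy => ?_, fun x hx y hy => ?_⟩, fun i x => ?_, fun i x => ?_⟩, ?_⟩
      · obtain ⟨b, rfl⟩ := Ideal.mem_span_singleton'.1 hy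
        rw [map_mul, mul_smul]
        refine (F'.F i).aff.smul_mem _ ?_
        rw [F'.mem_aff_iff e' he0' he']
        have h1 : e' i (toExt L C.A a • f i x) = (a : Q) • gL (e i x) := by
          rw [← hf]
          exact map_smul (e' i) _ _
        rw [h1]
        exact ha _ ((F.mem_aff_iff e he0 he i x).1 hx)
      · have hy' : y ∈ IsLocalRing.maximalIdeal C.O ^ n := hy
        rw [hϖ.maximalIdeal_eq, Ideal.span_singleton_pow] at hy'
        obtain ⟨b, rfl⟩ := Ideal.mem_span_singleton'.1 hy'
        rw [map_mul, mul_smul]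
        refine (F'.F i).inf.smul_mem _ ?_
        have h1 := hn i (e i x) (by
          change (e i).symm (e i x) ∈ (F.F i).inf
          rwa [LinearEquiv.symm_apply_apply])
        have h2 : toExt L C.O (ϖ ^ n) • f i x = (e' i).symm ((ϖ : Q) ^ n • gL (e i x)) := by
          rw [LinearEquiv.eq_symm_apply, ← hf]
          change e' i (((1 : L) ⊗ₜ[Fq] ((ϖ ^ n : C.O) : Q)) • f i x) = _
          rw [map_smul, smul_Q_def]
          simp
        rw [h2]
        exact h1
      · apply (e' (i + 1)).injective
        rw [hf, he, he', hf]
      · apply (e' (i + 1)).injective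
        rw [hf, F.trivialization_tau e he0 he, F'.trivialization_tau e' he0' he', hf]
        exact mem_intertwiners.1 g.2.1 _
      · refine Subtype.ext (LinearMap.ext fun x => ?_)
        rw [hT]
        change (e' 0).symm (gL (e 0 x)) = _
        rw [he0, he0']
        rfl
  rw [(LinearEquiv.ofBijective T hTbij).rank_eq, Module.finrank_eq_rank]

end AbelianTauSheaf

end TauSheaf

namespace TauSheaf

/-! ### Equivariant comparison and lifting of fixed points -/

section FixedPoints

variable {R k P : Type*} [CommRing R] [Field k] [AddCommGroup P] [Module R P] [Module k P]
  [SMulCommClass R k P]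

/-- A version of `nonempty_equiv_fixed` with an additional endomorphism `π`. -/
theorem exists_equiv_fixed_commute (F L : Type*) [Field F] [Fintype F] [Field L] [Fintype L]
    [Algebra F k] [Algebra L k] {e : ℕ} (he : 0 < e) (hcard : Fintype.card L = Fintype.card F ^ e)
    (hk : HasSubfields (Fintype.card F) k) (φ ψ π : P →ₗ[R] P)
    (hφ : ∀ (c : k) y, φ (c • y) = c ^ Fintype.card F • φ y)
    (hψ : ∀ (c : k) y, ψ (c • y) = c ^ Fintype.card L • ψ y)
    (hπ : ∀ (c : k) y, π (c • y) = c • π y)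
    (hφπ : ∀ y, φ (π y) = π (φ y)) (hψπ : ∀ y, ψ (π y) = π (ψ y))
    (hφp : ∀ y, ∃ N, 0 < N ∧ φ^[N] y = y) (hψp : ∀ y, ∃ N, 0 < N ∧ ψ^[N] y = y)
    [Finite (LinearMap.eqLocus ψ LinearMap.id)] :
    ∃ f : LinearMap.eqLocus ψ LinearMap.id ≃ₗ[R] (Fin e → LinearMap.eqLocus φ LinearMap.id),
      ∀ x y : LinearMap.eqLocus ψ LinearMap.id, (y : P) = π x → ∀ i, (f y i : P) = π (f x i) := by
  -- With `X` acting as `π` the space is a module over `R[X]`, and the non-equivariant comparison,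
  -- applied over `R[X]`, yields compatibility with `π`.
  let m : Module (Polynomial R) P := Module.compHom P (Polynomial.aeval π : Polynomial R →ₐ[R] Module.End R P).toRingHom
  have hsmul : ∀ (p : Polynomial R) y, p • y = Polynomial.aeval π p y := fun _ _ => rfl
  have hC : ∀ (a : R) (y : P), (Polynomial.C a : Polynomial R) • y = a • y := fun a y => by
    rw [hsmul, Polynomial.aeval_C]; rfl
  have hX : ∀ y : P, (Polynomial.X : Polynomial R) • y = π y := fun y => by
    rw [hsmul, Polynomial.aeval_X]
  have hcomm : ∀ (f : P → P) (hadd : ∀ x y, f (x + y) = f x + f y)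
      (hsm : ∀ (a : R) x, f (a • x) = a • f x) (hfπ : ∀ y, f (π y) = π (f y))
      (p : Polynomial R) (y : P), f (p • y) = p • f y := by
    intro f hadd hsm hfπ p
    induction p using Polynomial.induction_on with
    | C a => intro y; rw [hC, hC, hsm]
    | add p p' hp hp' => intro y; rw [add_smul, add_smul, hadd, hp, hp']
    | monomial n a ih => intro y; rw [pow_succ, ← mul_assoc, mul_smul, ih, hX, hfπ, ← hX, ← mul_smul]
  have : SMulCommClass (Polynomial R) k P := ⟨fun p c y =>
    (hcomm (fun y => c • y) (smul_add c) (fun a x => (smul_comm a c x).symm) (fun y => (hπ c y).symm) p y).symm⟩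
  let φ' : P →ₗ[Polynomial R] P :=
    { toFun := φ, map_add' := map_add φ, map_smul' := hcomm φ (map_add φ) (map_smul φ) hφπ }
  let ψ' : P →ₗ[Polynomial R] P :=
    { toFun := ψ, map_add' := map_add ψ, map_smul' := hcomm ψ (map_add ψ) (map_smul ψ) hψπ }
  have : Finite (LinearMap.eqLocus ψ' LinearMap.id) :=
    inferInstanceAs (Finite (LinearMap.eqLocus ψ LinearMap.id))
  obtain ⟨-, ⟨f⟩⟩ := nonempty_equiv_fixed F L he hcard hk φ' ψ' hφ hψ hφp hψp
  refine ⟨{ toFun := f, invFun := f.symm, left_inv := f.left_inv, right_inv := f.right_inv,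
            map_add' := map_add f, map_smul' := fun a x => ?_ }, fun x y hxy i => ?_⟩
  · funext i
    apply Subtype.ext
    have h : a • x = (Polynomial.C a • (show LinearMap.eqLocus ψ' LinearMap.id from x) :
      LinearMap.eqLocus ψ' LinearMap.id) := Subtype.ext (hC a x).symm
    have h2 := congrArg (fun z => (f z i : P)) h
    refine h2.trans ?_
    change (f (Polynomial.C a • _) i : P) = a • (f x i : P)
    rw [map_smul]
    exact hC a _
  · have h : (show LinearMap.eqLocus ψ' LinearMap.id from y) =
        (Polynomial.X : Polynomial R) • (show LinearMap.eqLocus ψ' LinearMap.id from x) :=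
      Subtype.ext (hxy.trans (hX x).symm)
    have h2 := congrArg (fun z => (f z i : P)) h
    refine h2.trans ?_
    rw [map_smul]
    exact hX _

/-- Frobenius shifts the sum by one index and fixes its value `1`; comparing the two ends gives the
claim. -/
theorem pow_card_pow_eq_of_trace_eq_one (F : Type*) [Field F] [Fintype F] [Algebra F k] {N : ℕ}
    {c : k} (hc : ∑ i ∈ Finset.range N, c ^ Fintype.card F ^ i = 1) :
    c ^ Fintype.card F ^ N = c := by
  have h1 : ∑ i ∈ Finset.range N, c ^ Fintype.card F ^ (i + 1) = 1 := by
    have := congrArg (FiniteField.frobeniusAlgHom F k) hc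
    rw [map_sum, map_one] at this
    rw [← this]
    refine Finset.sum_congr rfl fun i _ => ?_
    change _ = (c ^ Fintype.card F ^ i) ^ Fintype.card F
    rw [← pow_mul, ← pow_succ]
  have h2 := Finset.sum_range_succ' (fun i => c ^ Fintype.card F ^ i) N
  rw [Finset.sum_range_succ, h1, hc, pow_zero, pow_one] at h2
  exact add_left_cancel h2

theorem iterate_smul_eq {φ : P → P} {q : ℕ} (hφ : ∀ (c : k) y, φ (c • y) = c ^ q • φ y) (n : ℕ)
    (c : k) (y : P) : φ^[n] (c • y) = c ^ q ^ n • φ^[n] y := by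
  induction n with
  | zero => simp
  | succ n ih =>
    rw [Function.iterate_succ_apply', ih, hφ, ← pow_mul, ← pow_succ, Function.iterate_succ_apply']

theorem pow_pow_mul_eq {q n : ℕ} {c : k} (hc : c ^ q ^ n = c) (i : ℕ) : c ^ q ^ (n * i) = c := by
  induction i with
  | zero => simp
  | succ i ih => rw [Nat.mul_succ, pow_add, pow_mul, ih, hc]

/-- A weight `c` of trace one is used: the sum of the `φ^i (c y)` is fixed, and since `p y` is fixed
its image is `(∑ c^{q^i}) p y = p y`. -/
theorem exists_fixed_lift (F : Type*) [Field F] [Fintype F] [Algebra F k]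
    (hk : HasSubfields (Fintype.card F) k) {P' : Type*} [AddCommGroup P'] [Module k P']
    (φ : P →+ P) (φ' : P' →+ P') (p : P →ₗ[k] P') (hp : ∀ y, p (φ y) = φ' (p y))
    (hφ : ∀ (c : k) y, φ (c • y) = c ^ Fintype.card F • φ y) {y : P} {N : ℕ} (hN : 0 < N)
    (hy : φ^[N] y = y) (hfix : φ' (p y) = p y) : ∃ z, φ z = z ∧ p z = p y := by
  obtain ⟨c, hc⟩ := exists_trace_eq_one F hk hN
  have hpiter : ∀ i, p (φ^[i] y) = p y := by
    intro i
    induction i with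
    | zero => rfl
    | succ i ih => rw [Function.iterate_succ_apply', hp, ih, hfix]
  refine ⟨∑ i ∈ Finset.range N, φ^[i] (c • y), ?_, ?_⟩
  · have h1 := Finset.sum_range_succ' (fun i => φ^[i] (c • y)) N
    rw [Finset.sum_range_succ, iterate_smul_eq hφ N, pow_card_pow_eq_of_trace_eq_one F hc, hy] at h1
    rw [map_sum]
    simp_rw [← Function.iterate_succ_apply' φ]
    exact (add_right_cancel h1).symm
  · rw [map_sum]
    simp_rw [iterate_smul_eq hφ, map_smul, hpiter]
    rw [← Finset.sum_smul, hc, one_smul]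

end FixedPoints

/-! ### Reduction modulo an ideal -/

section Reduction

variable {A M N : Type*} [CommRing A] [AddCommGroup M] [Module A M] [AddCommGroup N] [Module A N]

/-- The map `M / J M → N / J N` induced by `f`. -/
noncomputable def modMap (J : Ideal A) (f : M →ₗ[A] N) :
    (M ⧸ (J • ⊤ : Submodule A M)) →ₗ[A] N ⧸ (J • ⊤ : Submodule A N) :=
  (f.reduceModIdeal J).restrictScalars A

theorem modMap_mk (J : Ideal A) (f : M →ₗ[A] N) (x : M) :
    modMap J f (Submodule.Quotient.mk x) = Submodule.Quotient.mk (f x) := rfl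

theorem modMap_iterate (J : Ideal A) (f : M →ₗ[A] M) (n : ℕ) (x : M) :
    (modMap J f)^[n] (Submodule.Quotient.mk x) = Submodule.Quotient.mk (f^[n] x) := by
  induction n with
  | zero => rfl
  | succ n ih => rw [Function.iterate_succ_apply', ih, modMap_mk, Function.iterate_succ_apply']

variable (N) in
/-- `N / J N` with the action of `k` induced from `N`. -/
@[reducible] noncomputable def quotientModule (k : Type*) [Field k] [Module k N] [SMulCommClass A k N]
    (J : Ideal A) : Module k (N ⧸ (J • ⊤ : Submodule A N)) :=
  have : SMulCommClass k A N := SMulCommClass.symm _ _ _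
  Module.compHom _
    (({ toFun := modMap J
        map_one' := LinearMap.ext fun x => by
          obtain ⟨x, rfl⟩ := Submodule.Quotient.mk_surjective _ x
          rfl
        map_mul' := fun f g => LinearMap.ext fun x => by
          obtain ⟨x, rfl⟩ := Submodule.Quotient.mk_surjective _ x
          rfl
        map_zero' := LinearMap.ext fun x => by
          obtain ⟨x, rfl⟩ := Submodule.Quotient.mk_surjective _ x
          rfl
        map_add' := fun f g => LinearMap.ext fun x => by
          obtain ⟨x, rfl⟩ := Submodule.Quotient.mk_surjective _ x
          rfl } : Module.End A N →+* Module.End A (N ⧸ (J • ⊤ : Submodule A N))).comp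
      (Module.toModuleEnd A N))

variable {k : Type*} [Field k] [Module k N] [SMulCommClass A k N]

theorem exists_common_period_of_finite {X : Type*} [Finite X] {f : X → X}
    (hf : Function.Injective f) : ∃ n, 0 < n ∧ ∀ x, f^[n] x = x :=
  exists_common_period f id fun x => ⟨_, (hf.mem_periodicPts x).choose_spec⟩

/-- A semilinear extension of a map with finite reduction is periodic modulo `J`. -/
theorem exists_period (J : Ideal A) {q : ℕ} (halg : ∀ b : k, ∃ n, 0 < n ∧ b ^ q ^ n = b)
    (j : M →ₗ[A] N) (hspan : Submodule.span k (Set.range j) = ⊤) (τ : M →ₗ[A] M) (φ : N →ₗ[A] N)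
    (hφ : ∀ (c : k) y, φ (c • y) = c ^ q • φ y) (hj : ∀ m, φ (j m) = j (τ m))
    (hτ : ∃ n, 0 < n ∧ ∀ x, (modMap J τ)^[n] x = x)
    (y : N ⧸ (J • ⊤ : Submodule A N)) : ∃ n, 0 < n ∧ (modMap J φ)^[n] y = y := by
  have : SMulCommClass k A N := SMulCommClass.symm _ _ _
  obtain ⟨y, rfl⟩ := Submodule.Quotient.mk_surjective _ y
  obtain ⟨n₁, hn₁, h₁⟩ := hτ
  have hiter : ∀ (n : ℕ) m, φ^[n] (j m) = j (τ^[n] m) := by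
    intro n m
    induction n with
    | zero => rfl
    | succ n ih => rw [Function.iterate_succ_apply', ih, hj, Function.iterate_succ_apply']
  have hy : y ∈ Submodule.span k (Set.range j) := hspan ▸ Submodule.mem_top
  induction hy using Submodule.span_induction with
  | zero => exact ⟨1, one_pos, by rw [Function.iterate_one, modMap_mk, map_zero]⟩
  | mem x hx =>
    obtain ⟨m, rfl⟩ := hx
    refine ⟨n₁, hn₁, ?_⟩
    rw [modMap_iterate, hiter, ← modMap_mk, ← modMap_iterate, h₁, modMap_mk]
  | add x y hx hy ihx ihy =>
    obtain ⟨n, hn, h⟩ := ihx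
    obtain ⟨n', hn', h'⟩ := ihy
    refine ⟨n * n', Nat.mul_pos hn hn', ?_⟩
    rw [Submodule.Quotient.mk_add, ← Module.End.coe_pow, map_add, Module.End.coe_pow]
    rw [Function.IsPeriodicPt.mul_const (f := modMap J φ) h n',
      Function.IsPeriodicPt.const_mul (f := modMap J φ) h' n]
  | smul c x hx ih =>
    obtain ⟨n, hn, h⟩ := ih
    obtain ⟨n', hn', h'⟩ := halg c
    let _ := quotientModule N k J
    refine ⟨n' * n, Nat.mul_pos hn' hn, ?_⟩
    rw [modMap_iterate, iterate_smul_eq hφ, pow_pow_mul_eq h']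
    change c • (Submodule.Quotient.mk (φ^[n' * n] x) : N ⧸ (J • ⊤ : Submodule A N)) =
      c • (Submodule.Quotient.mk x : N ⧸ (J • ⊤ : Submodule A N))
    rw [← modMap_iterate, Function.IsPeriodicPt.const_mul (f := modMap J φ) h n']

end Reduction

end TauSheaf

namespace TauSheaf

/-! ### Descent from `M ⊗ L^sep` to `M` -/

section Descent

variable {A M N : Type*} [CommRing A] [AddCommGroup M] [Module A M] [AddCommGroup N] [Module A N]
variable {F L k : Type*} [Field F] [Fintype F] [Field L] [Fintype L] [Field k]
  [Algebra F k] [Algebra L k] [Module k N] [SMulCommClass A k N]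

/-- `N` is `M ⊗_L k` with `φ = τ ⊗ Frob_F`, `ψ = id ⊗ Frob_L` and `π_N = π_M ⊗ id`. -/
structure IsSepExtension (F L k : Type*) [Field F] [Fintype F] [Field L] [Fintype L] [Field k]
    [Algebra F k] [Algebra L k] [Module k N] [SMulCommClass A k N]
    (j : M →ₗ[A] N) (τ πM : M →ₗ[A] M) (φ ψ πN : N →ₗ[A] N) : Prop where
  span_j : Submodule.span k (Set.range j) = ⊤
  smul_j : ∀ (a : L) m, ∃ m', algebraMap L k a • j m = j m'
  retraction : ∃ ρ : N →ₗ[A] M, ∀ m, ρ (j m) = m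
  φ_smul : ∀ (c : k) y, φ (c • y) = c ^ Fintype.card F • φ y
  φ_j : ∀ m, φ (j m) = j (τ m)
  ψ_smul : ∀ (c : k) y, ψ (c • y) = c ^ Fintype.card L • ψ y
  ψ_j : ∀ m, ψ (j m) = j m
  π_smul : ∀ (c : k) y, πN (c • y) = c • πN y
  π_j : ∀ m, πN (j m) = j (πM m)
  comm : ∀ m, τ (πM m) = πM (τ m)

namespace IsSepExtension

variable {j : M →ₗ[A] N} {τ πM : M →ₗ[A] M} {φ ψ πN : N →ₗ[A] N}

theorem induction (h : IsSepExtension F L k j τ πM φ ψ πN) {p : N → Prop} (hadd : ∀ x y, p x → p y → p (x + y))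
    (hsmul : ∀ (b : k) m, p (b • j m)) (y : N) : p y := by
  suffices ∀ b : k, p (b • y) by simpa using this 1
  have hy : y ∈ Submodule.span k (Set.range j) := h.span_j ▸ Submodule.mem_top
  induction hy using Submodule.span_induction with
  | zero => intro b; rw [smul_zero, ← smul_zero (0 : k), ← map_zero j]; exact hsmul _ _
  | mem x hx => obtain ⟨m, rfl⟩ := hx; exact fun b => hsmul b m
  | add x y _ _ hx hy => intro b; rw [smul_add]; exact hadd _ _ (hx b) (hy b)
  | smul c x _ hx => intro b; rw [smul_smul]; exact hx _

theorem φ_π (h : IsSepExtension F L k j τ πM φ ψ πN) (y : N) : φ (πN y) = πN (φ y) := by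
  induction y using h.induction with
  | hadd x y hx hy => simp only [map_add, hx, hy]
  | hsmul b m => rw [h.π_smul, h.π_j, h.φ_smul, h.φ_j, h.φ_smul, h.φ_j, h.π_smul, h.π_j, h.comm]

theorem ψ_π (h : IsSepExtension F L k j τ πM φ ψ πN) (y : N) : ψ (πN y) = πN (ψ y) := by
  induction y using h.induction with
  | hadd x y hx hy => simp only [map_add, hx, hy]
  | hsmul b m => rw [h.π_smul, h.π_j, h.ψ_smul, h.ψ_j, h.ψ_smul, h.ψ_j, h.π_smul, h.π_j]

/-- On `b • j m` the `ψ`-trace is the scalar trace of `c b` times `j m`; that scalar is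
Frobenius-fixed, lies in `L`, and is absorbed into `M`. Allowing all multiples of `n` gives sums a
common length. -/
theorem exists_trace_mem_range (h : IsSepExtension F L k j τ πM φ ψ πN)
    (halg : ∀ b : k, ∃ n, 0 < n ∧ b ^ Fintype.card L ^ n = b) (y : N) :
    ∃ n, 0 < n ∧ ∀ i (c : k), c ^ Fintype.card L ^ (n * i) = c →
      ∑ t ∈ Finset.range (n * i), ψ^[t] (c • y) ∈ LinearMap.range j := by
  induction y using h.induction with
  | hadd x y hx hy =>
    obtain ⟨n, hn, h1⟩ := hx
    obtain ⟨n', hn', h2⟩ := hy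
    refine ⟨n * n', Nat.mul_pos hn hn', fun i c hc => ?_⟩
    simp_rw [smul_add, ← Module.End.coe_pow, map_add, Finset.sum_add_distrib]
    simp_rw [Module.End.coe_pow]
    refine add_mem ?_ ?_
    · rw [mul_assoc] at hc ⊢
      exact h1 _ c hc
    · rw [mul_comm n, mul_assoc] at hc ⊢
      exact h2 _ c hc
  | hsmul b m =>
    obtain ⟨n, hn, hb⟩ := halg b
    refine ⟨n, hn, fun i c hc => ?_⟩
    have hψj : ∀ t, ψ^[t] (j m) = j m := fun t => Function.iterate_fixed (h.ψ_j m) t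
    simp_rw [smul_smul, iterate_smul_eq h.ψ_smul, hψj]
    rw [← Finset.sum_smul]
    set x := c * b with hx
    have hxp : x ^ Fintype.card L ^ (n * i) = x := by rw [hx, mul_pow, hc, pow_pow_mul_eq hb]
    obtain ⟨a, ha⟩ := exists_algebraMap_eq_of_pow_card (k := k) L
      (x := ∑ t ∈ Finset.range (n * i), x ^ Fintype.card L ^ t) (by
        have h1 := Finset.sum_range_succ' (fun t => x ^ Fintype.card L ^ t) (n * i)
        rw [Finset.sum_range_succ, hxp, pow_zero, pow_one] at h1
        change FiniteField.frobeniusAlgHom L k _ = _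
        rw [map_sum, add_right_cancel h1]
        refine Finset.sum_congr rfl fun t _ => ?_
        change (x ^ Fintype.card L ^ t) ^ Fintype.card L = _
        rw [← pow_mul, ← pow_succ])
    rw [← ha]
    obtain ⟨m', hm'⟩ := h.smul_j a m
    exact ⟨m', hm'.symm⟩

/-- Galois descent for `M ⊗_L k` modulo `J`. -/
theorem bijective_fixed (h : IsSepExtension F L k j τ πM φ ψ πN)
    (hk : HasSubfields (Fintype.card L) k)
    (halg : ∀ b : k, ∃ n, 0 < n ∧ b ^ Fintype.card L ^ n = b) (J : Ideal A) :
    Function.Injective (modMap J j) ∧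
      ∀ y, modMap J ψ y = y → ∃ x, modMap J j x = y := by
  constructor
  · obtain ⟨ρ, hρ⟩ := h.retraction
    refine Function.LeftInverse.injective (g := modMap J ρ) fun x => ?_
    obtain ⟨x, rfl⟩ := Submodule.Quotient.mk_surjective _ x
    rw [modMap_mk, modMap_mk, hρ]
  · intro y hy
    obtain ⟨y, rfl⟩ := Submodule.Quotient.mk_surjective _ y
    -- The trace of `c y`, with `c` of trace one, comes from `M`, and it agrees with `y` modulo `J`
    -- because `y` is fixed there.
    obtain ⟨n, hn, h1⟩ := h.exists_trace_mem_range halg y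
    obtain ⟨c, hc⟩ := exists_trace_eq_one L hk hn
    obtain ⟨m, hm⟩ := h1 1 c (by rw [mul_one]; exact pow_card_pow_eq_of_trace_eq_one L hc)
    refine ⟨Submodule.Quotient.mk m, ?_⟩
    let _ := quotientModule N k J
    have hmk : ∀ (c : k) (y : N), (Submodule.Quotient.mk (c • y) : N ⧸ (J • ⊤ : Submodule A N)) =
      c • Submodule.Quotient.mk y := fun _ _ => rfl
    rw [modMap_mk, hm, mul_one, ← Submodule.mkQ_apply, map_sum]
    simp_rw [iterate_smul_eq h.ψ_smul, Submodule.mkQ_apply, hmk, ← modMap_iterate,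
      Function.iterate_fixed hy]
    rw [← Finset.sum_smul, hc, one_smul]

theorem exists_period (h : IsSepExtension F L k j τ πM φ ψ πN)
    (halg : ∀ b : k, ∃ n, 0 < n ∧ b ^ Fintype.card F ^ n = b)
    (J : Ideal A) [Finite (M ⧸ (J • ⊤ : Submodule A M))] (hτ : Function.Injective (modMap J τ))
    (y : N ⧸ (J • ⊤ : Submodule A N)) : ∃ n, 0 < n ∧ (modMap J φ)^[n] y = y :=
  TauSheaf.exists_period J halg j h.span_j τ φ h.φ_smul h.φ_j
    (exists_common_period_of_finite hτ) y

/-- `M / J` is identified with the `ψ`-fixed points of `N / J`, which are then compared with the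
`φ`-fixed points. -/
theorem exists_equiv (h : IsSepExtension F L k j τ πM φ ψ πN) {e : ℕ} (he : 0 < e)
    (hcard : Fintype.card L = Fintype.card F ^ e) (hk : HasSubfields (Fintype.card F) k)
    (halg : ∀ b : k, ∃ n, 0 < n ∧ b ^ Fintype.card F ^ n = b)
    (J : Ideal A) [Finite (M ⧸ (J • ⊤ : Submodule A M))] (hτ : Function.Injective (modMap J τ)) :
    ∃ f : (M ⧸ (J • ⊤ : Submodule A M)) ≃ₗ[A]
        (Fin e → LinearMap.eqLocus (modMap J φ) LinearMap.id),
      ∀ x i, (f (modMap J πM x) i : N ⧸ (J • ⊤ : Submodule A N)) = modMap J πN (f x i) := by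
  have hkL : HasSubfields (Fintype.card L) k := hcard ▸ hk.pow he
  have halgL : ∀ b : k, ∃ n, 0 < n ∧ b ^ Fintype.card L ^ n = b := fun b => by
    obtain ⟨n, hn, hb⟩ := halg b
    exact ⟨n, hn, by rw [hcard, ← pow_mul, mul_comm, pow_pow_mul_eq hb]⟩
  obtain ⟨hinj, hsurj⟩ := h.bijective_fixed hkL halgL J
  have hfix : ∀ x, modMap J ψ (modMap J j x) = modMap J j x := fun x => by
    obtain ⟨x, rfl⟩ := Submodule.Quotient.mk_surjective _ x
    rw [modMap_mk, modMap_mk, h.ψ_j]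
  let g : (M ⧸ (J • ⊤ : Submodule A M)) ≃ₗ[A] LinearMap.eqLocus (modMap J ψ) LinearMap.id :=
    LinearEquiv.ofBijective ((modMap J j).codRestrict _ hfix)
      ⟨fun x y hxy => hinj (congrArg Subtype.val hxy), fun y => by
        obtain ⟨x, hx⟩ := hsurj y.1 y.2
        exact ⟨x, Subtype.ext hx⟩⟩
  have : Finite (LinearMap.eqLocus (modMap J ψ) LinearMap.id) := Finite.of_equiv _ g.toEquiv
  let _ := quotientModule N k J
  have hmk : ∀ (c : k) (y : N), c • (Submodule.Quotient.mk y : N ⧸ (J • ⊤ : Submodule A N)) =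
      Submodule.Quotient.mk (c • y) := fun _ _ => rfl
  have : SMulCommClass A k (N ⧸ (J • ⊤ : Submodule A N)) := ⟨fun a c y => by
    obtain ⟨y, rfl⟩ := Submodule.Quotient.mk_surjective _ y
    rw [hmk, ← Submodule.Quotient.mk_smul, ← Submodule.Quotient.mk_smul, hmk, smul_comm]⟩
  have hψp := TauSheaf.exists_period J halgL j h.span_j LinearMap.id ψ h.ψ_smul h.ψ_j
    ⟨1, one_pos, fun x => by
      obtain ⟨x, rfl⟩ := Submodule.Quotient.mk_surjective _ x
      rfl⟩
  obtain ⟨f, hf⟩ := exists_equiv_fixed_commute F L he hcard hk (modMap J φ) (modMap J ψ) (modMap J πN)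
    (fun c y => by
      obtain ⟨y, rfl⟩ := Submodule.Quotient.mk_surjective _ y
      rw [hmk, modMap_mk, modMap_mk, hmk, h.φ_smul])
    (fun c y => by
      obtain ⟨y, rfl⟩ := Submodule.Quotient.mk_surjective _ y
      rw [hmk, modMap_mk, modMap_mk, hmk, h.ψ_smul])
    (fun c y => by
      obtain ⟨y, rfl⟩ := Submodule.Quotient.mk_surjective _ y
      rw [hmk, modMap_mk, modMap_mk, hmk, h.π_smul])
    (fun y => by
      obtain ⟨y, rfl⟩ := Submodule.Quotient.mk_surjective _ y
      rw [modMap_mk, modMap_mk, modMap_mk, modMap_mk, h.φ_π])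
    (fun y => by
      obtain ⟨y, rfl⟩ := Submodule.Quotient.mk_surjective _ y
      rw [modMap_mk, modMap_mk, modMap_mk, modMap_mk, h.ψ_π])
    (h.exists_period halg J hτ) hψp
  refine ⟨g.trans f, fun x i => hf (g x) (g (modMap J πM x)) ?_ i⟩
  obtain ⟨x, rfl⟩ := Submodule.Quotient.mk_surjective _ x
  change modMap J j (modMap J πM _) = modMap J πN (modMap J j _)
  rw [modMap_mk, modMap_mk, modMap_mk, modMap_mk, h.π_j]

/-- Invariants lift along `N / J → N / J'`. -/
theorem exists_lift (h : IsSepExtension F L k j τ πM φ ψ πN) (hk : HasSubfields (Fintype.card F) k)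
    (halg : ∀ b : k, ∃ n, 0 < n ∧ b ^ Fintype.card F ^ n = b) {J J' : Ideal A}
    (hJ : (J • ⊤ : Submodule A N) ≤ J' • ⊤)
    [Finite (M ⧸ (J • ⊤ : Submodule A M))] (hτ : Function.Injective (modMap J τ))
    (y : N ⧸ (J' • ⊤ : Submodule A N)) (hy : modMap J' φ y = y) :
    ∃ z, modMap J φ z = z ∧ Submodule.factor hJ z = y := by
  obtain ⟨y, rfl⟩ := Submodule.Quotient.mk_surjective _ y
  let _ := quotientModule N k J
  let _ := quotientModule N k J'
  obtain ⟨n, hn, hper⟩ := h.exists_period halg J hτ (Submodule.Quotient.mk y)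
  let p : (N ⧸ (J • ⊤ : Submodule A N)) →ₗ[k] N ⧸ (J' • ⊤ : Submodule A N) :=
    { toFun := Submodule.factor hJ
      map_add' := map_add _
      map_smul' := fun c x => by
        obtain ⟨x, rfl⟩ := Submodule.Quotient.mk_surjective _ x
        rfl }
  exact exists_fixed_lift F hk (modMap J φ).toAddMonoidHom (modMap J' φ).toAddMonoidHom p
    (fun x => by
      obtain ⟨x, rfl⟩ := Submodule.Quotient.mk_surjective _ x
      rfl)
    (fun c x => by
      obtain ⟨x, rfl⟩ := Submodule.Quotient.mk_surjective _ x
      exact congrArg Submodule.Quotient.mk (h.φ_smul c x)) hn hper hy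

end IsSepExtension

end Descent

end TauSheaf

/-! ### Passage to the limit over the powers of an ideal -/

namespace TauSheaf

/-- An inverse sequence of nonempty finite sets has a nonempty limit. -/
theorem exists_compatible_sequence (S : ℕ → Type*) [∀ n, Finite (S n)] [∀ n, Nonempty (S n)]
    (t : ∀ n, S (n + 1) → S n) : ∃ s : ∀ n, S n, ∀ n, t n (s (n + 1)) = s n := by
  let _ : ∀ n, TopologicalSpace (S n) := fun n => ⊥
  have : ∀ n, DiscreteTopology (S n) := fun n => ⟨rfl⟩
  -- Sequences compatible below index `n`: closed in a compact product, decreasing in `n`, and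
  -- nonempty since any value at `n` can be pushed down by `t`.
  let K : ℕ → Set (∀ n, S n) := fun n => {s | ∀ m < n, t m (s (m + 1)) = s m}
  have hK : ∀ n (a : S n), ∃ s ∈ K n, s n = a := by
    intro n
    induction n with
    | zero =>
      intro a
      refine ⟨Function.update (fun n => Classical.arbitrary _) 0 a, fun m hm => ?_, ?_⟩
      · exact absurd hm m.not_lt_zero
      · exact Function.update_self _ _ _
    | succ n ih =>
      intro a
      obtain ⟨s, hs, hsn⟩ := ih (t n a)
      refine ⟨Function.update s (n + 1) a, fun m hm => ?_, Function.update_self _ _ _⟩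
      rw [Function.update_of_ne hm.ne]
      rcases (Nat.lt_succ_iff.1 hm).lt_or_eq with h | rfl
      · rw [Function.update_of_ne (by omega)]
        exact hs m h
      · rw [Function.update_self, hsn]
  have hclosed : ∀ n, IsClosed (K n) := fun n => by
    have h : K n = ⋂ m, ⋂ (_ : m < n), {s : ∀ n, S n | t m (s (m + 1)) = s m} := by
      ext s
      simp [K]
    rw [h]
    exact isClosed_iInter fun m => isClosed_iInter fun _ => isClosed_eq
      (continuous_of_discreteTopology.comp (continuous_apply _)) (continuous_apply _)
  obtain ⟨s, hs⟩ := IsCompact.nonempty_iInter_of_sequence_nonempty_isCompact_isClosed K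
    (fun n s hs m hm => hs m (hm.trans n.lt_succ_self))
    (fun n => by
      obtain ⟨s, hs, -⟩ := hK n (Classical.arbitrary _)
      exact ⟨s, hs⟩) (hclosed 0).isCompact hclosed
  exact ⟨s, fun n => Set.mem_iInter.1 hs (n + 1) n n.lt_succ_self⟩

section Tower

variable {A M N : Type*} [CommRing A] [AddCommGroup M] [Module A M] [AddCommGroup N] [Module A N]

theorem pow_succ_smul_top_le (I : Ideal A) (n : ℕ) (N : Type*) [AddCommGroup N] [Module A N] :
    (I ^ (n + 1) • ⊤ : Submodule A N) ≤ I ^ n • ⊤ :=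
  Submodule.smul_mono_left (Ideal.pow_le_pow_right n.le_succ)

theorem transitionMap_succ (I : Ideal A) {m n : ℕ} (hmn : m ≤ n)
    (x : M ⧸ (I ^ (n + 1) • ⊤ : Submodule A M)) :
    AdicCompletion.transitionMap I M (hmn.trans n.le_succ) x =
      AdicCompletion.transitionMap I M hmn (AdicCompletion.transitionMap I M n.le_succ x) := by
  obtain ⟨x, rfl⟩ := Submodule.Quotient.mk_surjective _ x
  rfl

theorem mk_smul_eq (J : Ideal A) (a : A) (x : M ⧸ (J • ⊤ : Submodule A M)) :
    (Ideal.Quotient.mk (J • ⊤ : Ideal A) a) • x = a • x := by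
  obtain ⟨x, rfl⟩ := Submodule.Quotient.mk_surjective _ x
  rfl

theorem factor_modMap {J J' : Ideal A} (h : (J • ⊤ : Submodule A M) ≤ J' • ⊤)
    (h' : (J • ⊤ : Submodule A N) ≤ J' • ⊤) (f : M →ₗ[A] N) (x : M ⧸ (J • ⊤ : Submodule A M)) :
    Submodule.factor h' (modMap J f x) = modMap J' f (Submodule.factor h x) := by
  obtain ⟨x, rfl⟩ := Submodule.Quotient.mk_surjective _ x
  rfl

/-- A levelwise comparison of `M / J` with the `e`-th power of the `φ`-invariants of `N / J`. -/
structure LevelEquiv (πM : M →ₗ[A] M) (φ πN : N →ₗ[A] N) (e : ℕ) (J : Ideal A) where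
  equiv : (M ⧸ (J • ⊤ : Submodule A M)) ≃ₗ[A]
    (Fin e → LinearMap.eqLocus (modMap J φ) LinearMap.id)
  comm : ∀ x i, (equiv (modMap J πM x) i : N ⧸ (J • ⊤ : Submodule A N)) = modMap J πN (equiv x i)

variable {πM : M →ₗ[A] M} {φ πN : N →ₗ[A] N} {e : ℕ}

theorem LevelEquiv.finite {J : Ideal A} [Finite (M ⧸ (J • ⊤ : Submodule A M))] :
    Finite (LevelEquiv πM φ πN e J) := by
  rcases isEmpty_or_nonempty (LevelEquiv πM φ πN e J) with h | ⟨⟨f⟩⟩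
  · infer_instance
  · have : Finite (Fin e → LinearMap.eqLocus (modMap J φ) LinearMap.id) :=
      Finite.of_equiv _ f.equiv.toEquiv
    refine Finite.of_injective (β := (M ⧸ (J • ⊤ : Submodule A M)) →
      (Fin e → LinearMap.eqLocus (modMap J φ) LinearMap.id)) (fun g => g.equiv) fun g g' h => ?_
    cases g
    cases g'
    congr 1
    exact LinearEquiv.ext fun x => congrFun h x

/-- The level equivalences are not canonical, so they have to be made into an inverse system. Fixed
points modulo `J'` lift and are killed by `J'`, so `f` induces a surjection modulo `J'`. -/
theorem LevelEquiv.exists_reduction {J J' : Ideal A} (hJ : J ≤ J')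
    [Finite (M ⧸ (J' • ⊤ : Submodule A M))] (hne : Nonempty (LevelEquiv πM φ πN e J'))
    (hlift : ∀ y, modMap J' φ y = y →
      ∃ z, modMap J φ z = z ∧ Submodule.factor (Submodule.smul_mono_left hJ) z = y)
    (f : LevelEquiv πM φ πN e J) :
    ∃ g : LevelEquiv πM φ πN e J', ∀ x i,
      (g.equiv (Submodule.factor (Submodule.smul_mono_left hJ) x) i : N ⧸ (J' • ⊤ : Submodule A N)) =
        Submodule.factor (Submodule.smul_mono_left hJ) (f.equiv x i : N ⧸ (J • ⊤ : Submodule A N)) := by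
  obtain ⟨g₀⟩ := hne
  set pM : (M ⧸ (J • ⊤ : Submodule A M)) →ₗ[A] M ⧸ (J' • ⊤ : Submodule A M) :=
    Submodule.factor (Submodule.smul_mono_left hJ)
  set pN : (N ⧸ (J • ⊤ : Submodule A N)) →ₗ[A] N ⧸ (J' • ⊤ : Submodule A N) :=
    Submodule.factor (Submodule.smul_mono_left hJ)
  have hpN : ∀ x, modMap J' φ (pN x) = pN (modMap J φ x) := fun x =>
    (factor_modMap _ _ φ x).symm
  let r : LinearMap.eqLocus (modMap J φ) LinearMap.id →ₗ[A]
      LinearMap.eqLocus (modMap J' φ) LinearMap.id :=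
    (pN ∘ₗ Submodule.subtype _).codRestrict _ fun x => by
      change modMap J' φ (pN x) = pN x
      rw [hpN, show modMap J φ x = x from x.2]
  have hr : Function.Surjective r := fun y => by
    obtain ⟨z, hz, hzy⟩ := hlift y.1 y.2
    exact ⟨⟨z, hz⟩, Subtype.ext hzy⟩
  let h : M →ₗ[A] (Fin e → LinearMap.eqLocus (modMap J' φ) LinearMap.id) :=
    LinearMap.pi fun i => r ∘ₗ LinearMap.proj i ∘ₗ f.equiv.toLinearMap ∘ₗ Submodule.mkQ _
  have hh : ∀ x i, (h x i : N ⧸ (J' • ⊤ : Submodule A N)) =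
    pN (f.equiv (Submodule.Quotient.mk x) i) := fun _ _ => rfl
  have hker : (J' • ⊤ : Submodule A M) ≤ LinearMap.ker h := by
    refine Submodule.smul_le.2 fun a ha x _ => funext fun i => Subtype.ext ?_
    rw [map_smul, Pi.smul_apply, Submodule.coe_smul]
    obtain ⟨y, hy⟩ := Submodule.Quotient.mk_surjective _ (h x i : N ⧸ (J' • ⊤ : Submodule A N))
    rw [← hy, ← Submodule.Quotient.mk_smul]
    exact (Submodule.Quotient.mk_eq_zero _).2 (Submodule.smul_mem_smul ha Submodule.mem_top)
  let g := (J' • ⊤ : Submodule A M).liftQ h hker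
  have hg : ∀ x, g (Submodule.Quotient.mk x) = h x := fun _ => rfl
  have hsurj : Function.Surjective g := by
    intro y
    choose z hz using fun i => hr (y i)
    obtain ⟨x, hx⟩ := f.equiv.surjective z
    obtain ⟨x, rfl⟩ := Submodule.Quotient.mk_surjective _ x
    refine ⟨Submodule.Quotient.mk x, funext fun i => ?_⟩
    rw [← hz, ← hx]
    rfl
  have : Finite (Fin e → LinearMap.eqLocus (modMap J' φ) LinearMap.id) :=
    Finite.of_equiv _ g₀.equiv.toEquiv
  -- The given equivalence `g₀` serves only to compare cardinalities.
  have hbij : Function.Bijective g :=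
    (Nat.bijective_iff_surjective_and_card g).2 ⟨hsurj, Nat.card_congr g₀.equiv.toEquiv⟩
  refine ⟨⟨LinearEquiv.ofBijective g hbij, fun x i => ?_⟩, fun x i => ?_⟩
  · obtain ⟨x, rfl⟩ := Submodule.Quotient.mk_surjective _ x
    change (g (modMap J' πM (Submodule.Quotient.mk x)) i : N ⧸ (J' • ⊤ : Submodule A N)) =
      modMap J' πN (g (Submodule.Quotient.mk x) i)
    rw [modMap_mk, hg, hg, hh, hh, ← modMap_mk, f.comm]
    exact factor_modMap _ _ πN _
  · obtain ⟨x, rfl⟩ := Submodule.Quotient.mk_surjective _ x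
    rfl

/-- The comparison of `lim M / I^n` with the `e`-th power of the `φ`-invariants of
`lim N / I^n`. -/
theorem exists_completion_equiv (I : Ideal A) [∀ n, Finite (M ⧸ (I ^ n • ⊤ : Submodule A M))]
    (hne : ∀ n, Nonempty (LevelEquiv πM φ πN e (I ^ n)))
    (hlift : ∀ n y, modMap (I ^ n) φ y = y → ∃ z, modMap (I ^ (n + 1)) φ z = z ∧
      Submodule.factor (pow_succ_smul_top_le I n N) z = y) :
    ∃ Θ : AdicCompletion I M ≃ₗ[AdicCompletion I A]
        (Fin e → LinearMap.eqLocus (AdicCompletion.map I φ) LinearMap.id),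
      ∀ x i, (Θ (AdicCompletion.map I πM x) i : AdicCompletion I N) =
        AdicCompletion.map I πN (Θ x i) := by
  have := fun n => LevelEquiv.finite (πM := πM) (φ := φ) (πN := πN) (e := e) (J := I ^ n)
  -- Each level has finitely many equivalences and at least one, so a compatible sequence can be
  -- picked in the limit.
  choose t ht using fun n => LevelEquiv.exists_reduction (πM := πM) (φ := φ) (πN := πN) (e := e)
    (Ideal.pow_le_pow_right (I := I) n.le_succ) (hne n) (hlift n)
  obtain ⟨f, hf⟩ := exists_compatible_sequence (fun n => LevelEquiv πM φ πN e (I ^ n)) t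
  have hstep : ∀ n x i, ((f n).equiv (AdicCompletion.transitionMap I M n.le_succ x) i :
      N ⧸ (I ^ n • ⊤ : Submodule A N)) =
      AdicCompletion.transitionMap I N n.le_succ ((f (n + 1)).equiv x i) := fun n x i => by
    rw [← hf n]
    exact ht n (f (n + 1)) x i
  have hcompat : ∀ m n (hmn : m ≤ n) x i,
      ((f m).equiv (AdicCompletion.transitionMap I M hmn x) i : N ⧸ (I ^ m • ⊤ : Submodule A N)) =
      AdicCompletion.transitionMap I N hmn ((f n).equiv x i) := by
    intro m n hmn
    induction n, hmn using Nat.le_induction with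
    | base =>
      intro x i
      obtain ⟨x, rfl⟩ := Submodule.Quotient.mk_surjective _ x
      obtain ⟨y, hy⟩ := Submodule.Quotient.mk_surjective _
        ((f m).equiv (Submodule.Quotient.mk x) i : N ⧸ (I ^ m • ⊤ : Submodule A N))
      rw [← hy]
      exact hy.symm
    | succ n hmn ih =>
      intro x i
      rw [transitionMap_succ I hmn, ih, hstep, ← transitionMap_succ I hmn]
  have hfix : ∀ n x i, modMap (I ^ n) φ ((f n).equiv x i) = (f n).equiv x i := fun n x i =>
    ((f n).equiv x i).2
  let Θ : AdicCompletion I M →ₗ[AdicCompletion I A]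
      (Fin e → LinearMap.eqLocus (AdicCompletion.map I φ) LinearMap.id) :=
    { toFun := fun x i => ⟨⟨fun n => (f n).equiv (x.val n) i, fun {m n} hmn => by
          rw [← hcompat, x.2 hmn]⟩, AdicCompletion.ext fun n => hfix n _ i⟩
      map_add' := fun x y => funext fun i => Subtype.ext <| AdicCompletion.ext fun n => by
        change ((f n).equiv (x.val n + y.val n) i : N ⧸ (I ^ n • ⊤ : Submodule A N)) =
          (f n).equiv (x.val n) i + (f n).equiv (y.val n) i
        rw [map_add]
        rfl
      map_smul' := fun a x => funext fun i => Subtype.ext <| AdicCompletion.ext fun n => by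
        obtain ⟨b, hb⟩ := Ideal.Quotient.mk_surjective (a.val n)
        change ((f n).equiv (a.val n • x.val n) i : N ⧸ (I ^ n • ⊤ : Submodule A N)) =
          a.val n • ((f n).equiv (x.val n) i : N ⧸ (I ^ n • ⊤ : Submodule A N))
        rw [← hb, mk_smul_eq, mk_smul_eq, map_smul]
        rfl }
  have hΘ : ∀ x i n, (Θ x i : AdicCompletion I N).val n = (f n).equiv (x.val n) i :=
    fun _ _ _ => rfl
  have hbij : Function.Bijective Θ := by
    constructor
    · intro x y hxy
      refine AdicCompletion.ext fun n => (f n).equiv.injective (funext fun i => Subtype.ext ?_)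
      rw [← hΘ, ← hΘ, hxy]
    · intro y
      have hy : ∀ i n, modMap (I ^ n) φ ((y i : AdicCompletion I N).val n) =
          (y i : AdicCompletion I N).val n := fun i n =>
        congrArg (fun z : AdicCompletion I N => z.val n) (y i).2
      let x : ∀ n, M ⧸ (I ^ n • ⊤ : Submodule A M) := fun n =>
        (f n).equiv.symm fun i => ⟨(y i : AdicCompletion I N).val n, hy i n⟩
      have hx : ∀ n i, ((f n).equiv (x n) i : N ⧸ (I ^ n • ⊤ : Submodule A N)) =
          (y i : AdicCompletion I N).val n := fun n i => by
        rw [LinearEquiv.apply_symm_apply]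
      refine ⟨⟨x, fun {m n} hmn => (f m).equiv.injective (funext fun i => Subtype.ext ?_)⟩,
        funext fun i => Subtype.ext <| AdicCompletion.ext fun n => hx n i⟩
      rw [hcompat, hx, hx]
      exact (y i : AdicCompletion I N).2 hmn
  exact ⟨LinearEquiv.ofBijective Θ hbij, fun x i => AdicCompletion.ext fun n =>
    (f n).comm (x.val n) i⟩

end Tower

end TauSheaf

namespace TauSheaf

universe w

/-! ### The `τ`-module modulo powers of `v` -/

open IsDedekindDomain

variable {Fq Q : Type*} [Field Fq] [Fintype Fq] [Field Q] [Algebra Fq Q] {C : PointedCurve Fq Q}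
variable {L : Type*} [Field L] [Algebra Fq L] [Finite L] {c : Characteristic C L}

/-- The residue field is of finite type over `F_q`, hence finite by the Nullstellensatz; powers
follow since `A` is noetherian. -/
theorem finite_quotient_pow (v : HeightOneSpectrum C.A) (n : ℕ) : Finite (C.A ⧸ v.asIdeal ^ n) := by
  have := v.isMaximal
  let := Ideal.Quotient.field v.asIdeal
  have : Algebra.FiniteType Fq (C.A ⧸ v.asIdeal) :=
    Algebra.FiniteType.of_surjective (Ideal.Quotient.mkₐ Fq v.asIdeal)
      (Ideal.Quotient.mkₐ_surjective Fq v.asIdeal)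
  have : Module.Finite Fq (C.A ⧸ v.asIdeal) := finite_of_finite_type_of_isJacobsonRing _ _
  have : Finite (C.A ⧸ v.asIdeal) := Module.finite_of_finite Fq
  exact Ideal.finite_quotient_pow (IsNoetherian.noetherian _) n

omit [Fintype Fq] [Finite L] in
theorem ext_induction (R : Subalgebra Fq Q) {p : ext L R → Prop} (hadd : ∀ x y, p x → p y → p (x + y))
    (hmul : ∀ (b : L) (a : R), p (algebraMap L (ext L R) b * toExt L R a)) (z : ext L R) : p z := by
  obtain ⟨z, t, rfl⟩ := z
  induction t using TensorProduct.induction_on with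
  | zero =>
    have h := hmul 0 0
    rw [map_zero, zero_mul] at h
    convert h
    exact Subtype.ext (map_zero _)
  | tmul b a =>
    convert hmul b a
    apply Subtype.ext
    change _ = (b ⊗ₜ[Fq] (1 : Q)) * ((1 : L) ⊗ₜ[Fq] (a : Q))
    simp
  | add x y hx hy =>
    convert hadd _ _ hx hy
    exact Subtype.ext (map_add _ _ _)

omit [Fintype Fq] in
theorem finite_AL : Module.Finite C.A (C.AL L) := by
  refine ⟨Submodule.fg_def.2 ⟨Set.range (algebraMap L (C.AL L)), Set.finite_range _,
    eq_top_iff.2 fun z _ => ?_⟩⟩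
  induction z using ext_induction with
  | hadd x y hx hy => exact add_mem (hx trivial) (hy trivial)
  | hmul b a =>
    rw [mul_comm, ← RingHom.algebraMap_toAlgebra (toExt L C.A), ← Algebra.smul_def]
    exact Submodule.smul_mem _ _ (Submodule.subset_span ⟨b, rfl⟩)

namespace AbelianTauSheaf

theorem finite_M (F : AbelianTauSheaf.{w} C c) : Module.Finite C.A F.M := by
  have := finite_AL (C := C) (L := L)
  have := (F.isLocallyFree 0).finite_aff
  exact Module.Finite.trans (C.AL L) _

theorem finite_quotient_M (F : AbelianTauSheaf.{w} C c) (v : HeightOneSpectrum C.A) (n : ℕ) :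
    Finite (F.M ⧸ (v.asIdeal ^ n • ⊤ : Submodule C.A F.M)) := by
  have := F.finite_M
  have := finite_quotient_pow v n
  have : Module.Finite (C.A ⧸ v.asIdeal ^ n) (F.M ⧸ (v.asIdeal ^ n • ⊤ : Submodule C.A F.M)) :=
    Module.Finite.of_restrictScalars_finite C.A _ _
  exact Module.finite_of_finite (C.A ⧸ v.asIdeal ^ n)

/-- Frobenius is onto on the finite field `L`, so the image of `τ_0` is already stable under `A_L`
and no span is needed. -/
theorem exists_tau_eq_smul (F : AbelianTauSheaf.{w} C c) (z : C.AL L) {x : (F.F 0).V}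
    (hx : x ∈ (F.F 0).aff) : ∃ y ∈ (F.F 0).aff, F.tau 0 y = z • F.tau 0 x := by
  induction z using ext_induction with
  | hadd z z' hz hz' =>
    obtain ⟨y, hy, h⟩ := hz
    obtain ⟨y', hy', h'⟩ := hz'
    exact ⟨y + y', add_mem hy hy', by rw [map_add, h, h', add_smul]⟩
  | hmul b a =>
    obtain ⟨b, rfl⟩ : ∃ b', frobL Fq L b' = b :=
      (Finite.injective_iff_surjective.1 (frobL Fq L).injective) b
    refine ⟨(algebraMap L (C.AL L) b * toExt L C.A a) • x, Submodule.smul_mem _ _ hx, ?_⟩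
    change F.tau 0 (((b ⊗ₜ[Fq] (1 : Q)) * ((1 : L) ⊗ₜ[Fq] (a : Q))) • x) =
      (((frobL Fq L b) ⊗ₜ[Fq] (1 : Q)) * ((1 : L) ⊗ₜ[Fq] (a : Q))) • F.tau 0 x
    rw [LinearMap.map_smulₛₗ, map_mul, sigma_tmul, sigma_tmul, map_one]

/-- The `d`-th power of the graph ideal kills the cokernel of `τ_0`, and `Π_0` is an isomorphism on
affine sections. -/
theorem exists_tauM_eq (F : AbelianTauSheaf.{w} C c) {a : C.A} (ha : toExt L C.A a ∈ c.graphAff)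
    (m : F.M) : ∃ x, F.tauM x = a ^ F.d • m := by
  have h1 : toExt L C.A (a ^ F.d) • (F.affPi m : (F.F (0 + 1)).V) ∈
      Submodule.span (C.AL L) (F.tau 0 '' (F.F 0).aff) := by
    refine F.annihilates_aff 0 (Submodule.smul_mem_smul ?_ (F.affPi m).2)
    rw [map_pow]
    exact Ideal.pow_mem_pow ha _
  have h2 : ∀ y ∈ Submodule.span (C.AL L) (F.tau 0 '' (F.F 0).aff),
      ∃ x ∈ (F.F 0).aff, F.tau 0 x = y := by
    intro y hy
    induction hy using Submodule.span_induction with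
    | zero => exact ⟨0, zero_mem _, map_zero _⟩
    | mem y hy => exact hy
    | add x y _ _ hx hy =>
      obtain ⟨x, hx, rfl⟩ := hx
      obtain ⟨y, hy, rfl⟩ := hy
      exact ⟨x + y, add_mem hx hy, map_add _ _ _⟩
    | smul z y _ hy =>
      obtain ⟨x, hx, rfl⟩ := hy
      exact F.exists_tau_eq_smul z hx
  obtain ⟨x, hx, hxy⟩ := h2 _ h1
  refine ⟨⟨x, hx⟩, F.affPi_bijective.1 ?_⟩
  have h3 : ∀ y, F.affPi (F.tauM y) = F.affTau y := fun y =>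
    (LinearEquiv.ofBijective F.affPi F.affPi_bijective).apply_symm_apply _
  rw [h3]
  refine Subtype.ext (hxy.trans ?_)
  change _ = F.Pi 0 (toExt L C.A (a ^ F.d) • (m : (F.F 0).V))
  exact ((F.Pi 0).map_smul _ _).symm

-- As `v` is maximal and `v ≠ ε`, some `a ∈ v` has `c^*(a) ≠ 0`, and `b = a ^ (s - 1)` maps to `1`
-- in `L`. If the characteristic is `∞`, the graph does not meet the affine part and `b = 0` works.
omit [Fintype Fq] in
theorem exists_one_sub_mem_graphAff (v : HeightOneSpectrum C.A) (hv : ¬ c.IsPoint v) :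
    ∃ b ∈ v.asIdeal, toExt L C.A (1 - b) ∈ c.graphAff := by
  cases c with
  | infinity => exact ⟨0, zero_mem _, Submodule.mem_top⟩
  | affine cstar =>
    have := Fintype.ofFinite L
    have hle : ¬ v.asIdeal ≤ RingHom.ker cstar := fun h =>
      hv (v.isMaximal.eq_of_le (RingHom.ker_ne_top _) h)
    obtain ⟨a, ha, ha0⟩ := SetLike.not_le_iff_exists.1 hle
    refine ⟨a ^ (Fintype.card L - 1), Ideal.pow_mem_of_mem _ ha _
      (Nat.sub_pos_of_lt Fintype.one_lt_card), ?_⟩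
    have h1 : cstar (a ^ (Fintype.card L - 1)) = 1 := by
      rw [map_pow, FiniteField.pow_card_sub_one_eq_one _ ha0]
    have h2 : toExt L C.A (a ^ (Fintype.card L - 1)) -
        algebraMap L (C.AL L) (cstar (a ^ (Fintype.card L - 1))) ∈
        (Characteristic.affine cstar).graphAff := Ideal.subset_span ⟨_, rfl⟩
    rw [h1, map_one, ← neg_mem_iff, neg_sub] at h2
    rwa [map_sub, map_one]

/-- `τ` is bijective modulo powers of `v ≠ ε`. -/
theorem modMap_tauM_injective (F : AbelianTauSheaf.{w} C c) (v : HeightOneSpectrum C.A)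
    (hv : ¬ c.IsPoint v) (n : ℕ) : Function.Injective (modMap (v.asIdeal ^ n) F.tauM) := by
  have := F.finite_quotient_M v n
  refine Finite.injective_iff_surjective.2 fun y => ?_
  obtain ⟨m, rfl⟩ := Submodule.Quotient.mk_surjective _ y
  obtain ⟨b, hb, hgraph⟩ := exists_one_sub_mem_graphAff v hv
  obtain ⟨x, hx⟩ := F.exists_tauM_eq hgraph m
  -- The geometric sum `w` inverts `1 - b` modulo `v^n`, as `w (1 - b) = 1 - b^n`. So `w^d • x` maps
  -- to `(1 - b^n)^d • m`, which is `m` modulo `v^n`.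
  have hw := geom_sum_mul_neg b n
  set w := ∑ i ∈ Finset.range n, b ^ i
  refine ⟨Submodule.Quotient.mk (w ^ F.d • x), ?_⟩
  rw [modMap_mk, map_smul, hx, smul_smul, ← mul_pow, hw, Submodule.Quotient.eq]
  have h1 : (1 - b ^ n) ^ F.d - 1 ∈ v.asIdeal ^ n := by
    rw [← Ideal.Quotient.eq_zero_iff_mem, map_sub, map_pow, map_sub,
      Ideal.Quotient.eq_zero_iff_mem.2 (Ideal.pow_mem_pow hb n), map_one, sub_zero, one_pow, sub_self]
  have h2 := Submodule.smul_mem_smul h1 (Submodule.mem_top (x := m))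
  rwa [sub_smul, one_smul] at h2

/-! ## The tensor product with the separable closure -/

-- The field `L(b)` is finite.
variable (Fq) in
theorem exists_pow_card_pow_eq (b : SeparableClosure L) :
    ∃ n, 0 < n ∧ b ^ Fintype.card Fq ^ n = b := by
  have halg : IsIntegral L b := (Algebra.IsAlgebraic.isAlgebraic b).isIntegral
  let K := IntermediateField.adjoin L {b}
  have : FiniteDimensional L K := IntermediateField.adjoin.finiteDimensional halg
  have : Module.Finite Fq L := Module.Finite.of_finite
  have : Module.Finite Fq K := Module.Finite.trans L K
  have : Finite K := Module.finite_of_finite L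
  have := Fintype.ofFinite K
  refine ⟨Module.finrank Fq K, Module.finrank_pos, ?_⟩
  rw [← Module.card_eq_pow_finrank (K := Fq) (V := K)]
  exact congrArg Subtype.val (FiniteField.pow_card (⟨b, IntermediateField.mem_adjoin_simple_self L b⟩ : K))

/-- The action of `L^sep` on `M ⊗_L L^sep`. -/
noncomputable def sepHom (F : AbelianTauSheaf.{w} C c) : SeparableClosure L →+* Module.End C.A F.Msep where
  toFun b := F.mapSep (φ := RingHom.id L) LinearMap.id (fun _ _ => rfl) (LinearMap.mulLeft L b)
  map_one' := LinearMap.ext fun x => by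
    induction x using Msep.induction with
    | zero => simp
    | add x y hx hy => rw [map_add, map_add, hx, hy]
    | tmul m b => rw [mapSep_tmulSep]; simp
  map_mul' b b' := LinearMap.ext fun x => by
    induction x using Msep.induction with
    | zero => simp
    | add x y hx hy => rw [map_add, map_add, hx, hy]
    | tmul m b => rw [Module.End.mul_apply, mapSep_tmulSep, mapSep_tmulSep, mapSep_tmulSep]; simp
  map_zero' := LinearMap.ext fun x => by
    induction x using Msep.induction with
    | zero => simp
    | add x y hx hy => rw [map_add, map_add, hx, hy]
    | tmul m b =>
      rw [mapSep_tmulSep]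
      simp only [LinearMap.mulLeft_apply, zero_mul, LinearMap.zero_apply]
      exact TensorProduct.tmul_zero _ _
  map_add' b b' := LinearMap.ext fun x => by
    induction x using Msep.induction with
    | zero => simp
    | add x y hx hy => rw [map_add, map_add, hx, hy]
    | tmul m b =>
      rw [LinearMap.add_apply, mapSep_tmulSep, mapSep_tmulSep, mapSep_tmulSep]
      simp only [LinearMap.mulLeft_apply, add_mul]
      exact TensorProduct.tmul_add _ _ _

noncomputable instance (F : AbelianTauSheaf.{w} C c) : Module (SeparableClosure L) F.Msep :=
  Module.compHom _ F.sepHom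

theorem smul_sep_tmulSep (F : AbelianTauSheaf.{w} C c) (b b' : SeparableClosure L) (m : F.M) :
    b • F.tmulSep m b' = F.tmulSep m (b * b') := rfl

instance (F : AbelianTauSheaf.{w} C c) : SMulCommClass C.A (SeparableClosure L) F.Msep :=
  ⟨fun a b x => (map_smul (F.sepHom b) a x).symm⟩

/-- The inclusion `M → M ⊗_L L^sep`. -/
noncomputable def toMsep (F : AbelianTauSheaf.{w} C c) : F.M →ₗ[C.A] F.Msep where
  toFun m := F.tmulSep m 1
  map_add' m m' := TensorProduct.add_tmul m m' 1
  map_smul' a m := (F.smul_tmulSep a m 1).symm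

theorem tmulSep_eq (F : AbelianTauSheaf.{w} C c) (m : F.M) (b : SeparableClosure L) :
    F.tmulSep m b = b • F.toMsep m := by
  change _ = b • F.tmulSep m 1
  rw [smul_sep_tmulSep, mul_one]

/-- The `s`-Frobenius of `L^sep`, acting on the second factor of `M ⊗_L L^sep`. -/
noncomputable def frobS (F : AbelianTauSheaf.{w} C c) [Fintype L] : F.Msep →ₗ[C.A] F.Msep :=
  F.mapSep (φ := RingHom.id L) LinearMap.id (fun _ _ => rfl)
    (FiniteField.frobeniusAlgHom L (SeparableClosure L)).toLinearMap

theorem mapSep_smul (F : AbelianTauSheaf.{w} C c) {φ : L →+* L} (f : F.M →ₗ[C.A] F.M)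
    (hf : ∀ (b : L) x, f (b • x) = φ b • f x) (g : SeparableClosure L →ₛₗ[φ] SeparableClosure L)
    {b b' : SeparableClosure L} (hg : ∀ x, g (b * x) = b' * g x) (x : F.Msep) :
    F.mapSep f hf g (b • x) = b' • F.mapSep f hf g x := by
  induction x using Msep.induction with
  | zero => rw [smul_zero, map_zero, smul_zero]
  | add x y hx hy => rw [smul_add, map_add, map_add, hx, hy, smul_add]
  | tmul m x => rw [smul_sep_tmulSep, mapSep_tmulSep, mapSep_tmulSep, smul_sep_tmulSep, hg]

theorem isSepExtension (F : AbelianTauSheaf.{w} C c) [Fintype L] :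
    IsSepExtension Fq L (SeparableClosure L) F.toMsep F.tauM F.frobM F.tauSep F.frobS F.frobSep where
  span_j := eq_top_iff.2 fun x _ => by
    induction x using Msep.induction with
    | zero => exact zero_mem _
    | add x y hx hy => exact add_mem (hx trivial) (hy trivial)
    | tmul m b =>
      rw [tmulSep_eq]
      exact Submodule.smul_mem _ _ (Submodule.subset_span ⟨m, rfl⟩)
  smul_j a m := ⟨a • m, by
    rw [← tmulSep_eq, Algebra.algebraMap_eq_smul_one]
    exact (TensorProduct.smul_tmul a m 1).symm⟩
  retraction := by
    -- An `L`-linear splitting of `L → L^sep` induces an `A`-linear retraction, which keeps `M → M ⊗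
    -- L^sep` injective modulo every ideal.
    obtain ⟨l, hl⟩ := (Algebra.linearMap L (SeparableClosure L)).exists_leftInverse_of_injective
      (LinearMap.ker_eq_bot.2 (algebraMap L (SeparableClosure L)).injective)
    have hl1 : l 1 = 1 := by
      have := LinearMap.congr_fun hl 1
      simpa using this
    let ρ : F.Msep →+ F.M := ((TensorProduct.rid L F.M).toLinearMap ∘ₗ l.lTensor F.M).toAddMonoidHom
    have hρ : ∀ m b, ρ (F.tmulSep m b) = l b • m := fun m b => rfl
    refine ⟨{ ρ with map_smul' := fun a x => ?_ }, fun m => ?_⟩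
    · change ρ (a • x) = a • ρ x
      induction x using Msep.induction with
      | zero => rw [smul_zero, map_zero, smul_zero]
      | add x y hx hy => rw [smul_add, map_add, map_add, hx, hy, smul_add]
      | tmul m b => rw [smul_tmulSep, hρ, hρ, smul_comm]
    · exact (hρ m 1).trans (by rw [hl1, one_smul])
  φ_smul b y := F.mapSep_smul _ _ _ (fun x => map_mul (FiniteField.frobeniusAlgHom Fq _) b x) y
  φ_j m := by
    change F.mapSep _ _ _ (F.tmulSep m 1) = F.tmulSep _ 1
    rw [mapSep_tmulSep]
    exact congrArg _ (map_one (FiniteField.frobeniusAlgHom Fq (SeparableClosure L)))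
  ψ_smul b y := F.mapSep_smul _ _ _ (fun x => map_mul (FiniteField.frobeniusAlgHom L _) b x) y
  ψ_j m := by
    change F.mapSep _ _ _ (F.tmulSep m 1) = F.tmulSep _ 1
    rw [mapSep_tmulSep]
    exact congrArg _ (map_one (FiniteField.frobeniusAlgHom L (SeparableClosure L)))
  π_smul b y := F.mapSep_smul _ _ _ (fun x => rfl) y
  π_j m := rfl
  comm m := by
    rw [frobM, ← Module.End.mul_apply, ← Module.End.mul_apply, ← pow_succ', ← pow_succ]

/-- The Tate module of `F` over a field with `q ^ e` elements: the `e`-th power of `T_v F` is the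
`v`-adic completion of `M`. -/
theorem exists_completion_equiv_tateModule (F : AbelianTauSheaf.{w} C c) (v : HeightOneSpectrum C.A)
    (hv : ¬ c.IsPoint v) :
    ∃ Θ : AdicCompletion v.asIdeal F.M ≃ₗ[Av v] (Fin (Module.finrank Fq L) → F.tateModule v),
      ∀ x i, Θ (AdicCompletion.map v.asIdeal F.frobM x) i = F.tateFrob v (Θ x i) := by
  have := Fintype.ofFinite L
  have : Module.Finite Fq L := Module.Finite.of_finite
  have := F.finite_quotient_M v
  have hk := hasSubfields_of_isSepClosed Fq (SeparableClosure L)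
  have hτ := F.modMap_tauM_injective v hv
  have halg := exists_pow_card_pow_eq Fq (L := L)
  obtain ⟨Θ, hΘ⟩ := exists_completion_equiv (e := Module.finrank Fq L) (πM := F.frobM)
    (φ := F.tauSep) (πN := F.frobSep) v.asIdeal
    (fun n => by
      obtain ⟨f, hf⟩ := F.isSepExtension.exists_equiv Module.finrank_pos
        Module.card_eq_pow_finrank hk halg (v.asIdeal ^ n) (hτ n)
      exact ⟨⟨f, hf⟩⟩)
    (fun n => F.isSepExtension.exists_lift hk halg _ (hτ (n + 1)))
  exact ⟨Θ, fun x i => Subtype.ext (hΘ x i)⟩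

end AbelianTauSheaf

end TauSheaf

namespace TauSheaf

universe w

/-! ### Base change through the completion -/

section BaseChange

variable {A : Type*} [CommRing A] {M : Type*} [AddCommGroup M] [Module A M]

theorem cancelBaseChange_baseChange {B K : Type*} [CommRing B] [CommRing K] [Algebra A B] [Algebra A K]
    [Algebra B K] [IsScalarTower A B K] (f : M →ₗ[A] M) (x : K ⊗[B] (B ⊗[A] M)) :
    TensorProduct.AlgebraTensorModule.cancelBaseChange A B K K M ((f.baseChange B).baseChange K x) =
      f.baseChange K (TensorProduct.AlgebraTensorModule.cancelBaseChange A B K K M x) := by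
  induction x using TensorProduct.induction_on with
  | zero => simp only [map_zero]
  | add x y hx hy => simp only [map_add, hx, hy]
  | tmul a x =>
    induction x using TensorProduct.induction_on with
    | zero => simp only [TensorProduct.tmul_zero, map_zero]
    | add x y hx hy => simp only [TensorProduct.tmul_add, map_add, hx, hy]
    | tmul b m => simp

theorem baseChange_equiv_comm {B K X Y : Type*} [CommRing B] [CommRing K] [Algebra B K]
    [AddCommGroup X] [Module B X] [AddCommGroup Y] [Module B Y] (E : X ≃ₗ[B] Y) (f : X →ₗ[B] X)
    (g : Y →ₗ[B] Y) (h : ∀ x, E (f x) = g (E x)) (x : K ⊗[B] X) :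
    E.baseChange B K X Y (f.baseChange K x) = g.baseChange K (E.baseChange B K X Y x) := by
  induction x using TensorProduct.induction_on with
  | zero => simp only [map_zero]
  | add x y hx hy => simp only [map_add, hx, hy]
  | tmul a x =>
    change a ⊗ₜ E (f x) = a ⊗ₜ g (E x)
    rw [h]

theorem exists_cancelBaseChange_equiv {B : Type*} (K : Type*) [CommRing B] [CommRing K] [Algebra A B]
    [Algebra A K] [Algebra B K] [IsScalarTower A B K] {Y : Type*} [AddCommGroup Y] [Module B Y]
    (E : B ⊗[A] M ≃ₗ[B] Y) (f : M →ₗ[A] M) (g : Y →ₗ[B] Y)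
    (h : ∀ x, E (f.baseChange B x) = g (E x)) :
    ∃ G : K ⊗[B] Y ≃ₗ[K] K ⊗[A] M, ∀ y, G (g.baseChange K y) = f.baseChange K (G y) := by
  refine ⟨(E.baseChange B K _ _).symm.trans
    (TensorProduct.AlgebraTensorModule.cancelBaseChange A B K K M), fun y => ?_⟩
  obtain ⟨x, rfl⟩ := (E.baseChange B K _ _).surjective y
  rw [← baseChange_equiv_comm E _ _ h, LinearEquiv.trans_apply, LinearEquiv.trans_apply,
    LinearEquiv.symm_apply_apply, LinearEquiv.symm_apply_apply, cancelBaseChange_baseChange]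

/-- The module is replaced by an isomorphic quotient of `A ^ n`, which lives in the universe of `A`,
and naturality carries the result back. -/
theorem ofTensorProduct_bijective [IsNoetherianRing A] (I : Ideal A) [Module.Finite A M] :
    Function.Bijective (AdicCompletion.ofTensorProduct I M) := by
  obtain ⟨n, p, hp⟩ := Module.Finite.exists_fin' A M
  let e : M ≃ₗ[A] ((Fin n → A) ⧸ LinearMap.ker p) := (p.quotKerEquivOfSurjective hp).symm
  have h := AdicCompletion.ofTensorProduct_bijective_of_finite_of_isNoetherian I
    ((Fin n → A) ⧸ LinearMap.ker p)
  have h1 : ∀ x, AdicCompletion.congr I e (AdicCompletion.ofTensorProduct I M x) =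
      AdicCompletion.ofTensorProduct I _ (e.baseChange A (AdicCompletion I A) _ _ x) := fun x =>
    LinearMap.congr_fun (AdicCompletion.ofTensorProduct_naturality I e.toLinearMap) x
  have h2 := h.comp (e.baseChange A (AdicCompletion I A) _ _).bijective
  refine ((AdicCompletion.congr I e).bijective.of_comp_iff' _).1 ?_
  rwa [show ⇑(AdicCompletion.congr I e) ∘ ⇑(AdicCompletion.ofTensorProduct I M) = _ from funext h1]

/-- Both sides are `K ⊗_A M`, reached once through the completion of `A` and once through `Q`; both
identifications respect `f`. -/
theorem exists_baseChange_equiv [IsNoetherianRing A] (I : Ideal A) [Module.Finite A M]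
    {Q V : Type*} [Field Q] [Algebra A Q] [AddCommGroup V] [Module Q V] [Module A V]
    [IsScalarTower A Q V] {i : M →ₗ[A] V} (hi : IsBaseChange Q i) (K : Type*) [Field K]
    [Algebra (AdicCompletion I A) K] [Algebra A K] [Algebra Q K]
    [IsScalarTower A (AdicCompletion I A) K] [IsScalarTower A Q K]
    (f : M →ₗ[A] M) (g : V →ₗ[Q] V) (h : ∀ m, i (f m) = g (i m)) :
    ∃ E : K ⊗[AdicCompletion I A] AdicCompletion I M ≃ₗ[K] K ⊗[Q] V,
      ∀ x, E ((AdicCompletion.map I f).baseChange K x) = g.baseChange K (E x) := by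
  have h₁ : ∀ x, AdicCompletion.ofTensorProduct I M (f.baseChange _ x) =
      AdicCompletion.map I f (AdicCompletion.ofTensorProduct I M x) := fun x =>
    (LinearMap.congr_fun (AdicCompletion.ofTensorProduct_naturality I f) x).symm
  have h₂ : ∀ x, hi.equiv (f.baseChange Q x) = g (hi.equiv x) := fun x => by
    induction x using TensorProduct.induction_on with
    | zero => simp only [map_zero]
    | add x y hx hy => simp only [map_add, hx, hy]
    | tmul a x => rw [LinearMap.baseChange_tmul, hi.equiv_tmul, hi.equiv_tmul, h, map_smul]
  obtain ⟨G₁, hG₁⟩ := exists_cancelBaseChange_equiv K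
    (LinearEquiv.ofBijective _ (ofTensorProduct_bijective (M := M) I)) f (AdicCompletion.map I f) h₁
  obtain ⟨G₂, hG₂⟩ := exists_cancelBaseChange_equiv K hi.equiv f g h₂
  refine ⟨G₁.trans G₂.symm, fun x => ?_⟩
  rw [LinearEquiv.trans_apply, hG₁, LinearEquiv.symm_apply_eq, hG₂, LinearEquiv.trans_apply,
    LinearEquiv.apply_symm_apply]

theorem finite_of_equiv_pi {K W X : Type*} [Semiring K] [AddCommMonoid W] [Module K W]
    [AddCommMonoid X] [Module K X] [Module.Finite K W] {e : ℕ} (he : 0 < e)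
    (G : W ≃ₗ[K] (Fin e → X)) : Module.Finite K X :=
  Module.Finite.of_surjective (LinearMap.proj (⟨0, he⟩ : Fin e) ∘ₗ G.toLinearMap)
    ((Function.surjective_eval _).comp G.surjective)

end BaseChange

open IsDedekindDomain

variable {Fq Q : Type*} [Field Fq] [Fintype Fq] [Field Q] [Algebra Fq Q] {C : PointedCurve Fq Q}
variable {L : Type*} [Field L] [Algebra Fq L] [Finite L] {c : Characteristic C L}

/-! ### Comparison at `v` and the dimension count -/

namespace AbelianTauSheaf

theorem phi_coe (F : AbelianTauSheaf.{w} C c) (m : F.M) : F.phi (m : (F.F 0).V) = F.tauM m := by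
  apply F.injective_Pi 0
  rw [Pi_phi]
  have h3 : F.affPi (F.tauM m) = F.affTau m :=
    (LinearEquiv.ofBijective F.affPi F.affPi_bijective).apply_symm_apply _
  exact (congrArg Subtype.val h3).symm

theorem phi_pow_coe (F : AbelianTauSheaf.{w} C c) (n : ℕ) (m : F.M) :
    (F.phi ^ n) (m : (F.F 0).V) = ((F.tauM ^ n) m : F.M) := by
  induction n with
  | zero => rfl
  | succ n ih =>
    rw [pow_succ', pow_succ', Module.End.mul_apply, Module.End.mul_apply, ih, phi_coe]

/-- `V_0` is the localization of `M` at the nonzero elements of `A`: denominators of generic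
sections can be cleared. -/
theorem isBaseChange_aff (F : AbelianTauSheaf.{w} C c) :
    IsBaseChange Q ((F.F 0).aff.subtype.restrictScalars C.A : F.M →ₗ[C.A] (F.F 0).V) := by
  rw [← isLocalizedModule_iff_isBaseChange (nonZeroDivisors C.A) Q]
  have hne : ∀ s : nonZeroDivisors C.A, ((s : C.A) : Q) ≠ 0 := fun s => by
    simp
  refine ⟨fun s => ?_, fun y => ?_, fun {x y} h => ?_⟩
  · rw [Module.End.isUnit_iff]
    have hinj : Function.Injective fun y : (F.F 0).V => ((s : C.A) : Q) • y :=
      smul_right_injective _ (hne s)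
    exact ⟨hinj, fun y => ⟨((s : C.A) : Q)⁻¹ • y, smul_inv_smul₀ (hne s) y⟩⟩
  · let S : Submonoid Q :=
      { carrier := {s | s ∈ C.A ∧ s ≠ 0}
        mul_mem' := fun h h' => ⟨C.A.mul_mem h.1 h'.1, mul_ne_zero h.2 h'.2⟩
        one_mem' := ⟨C.A.one_mem, one_ne_zero⟩ }
    obtain ⟨s, hs, h⟩ := exists_smul_mem S (fun s hs => hs.1) (fun a => by
      obtain ⟨b, hb, hba⟩ := exists_mul_mem_A C a
      exact ⟨b, ⟨b.2, by simpa using hb⟩, hba⟩) (F.F 0).aff (F.isLocallyFree 0).span_aff y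
    exact ⟨(⟨s • y, h⟩, ⟨⟨s, hs.1⟩, mem_nonZeroDivisors_of_ne_zero fun h0 => hs.2 (congrArg Subtype.val h0)⟩), rfl⟩
  · exact ⟨1, by rw [one_smul, one_smul]; exact Subtype.ext h⟩

omit [Fintype Fq] in
/-- The embedding of `Q` into its completion `Q_v`. -/
theorem exists_ringHom_Qv (v : HeightOneSpectrum C.A) : ∃ ι : Q →+* Qv v,
    ∀ a : C.A, ι a = algebraMap (Av v) (Qv v) (algebraMap C.A (Av v) a) := by
  have := IsHausdorff.of_isDomain v.asIdeal v.isPrime.ne_top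
  have hinj : Function.Injective ((algebraMap (Av v) (Qv v)).comp (algebraMap C.A (Av v))) :=
    (IsFractionRing.injective (Av v) (Qv v)).comp (AdicCompletion.of_injective v.asIdeal C.A)
  exact ⟨IsFractionRing.lift hinj, IsFractionRing.lift_algebraMap hinj⟩

/-- The `e` copies of the Tate module make up the completion of `M`, and after extension to `Q_v`
this completion is the extended generic fibre. -/
theorem exists_equiv_rationalTateModule (F : AbelianTauSheaf.{w} C c) (v : HeightOneSpectrum C.A)
    (hv : ¬ c.IsPoint v) [Algebra Q (Qv v)]
    (halg : ∀ a : C.A,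
      algebraMap Q (Qv v) a = algebraMap (Av v) (Qv v) (algebraMap C.A (Av v) a)) :
    ∃ G : Qv v ⊗[Q] (F.F 0).V ≃ₗ[Qv v] (Fin (Module.finrank Fq L) → F.rationalTateModule v),
      ∀ x, G ((F.phi ^ Module.finrank Fq L).baseChange (Qv v) x) =
        piEnd (Module.finrank Fq L) (F.piv v) (G x) := by
  have := F.finite_M
  have : IsScalarTower C.A (Av v) (Qv v) := IsScalarTower.of_algebraMap_eq halg
  obtain ⟨Θ, hΘ⟩ := F.exists_completion_equiv_tateModule v hv
  obtain ⟨E, hE⟩ := exists_baseChange_equiv v.asIdeal F.isBaseChange_aff (Qv v) F.frobM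
    (F.phi ^ Module.finrank Fq L) (fun m => (F.phi_pow_coe _ m).symm)
  let H : Qv v ⊗[Av v] AdicCompletion v.asIdeal F.M ≃ₗ[Qv v]
      (Fin (Module.finrank Fq L) → F.rationalTateModule v) :=
    (Θ.baseChange _ (Qv v) _ _).trans (TensorProduct.piRight (Av v) (Qv v) (Qv v) _)
  have hH : ∀ x, H ((AdicCompletion.map v.asIdeal F.frobM).baseChange (Qv v) x) =
      piEnd _ (F.piv v) (H x) := by
    intro x
    induction x using TensorProduct.induction_on with
    | zero => simp only [map_zero]
    | add x y hx hy => simp only [map_add, hx, hy]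
    | tmul a x =>
      funext i
      change a ⊗ₜ[Av v] (Θ (AdicCompletion.map v.asIdeal F.frobM x) i) =
        a ⊗ₜ[Av v] (F.tateFrob v (Θ x i))
      rw [hΘ]
  refine ⟨E.symm.trans H, fun x => ?_⟩
  obtain ⟨x, rfl⟩ := E.surjective x
  rw [← hE, LinearEquiv.trans_apply, LinearEquiv.trans_apply, LinearEquiv.symm_apply_apply,
    LinearEquiv.symm_apply_apply, hH]

/-- The intertwining maps of `φ ^ e` and `φ' ^ e` have dimension `e²` times the `L`-linear ones of
`φ`, `φ'`, and over `Q_v` they have dimension `e²` times those of `π_v`, `π_v'`. -/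
theorem rank_QHom_eq (F F' : AbelianTauSheaf.{w} C c) (hweight : F.weight = F'.weight)
    (v : HeightOneSpectrum C.A) (hv : ¬ c.IsPoint v)
    (hss : (F.piv v).IsSemisimple) (hss' : (F'.piv v).IsSemisimple) :
    Module.rank Q (QHom F F') = (rPairing (charPoly (F.piv v)) (charPoly (F'.piv v)) : ℕ) := by
  have := Fintype.ofFinite L
  have : Module.Finite Fq L := Module.Finite.of_finite
  have := F.finite_Q 0
  have := F'.finite_Q 0
  obtain ⟨ι, hι⟩ := exists_ringHom_Qv v
  let _ : Algebra Q (Qv v) := ι.toAlgebra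
  set e := Module.finrank Fq L with he
  have he0 : 0 < e := Module.finrank_pos
  obtain ⟨G, hG⟩ := F.exists_equiv_rationalTateModule v hv hι
  obtain ⟨G', hG'⟩ := F'.exists_equiv_rationalTateModule v hv hι
  -- Finite dimension makes `charPoly` the genuine characteristic polynomial instead of its default
  -- value `0`.
  have : Module.Finite (Qv v) (F.rationalTateModule v) :=
    finite_of_equiv_pi he0 G
  have : Module.Finite (Qv v) (F'.rationalTateModule v) :=
    finite_of_equiv_pi he0 G'
  have h1 := finrank_intertwiners_piEnd e (F.piv v) (F'.piv v)
  have h2 := (intertwinersCongr G G' hG hG').finrank_eq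
  have h3 := finrank_intertwiners_baseChange (Qv v) (F.phi ^ e) (F'.phi ^ e)
  have h4 := finrank_intertwiners_eq_mul F.phi F'.phi F.phi_smul_L F'.phi_smul_L F.phi_bijective
      (algebraMap_smul_eq _) (algebraMap_smul_eq _)
  have h5 := finrank_linearIntertwiners_pow F.phi F'.phi F.phi_smul_L F'.phi_smul_L F.phi_bijective
      (algebraMap_smul_eq _)
  rw [← h2, h3, h4, h5] at h1
  rw [rank_QHom F F' hweight, ← finrank_intertwiners_of_isSemisimple _ _ hss hss',
    Nat.eq_of_mul_eq_mul_left he0 (Nat.eq_of_mul_eq_mul_left he0 h1)]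

end AbelianTauSheaf

end TauSheaf

theorem mainTheorem6 {Fq Q L : Type*} [Field Fq] [Fintype Fq] [Field Q] [Algebra Fq Q]
    [Field L] [Algebra Fq L] [Finite L]
    (C : TauSheaf.PointedCurve Fq Q) (c : TauSheaf.Characteristic C L)
    (F F' : TauSheaf.AbelianTauSheaf C c) (hweight : F.weight = F'.weight)
    (v : IsDedekindDomain.HeightOneSpectrum C.A) (hv : ¬ c.IsPoint v)
    (hss : (F.piv v).IsSemisimple) (hss' : (F'.piv v).IsSemisimple) :
    Module.rank Q (TauSheaf.AbelianTauSheaf.QHom F F') =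
      (TauSheaf.rPairing (TauSheaf.charPoly (F.piv v)) (TauSheaf.charPoly (F'.piv v)) : ℕ) :=
  TauSheaf.AbelianTauSheaf.rank_QHom_eq F F' hweight v hv hss hss'
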